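/- **Setting.** Write $\widehat f(y)=\int_{\mathbb R}e^{-iyx}f(x)\,dx$. Let $\phi,\psi:\mathbb R\to\mathbb C$ be continuous, and suppose each of them is bounded a.e. by $\Phi(|x|)$ for some nonincreasing $\Phi:[0,\infty)\to\mathbb R$ (depending on the function) with $\int_{\mathbb R}\Phi(|x|)\,dx<\infty$. Let $\phi\in L_2(\mathbb R)$ be an $f$-wavelet, i.e. $\widehat\phi(0)\neq0$, $\widehat\phi$ is continuous at $0$, $\sum_{k\in\mathbb Z}|\widehat\phi(y+2\pi k)|^2=1$ a.e., and $\widehat\phi(y)=m_0(y/2)\widehat\phi(y/2)$ a.e. for some $2\pi$-periodic $m_0\in L_2([0,2\pi])$; and let $\psi$ be the corresponding $m$-wavelet, $\widehat\psi(y)=\overline{m_0(y/2+\pi)}\,e^{-iy/2}\,\widehat\phi(y/2)$. Put $\phi_{jk}(x)=2^{j/2}\phi(2^jx-k)$, $\psi_{jk}(x)=2^{j/2}\psi(2^jx-k)$. Assume: 1. $\widehat\phi'$ and $\widehat\psi''$ exist, $\widehat\psi(0)=\widehat\psi'(0)=0$; 2. $c_\phi=\sup|\widehat\phi|<\infty$,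 $c_{\phi'}=\sup|\widehat\phi'|<\infty$, $\widehat\psi'\in L^1(\mathbb R)$, $c_{\psi''}=\sup|\widehat\psi''|<\infty$; 3. $\widehat\phi(u)\to0$ and $\widehat\psi(u)\to0$ as $u\to\pm\infty$; 4. for some $0<\gamma<\frac12$ and $\alpha>\frac12$, $\int(\ln(1+|u|))^\alpha|\widehat\psi(u)|^\gamma du<\infty$ and $\int(\ln(1+|u|))^\alpha|\widehat\phi(u)|^\gamma du<\infty$. Let $R$ be a covariance function with spectral density $\widehat R\ge0$, $R(t)=\frac1{2\pi}\int e^{itz}\widehat R(z)\,dz$, such that 5. $\sup\widehat R<\infty$; 6. $\widehat R$ is differentiable, $\int|\widehat R'(z)|\,dz<\infty$ and $\int|\widehat R^{(p)}(z)||z|^4dz<\infty$ for $p=0,1$. Let $T>0$. Let $X(t)$, $t\in\mathbb R$, be a centered (real- or complex-valued) Gaussian process with $\mathbf E X(s)\overline{X(t)}=R(s-t)$, separable on $[0,T]$. With the mean-square integrals $\xi_{0k}=\int X\,\overline{\phi_{0k}}\,dt$ and $\eta_{jk}=\int X\,\overline{\psi_{jk}}\,dt$, put $$X_{n,\mathbf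 k_n}(t)=\sum_{|k|\le k_0'}\xi_{0k}\phi_{0k}(t)+\sum_{j=0}^{n-1}\sum_{|k|\le k_j}\eta_{jk}\psi_{jk}(t).$$ **Constants.** Let $$A^\psi=\tfrac{c_{\psi''}^2}{2\pi}\int\left(|\widehat R'(z)||z|^4+2|\widehat R(z)||z|^3\right)dz,\qquad A_1^\psi=\tfrac{c_{\psi''}^2}{2\pi}\int|\widehat R(z)||z|^4dz,$$ $$A^\phi=\tfrac1{2\pi}\left(c_\phi^2\int|\widehat R'|+2c_\phi c_{\phi'}\int|\widehat R|\right),\qquad A_1^\phi=\tfrac{c_\phi^2}{2\pi}\int|\widehat R|,$$ $B_1^f=\frac1{2\pi}\left(\int|\widehat f'|+T\int|\widehat f|\right)$ for $f\in\{\phi,\psi\}$, $c_2=\int|\widehat\psi|$, $\zeta(s)=\sum_{m\ge1}m^{-s}$, and $$A=B_1^\psi\left(6A^\psi\zeta(\tfrac32)+4A_1^\psi\right)^{1/2},$$ $$C=(2+\sqrt2)\left(3A^\psi(B_1^\psi)^2\zeta(\tfrac32)^2+\left(A_1^\psi(B_1^\psi)^2+\tfrac{c_2A^\psi B_1^\psi}{\pi}\right)\zeta(2)+\tfrac{c_2^2A_1^\psi}{32\pi^2}\right)^{1/2}.$$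 **Theorem.** There are constants $B,c\ge0$, depending only on $\phi,\psi,\alpha,\gamma$, $T$ and the covariance function, where $B=B_1^\phi\left(6A^\phi\zeta(\frac32)+4A_1^\phi\right)^{1/2}$ if $\widehat\phi'\in L^1(\mathbb R)$, such that the following holds with $$\varepsilon_{\mathbf k_n}=\sum_{j=0}^{n-1}\frac{A}{2^{j/2}\sqrt{k_j}}+\frac{B}{\sqrt{k_0'}}+\frac{C}{2^{n/2}},\qquad \sigma(h)=\frac{c}{\left(\ln(e^\alpha+\frac1h)\right)^\alpha},$$ $$\delta(\varepsilon)=\frac{g}{\sqrt2}\left(\sqrt{\ln(T+1)}+\left(1-\tfrac1{2\alpha}\right)^{-1}\left(\tfrac{c}{g}\right)^{\frac1{2\alpha}}\right),\quad g=\min\left(\varepsilon,\sigma(\tfrac T2)\right)$$ ($\delta(\varepsilon)=0$ if $g=0$). For all $n\ge1$, $k_0'\ge1$ and $k_0,\dots,k_{n-1}\ge1$: (a) the error $Y=X-X_{n,\mathbf k_n}$ satisfies $\left(\mathbf E|Y(t)-Y(s)|^2\right)^{1/2}\le\sigma(|t-s|)$ for all distinct $s,t\in[0,T]$; (b) for every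 $u>8\delta(\varepsilon_{\mathbf k_n})$, $$P\left\{\sup_{t\in[0,T]}|X(t)-X_{n,\mathbf k_n}(t)|>u\right\}\le2\exp\left\{-\frac{\left(u-\sqrt{8u\,\delta(\varepsilon_{\mathbf k_n})}\right)^2}{2\varepsilon_{\mathbf k_n}^2}\right\},$$ where for $\varepsilon_{\mathbf k_n}=0$ the right-hand side is read as $2$. Moreover $\varepsilon_{\mathbf k_n}\to0$ as $n$, $k_0'$ and all $k_j$ tend to infinity (along any sequence with all $k_j\ge1$), and for every $u>0$ there are $\kappa,\varepsilon_0>0$ such that the probability in (b) is at most $2\exp\{-\kappa/\varepsilon_{\mathbf k_n}^2\}$ whenever $\varepsilon_{\mathbf k_n}\le\varepsilon_0$ (again read as $2$ for $\varepsilon_{\mathbf k_n}=0$). -/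

import Mathlib

open MeasureTheory ProbabilityTheory Filter Topology
open scoped ENNReal ComplexConjugate

noncomputable section

namespace WaveletExpansion

/-! ### Wavelets -/

/-- The Fourier transform `∫ e^{-iyx} f(x) dx`. -/
def ft (f : ℝ → ℂ) (y : ℝ) : ℂ :=
  ∫ x : ℝ, Complex.exp (-(Complex.I * (y : ℂ) * (x : ℂ))) * f x

/-- Assumption S: `f` has an integrable radially decreasing majorant. -/
def AssumptionS (f : ℝ → ℂ) : Prop :=
  ∃ Φ : ℝ → ℝ, AntitoneOn Φ (Set.Ici 0) ∧ (∀ᵐ x : ℝ, ‖f x‖ ≤ Φ |x|) ∧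
    Integrable (fun x : ℝ => Φ |x|)

/-- `φ` is an `f`-wavelet and `ψ` is the corresponding `m`-wavelet. Both are assumed continuous and
subject to Assumption S (so that they are integrable and square integrable); the last clause says
that `ψ` is the inverse Fourier transform of `y ↦ conj m₀(y/2 + π) e^{-iy/2} φ̂(y/2)`. -/
structure IsWaveletPair (φ ψ : ℝ → ℂ) : Prop where
  memLp_scaling : MemLp φ 2 volume
  continuous_scaling : Continuous φ
  continuous_wavelet : Continuous ψ
  assumptionS_scaling : AssumptionS φ
  assumptionS_wavelet : AssumptionS ψ
  ft_zero_ne : ft φ 0 ≠ 0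
  ft_continuousAt_zero : ContinuousAt (ft φ) 0
  partition : ∀ᵐ y : ℝ, HasSum (fun k : ℤ => ‖ft φ (y + 2 * Real.pi * (k : ℝ))‖ ^ 2) 1
  exists_filter : ∃ m₀ : ℝ → ℂ,
    Function.Periodic m₀ (2 * Real.pi) ∧
    MemLp m₀ 2 (volume.restrict (Set.Icc 0 (2 * Real.pi))) ∧
    (∀ᵐ y : ℝ, ft φ y = m₀ (y / 2) * ft φ (y / 2)) ∧
    (∀ᵐ y : ℝ, ft ψ y =
      conj (m₀ (y / 2 + Real.pi)) * Complex.exp (-(Complex.I * (y : ℂ) / 2)) * ft φ (y / 2))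

/-- `f_{jk}(x) = 2^{j/2} f(2^j x - k)`. -/
def dilate (f : ℝ → ℂ) (j : ℕ) (k : ℤ) (x : ℝ) : ℂ :=
  (((2 : ℝ) ^ ((j : ℝ) / 2) : ℝ) : ℂ) * f ((2 : ℝ) ^ j * x - (k : ℝ))

/-- The conditions on the wavelet basis, with the exponents `α` (of the logarithm) and `γ`. -/
structure WaveletConditions (φ ψ : ℝ → ℂ) (α γ : ℝ) : Prop where
  differentiable_ft_scaling : Differentiable ℝ (ft φ)
  differentiable_ft_wavelet : Differentiable ℝ (ft ψ)
  differentiable_deriv_ft_wavelet : Differentiable ℝ (deriv (ft ψ))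
  ft_wavelet_zero : ft ψ 0 = 0
  deriv_ft_wavelet_zero : deriv (ft ψ) 0 = 0
  bdd_ft_scaling : BddAbove (Set.range fun u => ‖ft φ u‖)
  bdd_deriv_ft_scaling : BddAbove (Set.range fun u => ‖deriv (ft φ) u‖)
  integrable_deriv_ft_wavelet : Integrable (deriv (ft ψ))
  bdd_deriv2_ft_wavelet : BddAbove (Set.range fun u => ‖deriv (deriv (ft ψ)) u‖)
  ft_scaling_tendsto : Tendsto (ft φ) (cocompact ℝ) (𝓝 0)
  ft_wavelet_tendsto : Tendsto (ft ψ) (cocompact ℝ) (𝓝 0)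
  gamma_pos : 0 < γ
  gamma_lt : γ < 1 / 2
  alpha_gt : 1 / 2 < α
  log_integrable_wavelet : Integrable fun u : ℝ => Real.log (1 + |u|) ^ α * ‖ft ψ u‖ ^ γ
  log_integrable_scaling : Integrable fun u : ℝ => Real.log (1 + |u|) ^ α * ‖ft φ u‖ ^ γ

/-! ### The process -/

/-- `S` is the spectral density of the covariance function `R`, in the normalization
`S(z) = ∫ e^{-izt} R(t) dt`, i.e. `R(t) = (2π)⁻¹ ∫ e^{itz} S(z) dz`. (If the continuous covariance
function `R` is integrable, then its Fourier transform is its spectral density. The existence of a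
spectral density makes `R` continuous.) -/
structure IsSpectralDensity (R : ℝ → ℂ) (S : ℝ → ℝ) : Prop where
  nonneg : ∀ z, 0 ≤ S z
  integrable : Integrable S
  eq_integral : ∀ t : ℝ,
    R t = (2 * (Real.pi : ℂ))⁻¹ * ∫ z : ℝ, Complex.exp (Complex.I * (t : ℂ) * (z : ℂ)) * (S z : ℂ)

/-- The conditions on the spectral density. -/
structure SpectralConditions (S : ℝ → ℝ) : Prop where
  bdd : BddAbove (Set.range S)
  differentiable : Differentiable ℝ S
  integrable_deriv : Integrable (deriv S)
  integrable_mul_pow : Integrable fun z : ℝ => |S z| * |z| ^ 4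
  integrable_deriv_mul_pow : Integrable fun z : ℝ => |deriv S z| * |z| ^ 4

/-- Doob separability on the set `I` of parameters: for some countable `D ⊆ I`, almost surely, for
every `t ∈ I` the value at `t` is a limit of values at points of `D` arbitrarily close to `t`. -/
def IsSeparableOn {Ω : Type*} [MeasurableSpace Ω] (P : Measure Ω) (X : ℝ → Ω → ℂ) (I : Set ℝ) :
    Prop :=
  ∃ D : Set ℝ, D.Countable ∧ D ⊆ I ∧ ∀ᵐ ω ∂P, ∀ t ∈ I, ∀ U : Set ℝ, IsOpen U → t ∈ U →
    X t ω ∈ closure ((fun s => X s ω) '' (D ∩ U))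

/-- `X` is a centered stationary Gaussian process with covariance function `R`, that is
`E X(s) conj X(t) = R(s - t)`. Values are complex; a real process is the special case of values in
`ℝ ⊆ ℂ`. -/
structure IsStationaryGaussian {Ω : Type*} [MeasurableSpace Ω] (P : Measure Ω) (X : ℝ → Ω → ℂ)
    (R : ℝ → ℂ) : Prop where
  gaussian : IsGaussianProcess X P
  centered : ∀ t, ∫ ω, X t ω ∂P = 0
  covariance : ∀ s t, ∫ ω, X s ω * conj (X t ω) ∂P = R (s - t)

/-- `ξ` is (a version of) the mean-square integral `∫ X(t) g(t) dt`, the integral of the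
`L²(Ω)`-valued function `t ↦ g(t) X(t)`. -/
def IsMeanSquareIntegral {Ω : Type*} [MeasurableSpace Ω] (P : Measure Ω) (X : ℝ → Ω → ℂ)
    (g : ℝ → ℂ) (ξ : Ω → ℂ) : Prop :=
  ∃ (hX : ∀ t, MemLp (X t) 2 P) (hξ : MemLp ξ 2 P),
    Integrable (fun t : ℝ => g t • (hX t).toLp (X t)) ∧
    hξ.toLp ξ = ∫ t : ℝ, g t • (hX t).toLp (X t)

/-- The truncated expansion
`∑_{|k| ≤ k₀'} ξ_{0k} φ_{0k}(t) + ∑_{j<n} ∑_{|k| ≤ k_j} η_{jk} ψ_{jk}(t)`. -/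
def truncatedExpansion {Ω : Type*} (φ ψ : ℝ → ℂ) (ξ : ℤ → Ω → ℂ) (η : ℕ → ℤ → Ω → ℂ)
    (n k₀' : ℕ) (k : ℕ → ℕ) (t : ℝ) (ω : Ω) : ℂ :=
  ∑ l ∈ Finset.Icc (-(k₀' : ℤ)) (k₀' : ℤ), ξ l ω * dilate φ 0 l t +
    ∑ j ∈ Finset.range n, ∑ l ∈ Finset.Icc (-(k j : ℤ)) (k j : ℤ), η j l ω * dilate ψ j l t

/-! ### The constants -/

/-- `c_φ = sup |φ̂|`. -/
def cφ (φ : ℝ → ℂ) : ℝ := ⨆ u : ℝ, ‖ft φ u‖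

/-- `c_{φ'} = sup |φ̂'|`. -/
def cφ' (φ : ℝ → ℂ) : ℝ := ⨆ u : ℝ, ‖deriv (ft φ) u‖

/-- `c_{ψ''} = sup |ψ̂''|`. -/
def cψ'' (ψ : ℝ → ℂ) : ℝ := ⨆ u : ℝ, ‖deriv (deriv (ft ψ)) u‖

/-- `A^φ`. -/
def Aφ (φ : ℝ → ℂ) (S : ℝ → ℝ) : ℝ :=
  1 / (2 * Real.pi) * (cφ φ ^ 2 * (∫ z, |deriv S z|) + 2 * cφ φ * cφ' φ * ∫ z, |S z|)

/-- `A₁^φ`. -/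
def A₁φ (φ : ℝ → ℂ) (S : ℝ → ℝ) : ℝ :=
  cφ φ ^ 2 / (2 * Real.pi) * ∫ z, |S z|

/-- `A^ψ`. -/
def Aψ (ψ : ℝ → ℂ) (S : ℝ → ℝ) : ℝ :=
  cψ'' ψ ^ 2 / (2 * Real.pi) * ∫ z : ℝ, (|deriv S z| * |z| ^ 4 + 2 * |S z| * |z| ^ 3)

/-- `A₁^ψ`. -/
def A₁ψ (ψ : ℝ → ℂ) (S : ℝ → ℝ) : ℝ :=
  cψ'' ψ ^ 2 / (2 * Real.pi) * ∫ z : ℝ, |S z| * |z| ^ 4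

/-- `B₁^f = (2π)⁻¹ (∫ |f̂'| + T ∫ |f̂|)`, for `f = φ` or `f = ψ`. -/
def B₁ (f : ℝ → ℂ) (T : ℝ) : ℝ :=
  1 / (2 * Real.pi) * ((∫ u, ‖deriv (ft f) u‖) + T * ∫ u, ‖ft f u‖)

/-- `∑_{m ≥ 1} m^{-3/2}`. -/
def zeta32 : ℝ := ∑' m : ℕ, 1 / ((m : ℝ) + 1) ^ (3 / 2 : ℝ)

/-- `∑_{m ≥ 1} m^{-2}`. -/
def zeta2 : ℝ := ∑' m : ℕ, 1 / ((m : ℝ) + 1) ^ 2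

/-- The constant `A`. -/
def constA (ψ : ℝ → ℂ) (S : ℝ → ℝ) (T : ℝ) : ℝ :=
  B₁ ψ T * √(6 * Aψ ψ S * zeta32 + 4 * A₁ψ ψ S)

/-- The constant `B` (meaningful if `φ̂'` is integrable). -/
def constB (φ : ℝ → ℂ) (S : ℝ → ℝ) (T : ℝ) : ℝ :=
  B₁ φ T * √(6 * Aφ φ S * zeta32 + 4 * A₁φ φ S)

/-- The constant `C`. -/
def constC (ψ : ℝ → ℂ) (S : ℝ → ℝ) (T : ℝ) : ℝ :=
  (2 + √2) * √(3 * Aψ ψ S * B₁ ψ T ^ 2 * zeta32 ^ 2 +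
    (A₁ψ ψ S * B₁ ψ T ^ 2 + (∫ u, ‖ft ψ u‖) * Aψ ψ S * B₁ ψ T / Real.pi) * zeta2 +
    (∫ u, ‖ft ψ u‖) ^ 2 * A₁ψ ψ S / (32 * Real.pi ^ 2))

/-- `ε_{k_n} = ∑_{j<n} A / (2^{j/2} √k_j) + B / √k₀' + C / 2^{n/2}`. -/
def epsK (A B C : ℝ) (n k₀' : ℕ) (k : ℕ → ℕ) : ℝ :=
  (∑ j ∈ Finset.range n, A / ((2 : ℝ) ^ ((j : ℝ) / 2) * √(k j : ℝ))) + B / √(k₀' : ℝ) +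
    C / (2 : ℝ) ^ ((n : ℝ) / 2)

/-- `σ(h) = c / (ln(e^α + 1/h))^α`. -/
def sigma (c α h : ℝ) : ℝ := c / Real.log (Real.exp α + 1 / h) ^ α

/-- `δ(ε) = (g/√2) (√ln(T+1) + (1 - 1/(2α))⁻¹ (c/g)^{1/(2α)})` with `g = min(ε, σ(T/2))`; it is `0`
for `g = 0`. -/
def delta (c α T ε : ℝ) : ℝ :=
  let g := min ε (sigma c α (T / 2))
  g / √2 * (√(Real.log (T + 1)) + (1 - 1 / (2 * α))⁻¹ * (c / g) ^ (1 / (2 * α)))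

end WaveletExpansion

end

/-!
The spectral isometry `X(t) ↦ e^{itz}` maps the closed linear span of the process into
`L²(S(z) dz / 2π)`. It sends the mean-square coefficients to conjugates of Fourier transforms of
`φ_{0k}` and `ψ_{jk}`, hence the error process to `e^{itz}` minus an explicit function of the
frequency `z` (`represents_error`). Both mean-square statements are thereby questions about functions
of `z`, and since membership in the subgaussian set survives `L²` limits, all variables in question
keep Gaussian tails governed by their norms (`Represents.gaussianTail`).

*Mean-square error.* By Poisson summation, which holds for almost every frequency because `φ̂` and
`ψ̂` are integrable (`hasSum_ft_eq_zak`), the filter relations turn into the identity "projection onto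
scale `j + 1` = projection onto scale `j` + wavelet level `j`" (`IsWaveletPair.two_scale`). The
projections converge boundedly to `e^{itz}`, since the translates of `φ` sum to a constant of modulus
one (`IsWaveletPair.tendsto_fullLevel`). So the error is the sum of the tails `|k| > k_j` of the levels
`j < n`, of the tail of the `φ`-level, and of all full levels `j ≥ n`. The norm of a level is at most a
weight times the `ℓ²` norm of its coefficients: on each period of a trigonometric series the spectral
weight is bounded by its mean plus its variation (`lintegral_mul_norm_sq_trig_le`), and the weight of
level `j` is small because `|ψ̂(u)| ≤ c_{ψ''} u² / 2`. The coefficients `f(2^j t - k)` are at most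
`2^j B₁ / |k|` by an integration by parts; if `φ̂'` is not integrable, the radial majorant of `φ` takes
the place of that bound. The result is `eLpNorm_expo_sub_truncatedFreq_le`.

*Increments.* By Parseval and Poisson summation, `∑ₖ |f(2^j t - k) - f(2^j s - k)|²` is the square of
the norm over one period of the periodization of `f̂(u) (e^{iu 2^j t} - e^{iu 2^j s})`. There
`|e^{itz} - e^{isz}| ≤ 2 w(z) / w(1/|t - s|)` for the weight `w(z) = ln(e^α + |z|)^α`, and the
periodization of `w |f̂|` is square integrable because `∫ w |f̂|^γ < ∞` with `γ < 1/2` and `f̂` is bounded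
and Lipschitz (`lintegral_tsum_ft_sq_lt_top`). As `w(2^j z)` grows polynomially in `j`, while the weight
of level `j` decays geometrically, the bounds sum up to a logarithmic modulus of continuity that does
not depend on the truncation (`exists_eLpNorm_increment_le`).

*Supremum.* A union bound along the nested grids of mesh `T / 2^{2^k}` yields the exponential inequality
(`exists_const_measure_sup_gt_le`). The grid at which the chaining starts depends on `ε` and `u`: the
event there costs the main term, and enlarging `c`, hence `δ(ε)`, makes room for its cardinality and for
the later increments. For `ε = 0` the division by zero makes the right-hand side equal to `2`.
-/

namespace WaveletExpansion

/-! ### The logarithmic modulus of continuity -/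

lemma le_log_exp_add {α x : ℝ} (hx : 0 ≤ x) : α ≤ Real.log (Real.exp α + x) := by
  rw [Real.le_log_iff_exp_le (by positivity)]
  linarith

lemma log_exp_add_pos {α x : ℝ} (hα : 0 < α) (hx : 0 ≤ x) : 0 < Real.log (Real.exp α + x) :=
  hα.trans_le (le_log_exp_add hx)

lemma log_exp_add_le {α x y : ℝ} (hx : 0 ≤ x) (hxy : x ≤ y) :
    Real.log (Real.exp α + x) ≤ Real.log (Real.exp α + y) :=
  Real.log_le_log (by positivity) (by linarith)

/-- Enlarging the argument by a factor `r ≥ 1` costs at most the summand `log r`. -/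
lemma log_exp_add_mul_le {α x r : ℝ} (hx : 0 ≤ x) (hr : 1 ≤ r) :
    Real.log (Real.exp α + r * x) ≤ Real.log r + Real.log (Real.exp α + x) := by
  rw [← Real.log_mul (by positivity) (by positivity)]
  refine Real.log_le_log (by positivity) ?_
  nlinarith [Real.exp_pos α]

/-- `x ↦ log (e^α + x) ^ α / x` is nonincreasing on `(0, ∞)`; this is what the summand `e^α` is
for. -/
lemma log_exp_add_mul_rpow_le {α x r : ℝ} (hα : 0 < α) (hx : 0 ≤ x) (hr : 1 ≤ r) :
    Real.log (Real.exp α + r * x) ^ α ≤ r * Real.log (Real.exp α + x) ^ α := by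
  have hL := log_exp_add_pos hα hx
  have hr0 : 0 < r := by linarith
  have h1 : Real.log r ≤ α * (r ^ (1 / α) - 1) := by
    have h2 : Real.log (r ^ (1 / α)) ≤ r ^ (1 / α) - 1 :=
      Real.log_le_sub_one_of_pos (by positivity)
    rw [Real.log_rpow hr0] at h2
    have h3 := mul_le_mul_of_nonneg_left h2 hα.le
    rwa [← mul_assoc, mul_one_div_cancel hα.ne', one_mul] at h3
  have h4 : 1 ≤ r ^ (1 / α) := Real.one_le_rpow hr (by positivity)
  have h5 : Real.log (Real.exp α + r * x) ≤ r ^ (1 / α) * Real.log (Real.exp α + x) := by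
    have h6 := log_exp_add_mul_le (α := α) hx hr
    have h7 := le_log_exp_add (α := α) hx
    nlinarith
  calc Real.log (Real.exp α + r * x) ^ α
      ≤ (r ^ (1 / α) * Real.log (Real.exp α + x)) ^ α :=
        Real.rpow_le_rpow (log_exp_add_pos hα (by positivity)).le h5 hα.le
    _ = r * Real.log (Real.exp α + x) ^ α := by
        rw [Real.mul_rpow (by positivity) hL.le, ← Real.rpow_mul hr0.le,
          one_div_mul_cancel hα.ne', Real.rpow_one]

lemma sigma_nonneg {c α h : ℝ} (hc : 0 ≤ c) (hα : 0 < α) (hh : 0 ≤ h) : 0 ≤ sigma c α h := by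
  have := log_exp_add_pos hα (one_div_nonneg.2 hh)
  unfold sigma
  positivity

lemma sigma_le_sigma_left {c c' α h : ℝ} (hc : c ≤ c') (hα : 0 < α) (hh : 0 ≤ h) :
    sigma c α h ≤ sigma c' α h := by
  have := log_exp_add_pos hα (one_div_nonneg.2 hh)
  unfold sigma
  gcongr

lemma sigma_le_sigma {c α h h' : ℝ} (hc : 0 ≤ c) (hα : 0 < α) (hh : 0 < h) (hhh : h ≤ h') :
    sigma c α h ≤ sigma c α h' := by
  have h1 := log_exp_add_pos hα (one_div_nonneg.2 (hh.le.trans hhh))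
  have h2 : 1 / h' ≤ 1 / h := one_div_le_one_div_of_le hh hhh
  have h3 := log_exp_add_le (α := α) (one_div_nonneg.2 (hh.le.trans hhh)) h2
  unfold sigma
  gcongr

/-- At the doubly exponential mesh `T / 2^{2^k}` the modulus `σ` decays geometrically in `k`. -/
lemma sigma_mesh_le {α T : ℝ} (hα : 0 < α) (hT : 0 < T) :
    ∃ K : ℝ, 0 < K ∧ ∀ c, 0 ≤ c → ∀ k : ℕ,
      sigma c α (T / ((2 ^ 2 ^ k : ℕ) : ℝ)) ≤ c * K * ((2 : ℝ) ^ (-α)) ^ k := by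
  set a : ℝ := 1 + Real.log (max 1 T) / α with ha
  have ha0 : 1 ≤ a := by
    have : 0 ≤ Real.log (max 1 T) := Real.log_nonneg (le_max_left _ _)
    have : 0 ≤ Real.log (max 1 T) / α := by positivity
    linarith
  have hl2 : 0 < Real.log 2 := Real.log_pos (by norm_num)
  refine ⟨(a / Real.log 2) ^ α, by positivity, fun c hc k => ?_⟩
  set M : ℝ := ((2 ^ 2 ^ k : ℕ) : ℝ) with hM
  have hM0 : 0 < M := by rw [hM]; positivity
  have hlogM : Real.log M = 2 ^ k * Real.log 2 := by
    rw [hM]; push_cast; rw [Real.log_pow]; push_cast; rfl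
  have key : 2 ^ k * Real.log 2 ≤ a * Real.log (Real.exp α + 1 / (T / M)) := by
    have h1 : M ≤ Real.exp α + max 1 T * (M / T) := by
      have : M ≤ max 1 T * (M / T) := by
        rw [mul_div_assoc', le_div_iff₀ hT, mul_comm]
        exact mul_le_mul_of_nonneg_right (le_max_right _ _) hM0.le
      have := Real.exp_pos α
      linarith
    have h2 := Real.log_le_log hM0 h1
    have h3 := log_exp_add_mul_le (α := α) (x := M / T) (r := max 1 T) (by positivity)
      (le_max_left _ _)
    have h4 := le_log_exp_add (α := α) (x := M / T) (by positivity)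
    have h5 : Real.log (max 1 T) ≤ Real.log (max 1 T) / α * Real.log (Real.exp α + M / T) := by
      have : 0 ≤ Real.log (max 1 T) := Real.log_nonneg (le_max_left _ _)
      calc Real.log (max 1 T) = Real.log (max 1 T) / α * α := by field_simp
        _ ≤ _ := by gcongr
    rw [one_div_div, ha, ← hlogM]
    linarith
  have hL := log_exp_add_pos hα (x := 1 / (T / M)) (by positivity)
  have key2 : (2 ^ k * Real.log 2 / a) ^ α ≤ Real.log (Real.exp α + 1 / (T / M)) ^ α := by
    refine Real.rpow_le_rpow (by positivity) ?_ hα.le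
    rw [div_le_iff₀ (by positivity)]
    linarith
  have e1 : (2 ^ k * Real.log 2 / a : ℝ) ^ α * ((a / Real.log 2) ^ α * ((2 : ℝ) ^ (-α)) ^ k) = 1 := by
    have : (((2 : ℝ) ^ (-α)) ^ k) = ((2 : ℝ) ^ k) ^ (-α) := by
      rw [← Real.rpow_natCast, ← Real.rpow_natCast, ← Real.rpow_mul (by norm_num),
        ← Real.rpow_mul (by norm_num), mul_comm]
    rw [this, ← mul_assoc, ← Real.mul_rpow (by positivity) (by positivity),
      Real.rpow_neg (by positivity), ← div_eq_mul_inv]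
    rw [show (2 ^ k * Real.log 2 / a * (a / Real.log 2) : ℝ) = 2 ^ k by field_simp]
    exact div_self (by positivity)
  unfold sigma
  rw [div_le_iff₀ (by positivity)]
  calc c = c * ((2 ^ k * Real.log 2 / a : ℝ) ^ α * ((a / Real.log 2) ^ α * ((2 : ℝ) ^ (-α)) ^ k)) := by
        rw [e1, mul_one]
    _ = c * (a / Real.log 2) ^ α * ((2 : ℝ) ^ (-α)) ^ k * (2 ^ k * Real.log 2 / a : ℝ) ^ α := by ring
    _ ≤ _ := by gcongr

/-! ### Chaining -/

/-- The tail bound that a centered complex Gaussian variable satisfies: its standard deviation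
enters with the sharp exponent. -/
def GaussianTail {Ω : Type*} [MeasurableSpace Ω] (P : Measure Ω) (Z : Ω → ℂ) : Prop :=
  ∀ s r : ℝ, 0 ≤ s → 0 ≤ r → eLpNorm Z 2 P ≤ ENNReal.ofReal s →
    P {ω | s * r < ‖Z ω‖} ≤ ENNReal.ofReal (4 * Real.exp (-(r ^ 2 / 2)))

/-- The projection of `s` to the grid of mesh `T / 2^{2^k}`. -/
noncomputable def gridProj (T : ℝ) (k : ℕ) (s : ℝ) : ℝ :=
  T * ((⌊s / T * ((2 ^ 2 ^ k : ℕ) : ℝ)⌋₊ : ℝ) / ((2 ^ 2 ^ k : ℕ) : ℝ))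

lemma gridProj_mem {T s : ℝ} (hT : 0 < T) (hs : s ∈ Set.Icc 0 T) (k : ℕ) :
    gridProj T k s ∈ Set.Icc 0 T ∧ gridProj T k s ≤ s ∧
      s - gridProj T k s ≤ T / ((2 ^ 2 ^ k : ℕ) : ℝ) := by
  have hM : (0 : ℝ) < ((2 ^ 2 ^ k : ℕ) : ℝ) := by positivity
  set M : ℝ := ((2 ^ 2 ^ k : ℕ) : ℝ)
  have h1 : (⌊s / T * M⌋₊ : ℝ) ≤ s / T * M :=
    Nat.floor_le (mul_nonneg (div_nonneg hs.1 hT.le) hM.le)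
  have h2 : s / T * M < (⌊s / T * M⌋₊ : ℝ) + 1 := Nat.lt_floor_add_one _
  have h3 : gridProj T k s ≤ s := by
    unfold gridProj
    calc T * ((⌊s / T * M⌋₊ : ℝ) / M) ≤ T * ((s / T * M) / M) := by gcongr
      _ = s := by field_simp
  have h4 : s ≤ gridProj T k s + T / M := by
    unfold gridProj
    calc s = T * ((s / T * M) / M) := by field_simp
      _ ≤ T * (((⌊s / T * M⌋₊ : ℝ) + 1) / M) := by gcongr
      _ = _ := by ring
  refine ⟨⟨?_, h3.trans hs.2⟩, h3, by linarith⟩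
  unfold gridProj
  positivity

/-- Successive grids are nested, so the projection to the coarser one factors through the finer. -/
lemma gridProj_index {T s : ℝ} (hT : 0 < T) (hs : s ∈ Set.Icc 0 T) (k : ℕ) :
    ∃ j ∈ Finset.range (2 ^ 2 ^ (k + 1) + 1),
      gridProj T (k + 1) s = T * ((j : ℝ) / ((2 ^ 2 ^ (k + 1) : ℕ) : ℝ)) ∧
      gridProj T k s = T * (((j / 2 ^ 2 ^ k : ℕ) : ℝ) / ((2 ^ 2 ^ k : ℕ) : ℝ)) := by
  refine ⟨⌊s / T * ((2 ^ 2 ^ (k + 1) : ℕ) : ℝ)⌋₊, ?_, rfl, ?_⟩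
  · rw [Finset.mem_range, Nat.lt_succ_iff]
    refine Nat.floor_le_of_le ?_
    have : s / T ≤ 1 := (div_le_one hT).2 hs.2
    exact mul_le_of_le_one_left (by positivity) this
  · unfold gridProj
    congr 3
    rw [← Nat.floor_div_natCast]
    congr 1
    rw [pow_succ, pow_mul]
    push_cast
    field_simp

lemma gridProj_index_zero {T s : ℝ} (hT : 0 < T) (hs : s ∈ Set.Icc 0 T) (k : ℕ) :
    ∃ j ∈ Finset.range (2 ^ 2 ^ k + 1),
      gridProj T k s = T * ((j : ℝ) / ((2 ^ 2 ^ k : ℕ) : ℝ)) := by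
  refine ⟨⌊s / T * ((2 ^ 2 ^ k : ℕ) : ℝ)⌋₊, ?_, rfl⟩
  rw [Finset.mem_range, Nat.lt_succ_iff]
  refine Nat.floor_le_of_le ?_
  have : s / T ≤ 1 := (div_le_one hT).2 hs.2
  exact mul_le_of_le_one_left (by positivity) this

/-- The union bound over the edges of all chaining levels. -/
lemma sum_chaining_levels_le {v : ℝ} (hv : 0 ≤ v) :
    ∑' k : ℕ, ((2 ^ 2 ^ (k + 1) + 1 : ℕ) : ℝ≥0∞) *
      ENNReal.ofReal (4 * Real.exp (-((v + 4 * √2 ^ k) ^ 2 / 2))) ≤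
      ENNReal.ofReal (Real.exp (-(v ^ 2 / 2))) := by
  have hterm : ∀ k : ℕ, ((2 ^ 2 ^ (k + 1) + 1 : ℕ) : ℝ≥0∞) *
      ENNReal.ofReal (4 * Real.exp (-((v + 4 * √2 ^ k) ^ 2 / 2))) ≤
      ENNReal.ofReal (Real.exp (-(v ^ 2 / 2)) * (1 / 2) ^ (k + 1)) := by
    intro k
    rw [← ENNReal.ofReal_natCast, ← ENNReal.ofReal_mul (by positivity)]
    refine ENNReal.ofReal_le_ofReal ?_
    have hk : ((k : ℝ) + 1) ≤ 2 ^ k := by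
      have : k + 1 ≤ 2 ^ k := Nat.lt_two_pow_self
      exact_mod_cast this
    have hsq : (√2 ^ k) ^ 2 = (2 : ℝ) ^ k := by
      rw [← pow_mul, mul_comm, pow_mul, Real.sq_sqrt (by norm_num)]
    have h2e : (2 : ℝ) ≤ Real.exp 1 := by
      have := Real.add_one_le_exp (1 : ℝ); linarith
    have h1 : ((2 ^ 2 ^ (k + 1) + 1 : ℕ) : ℝ) * 4 ≤ Real.exp (3 + 2 * 2 ^ k) := by
      have : ((2 ^ 2 ^ (k + 1) + 1 : ℕ) : ℝ) * 4 ≤ (2 : ℝ) ^ (3 + 2 * 2 ^ k) := by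
        have h : (2 ^ 2 ^ (k + 1) + 1) * 4 ≤ 2 ^ (3 + 2 * 2 ^ k) := by
          have : 1 ≤ 2 ^ 2 ^ (k + 1) := Nat.one_le_two_pow
          rw [show 3 + 2 * 2 ^ k = 2 ^ (k + 1) + 3 by ring, pow_add 2 (2 ^ (k + 1)) 3]
          generalize 2 ^ 2 ^ (k + 1) = N at *
          omega
        exact_mod_cast h
      refine this.trans ?_
      calc (2 : ℝ) ^ (3 + 2 * 2 ^ k) ≤ Real.exp 1 ^ (3 + 2 * 2 ^ k) := by gcongr
        _ = Real.exp (3 + 2 * 2 ^ k) := by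
            rw [← Real.exp_nat_mul]; push_cast; ring_nf
    have h3 : (v + 4 * √2 ^ k) ^ 2 / 2 ≥ v ^ 2 / 2 + 8 * 2 ^ k := by
      have : 0 ≤ √2 ^ k := by positivity
      nlinarith [mul_nonneg hv this]
    have h4 : Real.exp (3 + 2 * 2 ^ k) * Real.exp (-((v + 4 * √2 ^ k) ^ 2 / 2)) ≤
        Real.exp (-(v ^ 2 / 2)) * Real.exp (-((k : ℝ) + 1)) := by
      rw [← Real.exp_add, ← Real.exp_add]
      refine Real.exp_le_exp.2 ?_
      nlinarith
    have h5 : Real.exp (-((k : ℝ) + 1)) ≤ (1 / 2) ^ (k + 1) := by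
      rw [Real.exp_neg, one_div, inv_pow]
      refine inv_anti₀ (by positivity) ?_
      calc (2 : ℝ) ^ (k + 1) ≤ Real.exp 1 ^ (k + 1) := by gcongr
        _ = _ := by rw [← Real.exp_nat_mul]; push_cast; ring_nf
    calc _ = ((2 ^ 2 ^ (k + 1) + 1 : ℕ) : ℝ) * 4 * Real.exp (-((v + 4 * √2 ^ k) ^ 2 / 2)) := by ring
      _ ≤ Real.exp (3 + 2 * 2 ^ k) * Real.exp (-((v + 4 * √2 ^ k) ^ 2 / 2)) := by gcongr
      _ ≤ _ := h4
      _ ≤ _ := by gcongr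
  refine (ENNReal.tsum_le_tsum hterm).trans ?_
  have hs : HasSum (fun k : ℕ => Real.exp (-(v ^ 2 / 2)) * (1 / 2 : ℝ) ^ (k + 1))
      (Real.exp (-(v ^ 2 / 2)) * 1) := by
    refine HasSum.mul_left _ ?_
    have := hasSum_geometric_two.mul_left (1 / 2 : ℝ)
    simpa [pow_succ, mul_comm] using this
  rw [← ENNReal.ofReal_tsum_of_nonneg (fun k => by positivity) hs.summable, hs.tsum_eq, mul_one]

/-- Chaining along the doubly exponential grids, started at level `k₀`: the base level is controlled
by the standard deviation `ε` of the process, the later levels by its increments. -/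
lemma measure_sup_gt_le_of_chaining {Ω : Type*} [MeasurableSpace Ω] {P : Measure Ω}
    {Y : ℝ → Ω → ℂ} {T ε u ρ v : ℝ} {s : ℕ → ℝ} {k₀ : ℕ} (hT : 0 < T)
    (hε : 0 ≤ ε) (hρ : 0 ≤ ρ) (hv : 0 ≤ v)
    (hmeas : ∀ t, AEStronglyMeasurable (Y t) P)
    (htail : ∀ t ∈ Set.Icc 0 T, GaussianTail P (Y t))
    (htail' : ∀ a ∈ Set.Icc 0 T, ∀ b ∈ Set.Icc 0 T, GaussianTail P (fun ω => Y a ω - Y b ω))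
    (hnorm : ∀ t ∈ Set.Icc 0 T, eLpNorm (Y t) 2 P ≤ ENNReal.ofReal ε)
    (hs0 : ∀ k, 0 ≤ s k) (hs : Tendsto s atTop (𝓝 0))
    (hincr : ∀ k, ∀ a ∈ Set.Icc 0 T, ∀ b ∈ Set.Icc 0 T, |a - b| ≤ T / ((2 ^ 2 ^ k : ℕ) : ℝ) →
      eLpNorm (fun ω => Y a ω - Y b ω) 2 P ≤ ENNReal.ofReal (s k))
    (hsep : IsSeparableOn P Y (Set.Icc 0 T))
    (hsum : ∀ m, k₀ ≤ m → ε * ρ + ∑ k ∈ Finset.Ico k₀ m, s k * (v + 4 * √2 ^ k) ≤ u) :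
    P {ω | ENNReal.ofReal u < ⨆ t ∈ Set.Icc 0 T, ‖Y t ω‖ₑ} ≤
      ENNReal.ofReal (((2 ^ 2 ^ k₀ + 1 : ℕ) : ℝ) * (4 * Real.exp (-(ρ ^ 2 / 2)))) +
        ENNReal.ofReal (Real.exp (-(v ^ 2 / 2))) := by
  have hgrid : ∀ k j : ℕ, j ∈ Finset.range (2 ^ 2 ^ k + 1) →
      T * ((j : ℝ) / ((2 ^ 2 ^ k : ℕ) : ℝ)) ∈ Set.Icc 0 T := by
    intro k j hj
    refine ⟨by positivity, ?_⟩
    have hj' : (j : ℝ) ≤ ((2 ^ 2 ^ k : ℕ) : ℝ) := by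
      exact_mod_cast Nat.lt_succ_iff.1 (Finset.mem_range.1 hj)
    have : (j : ℝ) / ((2 ^ 2 ^ k : ℕ) : ℝ) ≤ 1 := (div_le_one (by positivity)).2 hj'
    nlinarith
  -- the exceptional events
  set B₀ : Set Ω := ⋃ j ∈ Finset.range (2 ^ 2 ^ k₀ + 1),
    {ω | ε * ρ < ‖Y (T * ((j : ℝ) / ((2 ^ 2 ^ k₀ : ℕ) : ℝ))) ω‖} with hB₀
  set x : ℕ → ℕ → ℝ := fun k j => T * ((j : ℝ) / ((2 ^ 2 ^ (k + 1) : ℕ) : ℝ)) with hx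
  set y : ℕ → ℕ → ℝ := fun k j => T * (((j / 2 ^ 2 ^ k : ℕ) : ℝ) / ((2 ^ 2 ^ k : ℕ) : ℝ)) with hy
  set B₁ : Set Ω := ⋃ k : ℕ, ⋃ j ∈ Finset.range (2 ^ 2 ^ (k + 1) + 1),
    {ω | s k * (v + 4 * √2 ^ k) < ‖Y (x k j) ω - Y (y k j) ω‖} with hB₁
  have hPB₀ : P B₀ ≤
      ENNReal.ofReal (((2 ^ 2 ^ k₀ + 1 : ℕ) : ℝ) * (4 * Real.exp (-(ρ ^ 2 / 2)))) := by
    refine (measure_biUnion_finset_le _ _).trans ?_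
    refine (Finset.sum_le_card_nsmul _ _ _ fun j hj =>
      htail _ (hgrid k₀ j hj) ε ρ hε hρ (hnorm _ (hgrid k₀ j hj))).trans ?_
    rw [Finset.card_range, nsmul_eq_mul, ENNReal.ofReal_mul (p := ((2 ^ 2 ^ k₀ + 1 : ℕ) : ℝ)) (by positivity),
      ENNReal.ofReal_natCast]
  have hPB₁ : P B₁ ≤ ENNReal.ofReal (Real.exp (-(v ^ 2 / 2))) := by
    refine (measure_iUnion_le _).trans ?_
    refine le_trans ?_ (sum_chaining_levels_le hv)
    refine ENNReal.tsum_le_tsum fun k => ?_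
    refine (measure_biUnion_finset_le _ _).trans ?_
    refine (Finset.sum_le_card_nsmul _ _ (ENNReal.ofReal
      (4 * Real.exp (-((v + 4 * √2 ^ k) ^ 2 / 2)))) fun j hj => ?_).trans ?_
    · have hxm : x k j ∈ Set.Icc 0 T := hgrid (k + 1) j hj
      have hpow : 2 ^ 2 ^ (k + 1) = 2 ^ 2 ^ k * 2 ^ 2 ^ k := by
        rw [← pow_add]; congr 1; ring
      have hym : y k j ∈ Set.Icc 0 T := by
        refine hgrid k _ ?_
        have := Nat.lt_succ_iff.1 (Finset.mem_range.1 hj)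
        rw [Finset.mem_range, Nat.lt_succ_iff]
        refine Nat.div_le_of_le_mul ?_
        rwa [← hpow]
      refine htail' _ hxm _ hym (s k) _ (hs0 k) (by positivity) (hincr k _ hxm _ hym ?_)
      have hMp : 0 < 2 ^ 2 ^ k := by positivity
      have hM : (0 : ℝ) < ((2 ^ 2 ^ k : ℕ) : ℝ) := by positivity
      have hdm := Nat.div_add_mod j (2 ^ 2 ^ k)
      have hml := Nat.mod_lt j hMp
      simp only [hx, hy, hpow]
      generalize 2 ^ 2 ^ k = M at *
      have h1 : (j : ℝ) = M * ((j / M : ℕ) : ℝ) + ((j % M : ℕ) : ℝ) := by exact_mod_cast hdm.symm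
      have h2 : ((j % M : ℕ) : ℝ) ≤ M := by exact_mod_cast hml.le
      have h3 : (0 : ℝ) ≤ ((j % M : ℕ) : ℝ) := Nat.cast_nonneg _
      rw [h1]
      generalize ((j / M : ℕ) : ℝ) = q at *
      generalize ((j % M : ℕ) : ℝ) = r at *
      -- a point of the finer grid exceeds its projection by `r < M` of its mesh widths `T / M²`
      have h4 : T * ((M * q + r) / ((M * M : ℕ) : ℝ)) - T * (q / M) = T / M * (r / M) := by
        push_cast
        field_simp
        ring
      rw [h4, abs_of_nonneg (by positivity)]
      exact mul_le_of_le_one_right (by positivity) ((div_le_one hM).2 h2)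
    · rw [Finset.card_range, nsmul_eq_mul]
  -- outside of them the process is bounded by `u` along the grids
  have hchain : ∀ ω ∉ B₀ ∪ B₁, ∀ t ∈ Set.Icc 0 T, ∀ m, k₀ ≤ m →
      ‖Y (gridProj T m t) ω‖ ≤ ε * ρ + ∑ k ∈ Finset.Ico k₀ m, s k * (v + 4 * √2 ^ k) := by
    intro ω hω t ht m hm
    rw [Set.mem_union, not_or] at hω
    induction m, hm using Nat.le_induction with
    | base =>
      obtain ⟨j, hj, hj'⟩ := gridProj_index_zero hT ht k₀
      have := hω.1
      simp only [hB₀, Set.mem_iUnion, Set.mem_ofPred_eq, not_exists, not_lt] at this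
      rw [Finset.Ico_self, Finset.sum_empty, add_zero, hj']
      exact this j hj
    | succ m hm ih =>
      obtain ⟨j, hj, hj1, hj2⟩ := gridProj_index hT ht m
      have := hω.2
      simp only [hB₁, Set.mem_iUnion, Set.mem_ofPred_eq, not_exists, not_lt] at this
      have h1 := this m j hj
      simp only [hx, hy] at h1
      rw [← hj1, ← hj2] at h1
      rw [Finset.sum_Ico_succ_top hm, ← add_assoc]
      have h2 := norm_add_le (Y (gridProj T m t) ω) (Y (gridProj T (m + 1) t) ω - Y (gridProj T m t) ω)
      rw [add_sub_cancel] at h2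
      linarith
  -- at the points of the separating set the grid values converge almost surely along a subsequence
  obtain ⟨D, hDc, hDI, hD⟩ := hsep
  have hDae : ∀ᵐ ω ∂P, ∀ t ∈ D, ω ∉ B₀ ∪ B₁ → ‖Y t ω‖ ≤ u := by
    rw [ae_ball_iff hDc]
    intro t ht
    have htI := hDI ht
    have hconv : Tendsto (fun m => eLpNorm (Y (gridProj T m t) - Y t) 2 P) atTop (𝓝 0) := by
      have h0 : Tendsto (fun m => ENNReal.ofReal (s m)) atTop (𝓝 0) := by
        simpa using ENNReal.tendsto_ofReal hs
      refine tendsto_of_tendsto_of_tendsto_of_le_of_le tendsto_const_nhds h0 (fun _ => bot_le) ?_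
      intro m
      obtain ⟨g1, g2, g3⟩ := gridProj_mem hT htI m
      refine hincr m _ g1 _ htI ?_
      rw [abs_sub_comm, abs_of_nonneg (by linarith)]
      exact g3
    obtain ⟨ns, hns, hlim⟩ := (tendstoInMeasure_of_tendsto_eLpNorm (by norm_num)
      (fun m => hmeas _) (hmeas t) hconv).exists_seq_tendsto_ae
    filter_upwards [hlim] with ω hω hωB
    refine le_of_tendsto hω.norm ?_
    filter_upwards [hns.tendsto_atTop.eventually_ge_atTop k₀] with i hi
    exact (hchain ω hωB t htI _ hi).trans (hsum _ hi)
  -- separability extends the bound to all times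
  have hsub : ∀ᵐ ω ∂P, ω ∈ {ω | ENNReal.ofReal u < ⨆ t ∈ Set.Icc 0 T, ‖Y t ω‖ₑ} → ω ∈ B₀ ∪ B₁ := by
    filter_upwards [hDae, hD] with ω h1 h2 hω
    by_contra hcon
    refine not_le.2 hω (iSup₂_le fun t ht => ?_)
    rw [← ofReal_norm]
    refine ENNReal.ofReal_le_ofReal ?_
    have h3 := h2 t ht Set.univ isOpen_univ trivial
    have h4 : closure ((fun r => Y r ω) '' (D ∩ Set.univ)) ⊆ {z : ℂ | ‖z‖ ≤ u} := by
      refine closure_minimal ?_ (isClosed_le continuous_norm continuous_const)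
      rintro _ ⟨r, hr, rfl⟩
      exact h1 r hr.1 hcon
    exact h4 h3
  calc _ ≤ P (B₀ ∪ B₁) := measure_mono_ae hsub
    _ ≤ P B₀ + P B₁ := measure_union_le _ _
    _ ≤ _ := add_le_add hPB₀ hPB₁

lemma delta_nonneg {c α T ε : ℝ} (hα : 1 / 2 < α) (hT : 0 < T) (hc : 0 ≤ c) (hε : 0 ≤ ε) :
    0 ≤ delta c α T ε := by
  have h1 : 0 ≤ min ε (sigma c α (T / 2)) :=
    le_min hε (sigma_nonneg hc (by linarith) (by positivity))
  have h2 : 0 ≤ (1 - 1 / (2 * α))⁻¹ := by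
    rw [inv_nonneg, sub_nonneg, div_le_one (by linarith)]
    linarith
  unfold delta
  positivity

lemma delta_eq_of_le {c α T ε : ℝ} (h : ε ≤ sigma c α (T / 2)) :
    delta c α T ε =
      ε / √2 * (√(Real.log (T + 1)) + (1 - 1 / (2 * α))⁻¹ * (c / ε) ^ (1 / (2 * α))) := by
  unfold delta
  rw [min_eq_left h]

/-- Only the second summand of `δ` is used: the first one is dropped, and the factor
`(1 - 1/(2α))⁻¹` is at least one. -/
lemma le_sq_delta {c α T ε : ℝ} (hα : 1 / 2 < α) (hc : 0 ≤ c) (hε : 0 < ε)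
    (h : ε ≤ sigma c α (T / 2)) :
    ε ^ 2 / 2 * (c / ε) ^ (1 / α) ≤ delta c α T ε ^ 2 := by
  have h1 : 1 ≤ (1 - 1 / (2 * α))⁻¹ := by
    have h2 : 1 / (2 * α) < 1 := by rw [div_lt_one (by linarith)]; linarith
    have h3 : 0 < 1 / (2 * α) := by positivity
    exact (one_le_inv₀ (by linarith)).2 (by linarith)
  have h4 : 0 ≤ (c / ε) ^ (1 / (2 * α)) := by positivity
  have h5 : ε / √2 * (c / ε) ^ (1 / (2 * α)) ≤ delta c α T ε := by
    rw [delta_eq_of_le h]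
    have := Real.sqrt_nonneg (Real.log (T + 1))
    gcongr
    nlinarith
  have h6 : ε ^ 2 / 2 * (c / ε) ^ (1 / α) = (ε / √2 * (c / ε) ^ (1 / (2 * α))) ^ 2 := by
    rw [mul_pow, div_pow, Real.sq_sqrt (by norm_num), ← Real.rpow_natCast, ← Real.rpow_natCast,
      ← Real.rpow_mul (by positivity)]
    congr 2
    push_cast
    field_simp
  rw [h6]
  gcongr

/-- The choice of the level at which the chaining starts: fine enough for the increments to be
negligible against `ε θ`, and coarse enough for the grid to be small. -/
lemma exists_chaining_level {α D ε θ u δ c : ℝ} (hα : 1 / 2 < α) (hD : 0 < D) (hε : 0 < ε)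
    (hθ : 0 < θ) (hθ1 : θ ≤ 1) (hδu : 8 * δ = u * θ ^ 2)
    (hcε : ε ≤ c) (hcD : (2 : ℝ) ^ α * (4 * D) ≤ c)
    (hδ : ε ^ 2 / 2 * (c / ε) ^ (1 / α) ≤ δ ^ 2) :
    ∃ k₀ : ℕ, D * ((2 : ℝ) ^ (-α)) ^ k₀ ≤ ε * θ / 4 ∧ 24 * 2 ^ k₀ * ε ^ 2 ≤ θ * u ^ 2 := by
  have hα0 : 0 < α := by linarith
  have hc0 : 0 < c := hε.trans_le hcε
  have hq : (2 : ℝ) ^ (-α) < 1 := Real.rpow_lt_one_of_one_lt_of_neg (by norm_num) (by linarith)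
  have hq0 : 0 < (2 : ℝ) ^ (-α) := by positivity
  have hex : ∃ k : ℕ, D * ((2 : ℝ) ^ (-α)) ^ k ≤ ε * θ / 4 := by
    obtain ⟨k, hk⟩ := exists_pow_lt_of_lt_one (show 0 < ε * θ / 4 / D by positivity) hq
    refine ⟨k, ?_⟩
    rw [lt_div_iff₀ hD] at hk
    linarith
  classical
  -- the least such level: its minimality bounds `2^{k₀}` from above
  refine ⟨Nat.find hex, Nat.find_spec hex, ?_⟩
  have hu : θ ^ 3 * (θ * u ^ 2) = 64 * δ ^ 2 := by
    have : (8 * δ) ^ 2 = (u * θ ^ 2) ^ 2 := by rw [hδu]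
    linarith
  have hθ3 : 0 < θ ^ 3 := by positivity
  have hθ31 : θ ^ 3 ≤ 1 := pow_le_one₀ hθ.le hθ1
  -- `θ³` turns the right-hand side of the second claim into `64 δ²`
  refine le_of_mul_le_mul_left ?_ hθ3
  rw [hu]
  rcases hk : Nat.find hex with _ | m
  · have h1 : 1 ≤ (c / ε) ^ (1 / α) :=
      Real.one_le_rpow ((one_le_div hε).2 hcε) (by positivity)
    have h2 : ε ^ 2 / 2 ≤ δ ^ 2 := le_trans (le_mul_of_one_le_right (by positivity) h1) hδ
    have : 0 < ε ^ 2 := by positivity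
    nlinarith
  · have h1 : ε * θ / 4 < D * ((2 : ℝ) ^ (-α)) ^ m := by
      -- the level before the least one is too coarse
      have := Nat.find_min hex (m := m) (by omega)
      exact not_le.1 this
    have e1 : ((2 : ℝ) ^ (-α)) ^ m * ((2 : ℝ) ^ m) ^ α = 1 := by
      rw [← Real.rpow_natCast, ← Real.rpow_natCast, ← Real.rpow_mul (by norm_num),
        ← Real.rpow_mul (by norm_num), ← Real.rpow_add (by norm_num)]
      simp [mul_comm]
    have h2 : ((2 : ℝ) ^ m) ^ α ≤ 4 * D / (ε * θ) := by
      rw [le_div_iff₀ (by positivity)]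
      have h3 : 0 < ((2 : ℝ) ^ m) ^ α := by positivity
      have h4 := mul_le_mul_of_nonneg_right h1.le h3.le
      rw [mul_assoc, e1] at h4
      linarith
    have h3 : (2 : ℝ) ^ m ≤ (4 * D / (ε * θ)) ^ (1 / α) := by
      have := Real.rpow_le_rpow (by positivity) h2 (show 0 ≤ 1 / α by positivity)
      rwa [← Real.rpow_mul (by positivity), mul_one_div_cancel hα0.ne', Real.rpow_one] at this
    have h4 : (4 * D / (ε * θ)) ^ (1 / α) * θ ^ 2 ≤ (4 * D / ε) ^ (1 / α) := by
      have e2 : 4 * D / ε = 4 * D / (ε * θ) * θ := by field_simp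
      rw [e2, Real.mul_rpow (by positivity) hθ.le]
      gcongr
      rw [← Real.rpow_natCast]
      refine Real.rpow_le_rpow_of_exponent_ge hθ hθ1 ?_
      push_cast
      rw [div_le_iff₀ hα0]
      linarith
    have h5 : 2 * (4 * D / ε) ^ (1 / α) ≤ (c / ε) ^ (1 / α) := by
      have e3 : (2 : ℝ) = ((2 : ℝ) ^ α) ^ (1 / α) := by
        rw [← Real.rpow_mul (by norm_num), mul_one_div_cancel hα0.ne', Real.rpow_one]
      calc 2 * (4 * D / ε) ^ (1 / α) = ((2 : ℝ) ^ α * (4 * D / ε)) ^ (1 / α) := by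
            rw [Real.mul_rpow (by positivity) (by positivity), ← e3]
        _ ≤ _ := by
            refine Real.rpow_le_rpow (by positivity) ?_ (by positivity)
            rw [mul_div_assoc']
            gcongr
    have h6 : 2 ^ m * θ ^ 3 ≤ (4 * D / ε) ^ (1 / α) := by
      calc 2 ^ m * θ ^ 3 ≤ (4 * D / (ε * θ)) ^ (1 / α) * θ ^ 2 := by
            have : θ ^ 3 ≤ θ ^ 2 := pow_le_pow_of_le_one hθ.le hθ1 (by norm_num)
            gcongr
        _ ≤ _ := h4
    have hε2 : 0 < ε ^ 2 := by positivity
    have h7 : ε ^ 2 * (2 * (2 ^ m * θ ^ 3)) ≤ ε ^ 2 * (c / ε) ^ (1 / α) := by gcongr; linarith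
    rw [pow_succ (2 : ℝ) m]
    have h8 : 0 ≤ ε ^ 2 * (2 ^ m * θ ^ 3) := by positivity
    nlinarith

lemma two_pow_two_pow_add_one_mul_le (k₀ : ℕ) :
    ((2 ^ 2 ^ k₀ + 1 : ℕ) : ℝ) * 4 ≤ Real.exp (3 * 2 ^ k₀) := by
  have h1 : ((2 ^ 2 ^ k₀ + 1 : ℕ) : ℝ) * 4 ≤ (2 : ℝ) ^ (4 * 2 ^ k₀) := by
    have h : (2 ^ 2 ^ k₀ + 1) * 4 ≤ 2 ^ (4 * 2 ^ k₀) := by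
      have h2 : 2 ≤ 2 ^ 2 ^ k₀ := by
        calc 2 = 2 ^ 1 := rfl
          _ ≤ 2 ^ 2 ^ k₀ := Nat.pow_le_pow_right (by norm_num) Nat.one_le_two_pow
      rw [show 4 * 2 ^ k₀ = 2 ^ k₀ * 4 by ring, pow_mul]
      generalize 2 ^ 2 ^ k₀ = N at *
      have h3 : N ^ 4 = N * N * (N * N) := by ring
      have h4 : 4 ≤ N * N := by nlinarith
      rw [h3]
      nlinarith
    exact_mod_cast h
  have h2 : (2 : ℝ) = Real.exp (Real.log 2) := (Real.exp_log (by norm_num)).symm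
  refine h1.trans ?_
  calc (2 : ℝ) ^ (4 * 2 ^ k₀) = Real.exp (((4 * 2 ^ k₀ : ℕ) : ℝ) * Real.log 2) := by
        rw [Real.exp_nat_mul, Real.exp_log (by norm_num)]
    _ ≤ _ := by
        refine Real.exp_le_exp.2 ?_
        have := Real.log_two_lt_d9
        have h3 : (0 : ℝ) < 2 ^ k₀ := by positivity
        push_cast
        nlinarith

/-- Both exceptional events of the chaining cost at most one exponential of the asserted form. Here
`θ` stands for `√(8δ/u)`, so that `u - uθ = u - √(8uδ)`; the threshold `(1 - θ/2) u` at the starting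
grid leaves `θ u / 2` for the later increments, and its gap to `u - uθ` absorbs the size of the
grid. -/
lemma add_exp_le_two_mul_exp {ε θ u : ℝ} {k₀ : ℕ} (hε : 0 < ε) (hu0 : 0 < u) (hθ0 : 0 < θ)
    (hθ1 : θ ≤ 1) (hk2 : 24 * 2 ^ k₀ * ε ^ 2 ≤ θ * u ^ 2) :
    ((2 ^ 2 ^ k₀ + 1 : ℕ) : ℝ) * (4 * Real.exp (-(((1 - θ / 2) * u / ε) ^ 2 / 2))) +
        Real.exp (-((u / ε) ^ 2 / 2)) ≤
      2 * Real.exp (-((u - u * θ) ^ 2 / (2 * ε ^ 2))) := by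
  have hbase := two_pow_two_pow_add_one_mul_le k₀
  generalize ((2 ^ 2 ^ k₀ + 1 : ℕ) : ℝ) = N at *
  have hexp1 : N * (4 * Real.exp (-(((1 - θ / 2) * u / ε) ^ 2 / 2))) ≤
      Real.exp (-((u - u * θ) ^ 2 / (2 * ε ^ 2))) := by
    rw [← mul_assoc]
    refine (mul_le_mul_of_nonneg_right hbase (Real.exp_pos _).le).trans ?_
    rw [← Real.exp_add]
    refine Real.exp_le_exp.2 ?_
    have h1 : 3 * 2 ^ k₀ ≤ θ * u ^ 2 / (8 * ε ^ 2) := by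
      rw [le_div_iff₀ (by positivity)]
      linarith
    have h2 : ((1 - θ / 2) * u / ε) ^ 2 / 2 - (u - u * θ) ^ 2 / (2 * ε ^ 2) =
        (θ / 2 * (2 - 3 / 2 * θ)) * u ^ 2 / (2 * ε ^ 2) := by
      field_simp
      ring
    have h3 : θ * u ^ 2 / (8 * ε ^ 2) ≤ (θ / 2 * (2 - 3 / 2 * θ)) * u ^ 2 / (2 * ε ^ 2) := by
      rw [show θ * u ^ 2 / (8 * ε ^ 2) = θ / 4 * u ^ 2 / (2 * ε ^ 2) by ring]
      gcongr
      nlinarith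
    linarith
  have hexp2 : Real.exp (-((u / ε) ^ 2 / 2)) ≤
      Real.exp (-((u - u * θ) ^ 2 / (2 * ε ^ 2))) := by
    refine Real.exp_le_exp.2 (neg_le_neg ?_)
    rw [show (u / ε) ^ 2 / 2 = u ^ 2 / (2 * ε ^ 2) by field_simp]
    gcongr
    · nlinarith
    · nlinarith
  linarith

/-- The increments beyond the starting grid use up at most `θ u / 2`; both geometric series converge
because `q = 2^{-α} < 1/√2`. -/
lemma sum_chaining_thresholds_le {q c₂ ε θ u : ℝ} {k₀ : ℕ} (hq0 : 0 < q) (hr1 : q * √2 < 1)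
    (hc₂ : 0 < c₂) (hε : 0 < ε) (hu0 : 0 < u) (hθ0 : 0 < θ)
    (hk1 : c₂ / (1 - q * √2) * q ^ k₀ ≤ ε * θ / 4) (hεu : 4 * ε * √2 ^ k₀ ≤ u) (m : ℕ) :
    ∑ k ∈ Finset.Ico k₀ m, c₂ * q ^ k * (u / ε + 4 * √2 ^ k) ≤ θ * u / 2 := by
  have hs2 : (1 : ℝ) < √2 := by rw [Real.lt_sqrt (by norm_num)]; norm_num
  have hq1 : q < 1 := by nlinarith
  have hr0 : 0 < 1 - q * √2 := by linarith
  have e1 : ∑ k ∈ Finset.Ico k₀ m, c₂ * q ^ k * (u / ε + 4 * √2 ^ k) =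
      c₂ * (u / ε) * ∑ k ∈ Finset.Ico k₀ m, q ^ k +
        4 * c₂ * ∑ k ∈ Finset.Ico k₀ m, (q * √2) ^ k := by
    rw [Finset.mul_sum, Finset.mul_sum, ← Finset.sum_add_distrib]
    refine Finset.sum_congr rfl fun k _ => ?_
    rw [mul_pow]
    ring
  have g1 : ∑ k ∈ Finset.Ico k₀ m, q ^ k ≤ q ^ k₀ / (1 - q) :=
    geom_sum_Ico_le_of_lt_one hq0.le hq1
  have g2 : ∑ k ∈ Finset.Ico k₀ m, (q * √2) ^ k ≤ (q * √2) ^ k₀ / (1 - q * √2) :=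
    geom_sum_Ico_le_of_lt_one (by positivity) hr1
  have g3 : q ^ k₀ / (1 - q) ≤ q ^ k₀ / (1 - q * √2) := by
    refine div_le_div_of_nonneg_left (by positivity) (by linarith) ?_
    nlinarith
  have g4 : c₂ * (u / ε) * ∑ k ∈ Finset.Ico k₀ m, q ^ k ≤ θ * u / 4 := by
    calc _ ≤ c₂ * (u / ε) * (q ^ k₀ / (1 - q * √2)) := by gcongr; exact g1.trans g3
      _ = c₂ / (1 - q * √2) * q ^ k₀ * (u / ε) := by ring
      _ ≤ ε * θ / 4 * (u / ε) := by gcongr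
      _ = _ := by field_simp
  have g5 : 4 * c₂ * ∑ k ∈ Finset.Ico k₀ m, (q * √2) ^ k ≤ θ * u / 4 := by
    calc _ ≤ 4 * c₂ * ((q * √2) ^ k₀ / (1 - q * √2)) := by gcongr
      _ = 4 * (c₂ / (1 - q * √2) * q ^ k₀) * √2 ^ k₀ := by rw [mul_pow]; ring
      _ ≤ 4 * (ε * θ / 4) * √2 ^ k₀ := by gcongr
      _ = θ / 4 * (4 * ε * √2 ^ k₀) := by ring
      _ ≤ θ / 4 * u := by gcongr
      _ = _ := by ring
  rw [e1]
  linarith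

/-- The exponential bound for the supremum of a process with Gaussian tails and a logarithmic
modulus of continuity, once the constant `c` in `σ` and `δ` is large enough. -/
lemma exists_const_measure_sup_gt_le {α T E c₁ : ℝ} (hα : 1 / 2 < α) (hT : 0 < T) (hE : 0 < E)
    (hc₁ : 0 < c₁) :
    ∃ Λ : ℝ, 0 < Λ ∧ ∀ c, Λ ≤ c → E ≤ sigma c α (T / 2) ∧
      ∀ {Ω : Type*} [MeasurableSpace Ω] {P : Measure Ω}
      {Y : ℝ → Ω → ℂ} {ε u : ℝ}, 0 < ε → ε ≤ E →
      (∀ t, AEStronglyMeasurable (Y t) P) →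
      (∀ t ∈ Set.Icc 0 T, GaussianTail P (Y t)) →
      (∀ a ∈ Set.Icc 0 T, ∀ b ∈ Set.Icc 0 T, GaussianTail P (fun ω => Y a ω - Y b ω)) →
      (∀ t ∈ Set.Icc 0 T, eLpNorm (Y t) 2 P ≤ ENNReal.ofReal ε) →
      (∀ a ∈ Set.Icc 0 T, ∀ b ∈ Set.Icc 0 T, a ≠ b →
        eLpNorm (fun ω => Y a ω - Y b ω) 2 P ≤ ENNReal.ofReal (sigma c₁ α |a - b|)) →
      IsSeparableOn P Y (Set.Icc 0 T) →
      8 * delta c α T ε < u →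
      P {ω | ENNReal.ofReal u < ⨆ t ∈ Set.Icc 0 T, ‖Y t ω‖ₑ} ≤
        ENNReal.ofReal (2 * Real.exp
          (-((u - √(8 * u * delta c α T ε)) ^ 2 / (2 * ε ^ 2)))) := by
  have hα0 : 0 < α := by linarith
  obtain ⟨K, hK, hKs⟩ := sigma_mesh_le hα0 hT
  set q : ℝ := (2 : ℝ) ^ (-α) with hq
  have hq0 : 0 < q := by positivity
  have hsq2 : (√2) ^ 2 = (2 : ℝ) := Real.sq_sqrt (by norm_num)
  have hs2 : (1 : ℝ) < √2 := by rw [Real.lt_sqrt (by norm_num)]; norm_num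
  have hr1 : q * √2 < 1 := by
    rw [hq, Real.sqrt_eq_rpow, ← Real.rpow_add (by norm_num)]
    exact Real.rpow_lt_one_of_one_lt_of_neg (by norm_num) (by linarith)
  have hq1 : q < 1 := by nlinarith
  set c₂ : ℝ := c₁ * K with hc₂
  have hc₂0 : 0 < c₂ := by positivity
  set D : ℝ := c₂ / (1 - q * √2) with hDdef
  have hD0 : 0 < D := div_pos hc₂0 (by linarith)
  have hL := log_exp_add_pos hα0 (x := 1 / (T / 2)) (by positivity)
  -- `c` has to exceed `E`, the threshold in the choice of the starting level, and a value that
  -- makes `σ(T/2) ≥ E`, so that the minimum in `δ` is always `ε`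
  refine ⟨max E (max ((2 : ℝ) ^ α * (4 * D))
    (E * Real.log (Real.exp α + 1 / (T / 2)) ^ α)), by positivity, fun c hc => ?_⟩
  have hcE : E ≤ c := (le_max_left _ _).trans hc
  have hcD : (2 : ℝ) ^ α * (4 * D) ≤ c := (le_max_left _ _).trans ((le_max_right _ _).trans hc)
  have hcσ : E ≤ sigma c α (T / 2) := by
    unfold sigma
    rw [le_div_iff₀ (by positivity)]
    exact (le_max_right _ _).trans ((le_max_right _ _).trans hc)
  refine ⟨hcσ, ?_⟩
  intro Ω _ P Y ε u hε hεE hmeas htail htail' hnorm hincr hsep hu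
  have hc0 : 0 < c := by linarith
  have hδ0 := delta_nonneg hα hT hc0.le hε.le
  have hδ := le_sq_delta hα hc0.le hε (hεE.trans hcσ)
  have hδpos : 0 < delta c α T ε := by
    have : 0 < ε ^ 2 / 2 * (c / ε) ^ (1 / α) := by positivity
    exact (sq_pos_iff.1 (this.trans_le hδ)).symm.lt_of_le hδ0
  generalize delta c α T ε = δ at *
  have hu0 : 0 < u := by linarith
  -- with this `θ` the deviation `u - √(8uδ)` is `(1 - θ) u`
  set θ : ℝ := √(8 * δ / u) with hθ
  have hθ0 : 0 < θ := Real.sqrt_pos.2 (by positivity)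
  have hθ1 : θ ≤ 1 := by
    exact Real.sqrt_le_one.2 ((div_le_one hu0).2 hu.le)
  have hθ2 : 8 * δ = u * θ ^ 2 := by
    rw [hθ, Real.sq_sqrt (by positivity)]
    field_simp
  have hsqrt : √(8 * u * δ) = u * θ := by
    rw [show 8 * u * δ = (u * θ) ^ 2 by rw [mul_pow]; linear_combination u * hθ2]
    exact Real.sqrt_sq (by positivity)
  obtain ⟨k₀, hk1, hk2⟩ := exists_chaining_level hα hD0 hε hθ0 hθ1 hθ2 (hεE.trans hcE) hcD hδ
  rw [← hq] at hk1
  have hεu : 4 * ε * √2 ^ k₀ ≤ u := by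
    refine abs_le_of_sq_le_sq' ?_ hu0.le |>.2
    have : (√2 ^ k₀) ^ 2 = (2 : ℝ) ^ k₀ := by rw [← pow_mul, mul_comm, pow_mul, hsq2]
    rw [mul_pow, this]
    have h1 : θ * u ^ 2 ≤ u ^ 2 := mul_le_of_le_one_left (by positivity) hθ1
    have h2 : 0 < 2 ^ k₀ * ε ^ 2 := by positivity
    nlinarith
  have hmain := measure_sup_gt_le_of_chaining (P := P) (Y := Y) (T := T) (ε := ε) (u := u)
    (ρ := (1 - θ / 2) * u / ε) (v := u / ε) (s := fun k => c₂ * q ^ k) (k₀ := k₀) hT hε.le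
    (div_nonneg (mul_nonneg (by linarith) hu0.le) hε.le) (by positivity) hmeas htail htail' hnorm
    (fun k => by positivity)
    (by simpa using (tendsto_pow_atTop_nhds_zero_of_lt_one hq0.le hq1).const_mul c₂)
    (fun k a ha b hb hab => ?_) hsep (fun m hm => ?_)
  · refine hmain.trans ?_
    rw [← ENNReal.ofReal_add (by positivity) (by positivity)]
    refine ENNReal.ofReal_le_ofReal ?_
    rw [hsqrt]
    exact add_exp_le_two_mul_exp hε hu0 hθ0 hθ1 hk2
  · rcases eq_or_ne a b with rfl | hne
    · simp
    · refine (hincr a ha b hb hne).trans (ENNReal.ofReal_le_ofReal ?_)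
      exact (sigma_le_sigma hc₁.le hα0 (abs_pos.2 (sub_ne_zero.2 hne)) hab).trans (hKs c₁ hc₁.le k)
  · have e2 : ε * ((1 - θ / 2) * u / ε) = (1 - θ / 2) * u := by field_simp
    have := sum_chaining_thresholds_le hq0 hr1 hc₂0 hε hu0 hθ0 hk1 hεu m
    linarith

/-! ### Gaussian variables in `L²` -/

section Gaussian

variable {Ω : Type*} [MeasurableSpace Ω] {P : Measure Ω}

/-- The real `L²` functions whose Laplace transform is at most that of a centered Gaussian variable
of the same norm. -/
def subgaussianSet (P : Measure Ω) : Set (Lp ℝ 2 P) :=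
  {g | ∀ l : ℝ, ∫⁻ ω, ENNReal.ofReal (Real.exp (l * g ω)) ∂P ≤
    ENNReal.ofReal (Real.exp (l ^ 2 * ‖g‖ ^ 2 / 2))}

lemma isClosed_subgaussianSet : IsClosed (subgaussianSet P) := by
  refine isClosed_of_closure_subset fun g hg l => ?_
  obtain ⟨u, hu, hlim⟩ := mem_closure_iff_seq_limit.1 hg
  obtain ⟨ns, hns, hae⟩ := (tendstoInMeasure_of_tendsto_Lp hlim).exists_seq_tendsto_ae
  have h1 : ∫⁻ ω, ENNReal.ofReal (Real.exp (l * g ω)) ∂P ≤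
      ∫⁻ ω, liminf (fun i => ENNReal.ofReal (Real.exp (l * u (ns i) ω))) atTop ∂P := by
    refine lintegral_mono_ae ?_
    filter_upwards [hae] with ω hω
    refine le_of_eq (Tendsto.liminf_eq ?_).symm
    exact ENNReal.tendsto_ofReal ((Real.continuous_exp.tendsto _).comp (hω.const_mul l))
  refine h1.trans ((lintegral_liminf_le' fun i => ?_).trans ?_)
  · exact (Real.measurable_exp.comp_aemeasurable
      ((Lp.aestronglyMeasurable _).aemeasurable.const_mul l)).ennreal_ofReal
  · have h2 : Tendsto (fun i => ENNReal.ofReal (Real.exp (l ^ 2 * ‖u (ns i)‖ ^ 2 / 2))) atTop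
        (𝓝 (ENNReal.ofReal (Real.exp (l ^ 2 * ‖g‖ ^ 2 / 2)))) := by
      refine ENNReal.tendsto_ofReal ((Real.continuous_exp.tendsto _).comp ?_)
      exact ((((hlim.comp hns.tendsto_atTop).norm).pow 2).const_mul _).div_const _
    rw [← h2.liminf_eq]
    exact liminf_le_liminf (Eventually.of_forall fun i => hu (ns i) l)

/-- Chernoff's bound. -/
lemma measure_gt_le_of_mem_subgaussianSet {g : Lp ℝ 2 P} (hg : g ∈ subgaussianSet P) {r : ℝ}
    (hr : 0 ≤ r) : P {ω | ‖g‖ * r < g ω} ≤ ENNReal.ofReal (Real.exp (-(r ^ 2 / 2))) := by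
  rcases (norm_nonneg g).eq_or_lt with h0 | h0
  · have hz : g = 0 := norm_eq_zero.1 h0.symm
    have : P {ω | ‖g‖ * r < g ω} = 0 := by
      rw [measure_eq_zero_iff_ae_notMem]
      filter_upwards [Lp.coeFn_zero ℝ 2 P] with ω hω
      subst hz
      rw [hω, norm_zero, zero_mul]
      exact lt_irrefl _
    rw [this]
    exact bot_le
  · set l : ℝ := r / ‖g‖ with hl
    have hl0 : 0 ≤ l := by positivity
    have hlg : l * ‖g‖ = r := by rw [hl]; field_simp
    have hmeas : AEMeasurable (fun ω => ENNReal.ofReal (Real.exp (l * g ω))) P :=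
      (Real.measurable_exp.comp_aemeasurable
        ((Lp.aestronglyMeasurable _).aemeasurable.const_mul l)).ennreal_ofReal
    have h1 : P {ω | ‖g‖ * r < g ω} ≤
        P {ω | ENNReal.ofReal (Real.exp (r ^ 2)) ≤ ENNReal.ofReal (Real.exp (l * g ω))} := by
      refine measure_mono fun ω hω => ?_
      refine ENNReal.ofReal_le_ofReal (Real.exp_le_exp.2 ?_)
      have : l * (‖g‖ * r) ≤ l * g ω := mul_le_mul_of_nonneg_left (le_of_lt hω) hl0
      rw [← mul_assoc, hlg] at this
      linarith
    have hpos : ENNReal.ofReal (Real.exp (r ^ 2)) ≠ 0 := by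
      simp [Real.exp_pos]
    refine h1.trans ((meas_ge_le_lintegral_div hmeas hpos ENNReal.ofReal_ne_top).trans ?_)
    refine (ENNReal.div_le_div_right (hg l) _).trans ?_
    rw [← ENNReal.ofReal_div_of_pos (Real.exp_pos _), ← Real.exp_sub]
    refine ENNReal.ofReal_le_ofReal (Real.exp_le_exp.2 ?_)
    rw [← mul_pow, hlg]
    linarith

lemma neg_mem_subgaussianSet {g : Lp ℝ 2 P} (hg : g ∈ subgaussianSet P) :
    -g ∈ subgaussianSet P := by
  intro l
  have h := hg (-l)
  rw [norm_neg]
  refine le_of_eq_of_le (lintegral_congr_ae ?_) (by rwa [neg_sq] at h)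
  filter_upwards [Lp.coeFn_neg g] with ω hω
  rw [hω, Pi.neg_apply, mul_neg, neg_mul]

lemma measure_abs_gt_le_of_mem_subgaussianSet {g : Lp ℝ 2 P} (hg : g ∈ subgaussianSet P) {r : ℝ}
    (hr : 0 ≤ r) : P {ω | ‖g‖ * r < |g ω|} ≤ ENNReal.ofReal (2 * Real.exp (-(r ^ 2 / 2))) := by
  have h1 := measure_gt_le_of_mem_subgaussianSet hg hr
  have h2 := measure_gt_le_of_mem_subgaussianSet (neg_mem_subgaussianSet hg) hr
  rw [two_mul, ENNReal.ofReal_add (Real.exp_pos _).le (Real.exp_pos _).le]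
  refine (measure_mono_ae ?_).trans ((measure_union_le {ω | ‖g‖ * r < g ω}
    {ω | ‖-g‖ * r < (-g : Lp ℝ 2 P) ω}).trans (add_le_add h1 h2))
  filter_upwards [Lp.coeFn_neg g] with ω hω h
  change ‖g‖ * r < |g ω| at h
  rcases lt_abs.1 h with h | h
  · exact Or.inl h
  · refine Or.inr ?_
    change ‖-g‖ * r < (-g : Lp ℝ 2 P) ω
    rw [norm_neg, hω]
    exact h

lemma norm_sq_eq_re_add_im (f : Lp ℂ 2 P) :
    ‖f‖ ^ 2 = ‖Complex.reCLM.compLp f‖ ^ 2 + ‖Complex.imCLM.compLp f‖ ^ 2 := by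
  have hR : ∀ g : Lp ℝ 2 P, ‖g‖ ^ 2 = ∫ ω, g ω ^ 2 ∂P := by
    intro g
    rw [← real_inner_self_eq_norm_sq, L2.inner_def]
    simp [sq]
  have hC : ‖f‖ ^ 2 = ∫ ω, ‖f ω‖ ^ 2 ∂P := by
    have h1 : ((‖f‖ ^ 2 : ℝ) : ℂ) = inner ℂ f f := by
      rw [inner_self_eq_norm_sq_to_K]; push_cast; rfl
    rw [L2.inner_def] at h1
    have h2 : ∫ ω, inner ℂ (f ω) (f ω) ∂P = ((∫ ω, ‖f ω‖ ^ 2 ∂P : ℝ) : ℂ) := by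
      rw [← integral_complex_ofReal]
      refine integral_congr_ae (Eventually.of_forall fun ω => ?_)
      simp only [inner_self_eq_norm_sq_to_K]
      push_cast
      rfl
    rw [h2] at h1
    exact_mod_cast h1
  rw [hR, hR, hC, ← integral_add]
  · refine integral_congr_ae ?_
    filter_upwards [Complex.reCLM.coeFn_compLp f, Complex.imCLM.coeFn_compLp f] with ω h1 h2
    simp only [h1, h2, Complex.reCLM_apply, Complex.imCLM_apply, ← Complex.normSq_eq_norm_sq,
      Complex.normSq_apply]
    ring
  · exact (Lp.memLp _).integrable_sq
  · exact (Lp.memLp _).integrable_sq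

/-- Real and imaginary parts may be correlated: `|Z|² > s² r²` with `s² ≥ E|Re Z|² + E|Im Z|²`
forces one of the two parts to exceed `r` standard deviations of its own. -/
lemma gaussianTail_of_mem_subgaussianSet {f : Lp ℂ 2 P} {Z : Ω → ℂ} (hZ : Z =ᵐ[P] f)
    (hre : Complex.reCLM.compLp f ∈ subgaussianSet P)
    (him : Complex.imCLM.compLp f ∈ subgaussianSet P) : GaussianTail P Z := by
  intro s r hs hr hle
  have hnorm : ‖f‖ ≤ s := by
    rw [Lp.norm_def, ← eLpNorm_congr_ae hZ]
    exact ENNReal.toReal_le_of_le_ofReal hs hle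
  have h4 : ENNReal.ofReal (4 * Real.exp (-(r ^ 2 / 2))) =
      ENNReal.ofReal (2 * Real.exp (-(r ^ 2 / 2))) +
        ENNReal.ofReal (2 * Real.exp (-(r ^ 2 / 2))) := by
    rw [← ENNReal.ofReal_add (by positivity) (by positivity)]
    congr 1
    ring
  rw [h4]
  refine (measure_mono_ae ?_).trans ((measure_union_le
    {ω | ‖Complex.reCLM.compLp f‖ * r < |Complex.reCLM.compLp f ω|}
    {ω | ‖Complex.imCLM.compLp f‖ * r < |Complex.imCLM.compLp f ω|}).trans
    (add_le_add (measure_abs_gt_le_of_mem_subgaussianSet hre hr)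
      (measure_abs_gt_le_of_mem_subgaussianSet him hr)))
  filter_upwards [hZ, Complex.reCLM.coeFn_compLp f, Complex.imCLM.coeFn_compLp f] with ω h0 h1 h2 h
  change s * r < ‖Z ω‖ at h
  by_contra hcon
  have c1 : |Complex.reCLM.compLp f ω| ≤ ‖Complex.reCLM.compLp f‖ * r :=
    not_lt.1 fun hlt => hcon (Or.inl hlt)
  have c2 : |Complex.imCLM.compLp f ω| ≤ ‖Complex.imCLM.compLp f‖ * r :=
    not_lt.1 fun hlt => hcon (Or.inr hlt)
  rw [h1, Complex.reCLM_apply] at c1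
  rw [h2, Complex.imCLM_apply] at c2
  rw [h0] at h
  have h5 := norm_sq_eq_re_add_im f
  have h6 : ‖f ω‖ ^ 2 = |(f ω).re| ^ 2 + |(f ω).im| ^ 2 := by
    rw [← Complex.normSq_eq_norm_sq, Complex.normSq_apply, sq_abs, sq_abs]
    ring
  have h7 : (s * r) ^ 2 < ‖f ω‖ ^ 2 := by
    have : 0 ≤ s * r := by positivity
    gcongr
  have h8 : |(f ω).re| ^ 2 ≤ (‖Complex.reCLM.compLp f‖ * r) ^ 2 := by gcongr
  have h9 : |(f ω).im| ^ 2 ≤ (‖Complex.imCLM.compLp f‖ * r) ^ 2 := by gcongr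
  have h10 : ‖f‖ ^ 2 * r ^ 2 ≤ s ^ 2 * r ^ 2 := by gcongr
  rw [mul_pow] at h7 h8 h9
  rw [h5] at h10
  linarith

/-- A centered real Gaussian variable is in the subgaussian set. -/
lemma mem_subgaussianSet_of_hasGaussianLaw {U : Ω → ℝ} (hU : HasGaussianLaw U P)
    (h0 : ∫ ω, U ω ∂P = 0) {g : Lp ℝ 2 P} (hg : g =ᵐ[P] U) : g ∈ subgaussianSet P := by
  intro l
  have hP := hU.isProbabilityMeasure
  have hmap := hU.map_eq_gaussianReal
  rw [h0] at hmap
  have hmgf := mgf_gaussianReal hmap l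
  have hnorm : ‖g‖ ^ 2 = Var[U; P] := by
    rw [variance_of_integral_eq_zero hU.aemeasurable h0, ← real_inner_self_eq_norm_sq,
      L2.inner_def]
    refine integral_congr_ae ?_
    filter_upwards [hg] with ω hω
    simp [hω, sq]
  rw [zero_mul, zero_add, Real.coe_toNNReal _ (variance_nonneg _ _)] at hmgf
  have hint : Integrable (fun ω => Real.exp (l * U ω)) P := by
    by_contra hcon
    rw [mgf, integral_undef hcon] at hmgf
    exact (Real.exp_pos _).ne hmgf
  have : ∫⁻ ω, ENNReal.ofReal (Real.exp (l * g ω)) ∂P =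
      ∫⁻ ω, ENNReal.ofReal (Real.exp (l * U ω)) ∂P := by
    refine lintegral_congr_ae ?_
    filter_upwards [hg] with ω hω
    rw [hω]
  rw [this, ← ofReal_integral_eq_lintegral_ofReal hint
    (Eventually.of_forall fun ω => (Real.exp_pos _).le)]
  change ENNReal.ofReal (mgf U P l) ≤ _
  rw [hmgf, hnorm, mul_comm]

end Gaussian

/-! ### The spectral representation -/

/-- The spectral measure `S(z) dz / 2π`. -/
noncomputable def spectralMeasure (S : ℝ → ℝ) : Measure ℝ :=
  volume.withDensity fun z => ENNReal.ofReal (S z / (2 * Real.pi))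

lemma isFiniteMeasure_spectralMeasure {S : ℝ → ℝ} (hS : Integrable S) :
    IsFiniteMeasure (spectralMeasure S) := by
  refine isFiniteMeasure_withDensity ?_
  exact (hS.div_const (2 * Real.pi)).lintegral_lt_top.ne

lemma integral_spectralMeasure {S : ℝ → ℝ} (hS : Integrable S) (h0 : ∀ z, 0 ≤ S z) (F : ℝ → ℂ) :
    ∫ z, F z ∂spectralMeasure S = (2 * (Real.pi : ℂ))⁻¹ * ∫ z, F z * (S z : ℂ) := by
  unfold spectralMeasure
  rw [integral_withDensity_eq_integral_toReal_smul₀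
    (hS.div_const (2 * Real.pi)).aemeasurable.ennreal_ofReal
    (Eventually.of_forall fun z => ENNReal.ofReal_lt_top), ← integral_const_mul]
  refine integral_congr_ae (Eventually.of_forall fun z => ?_)
  have : 0 ≤ S z / (2 * Real.pi) := div_nonneg (h0 z) (by positivity)
  simp only [ENNReal.toReal_ofReal this, Complex.real_smul]
  push_cast
  field_simp

/-- The exponential `z ↦ e^{itz}`. -/
noncomputable def expo (t z : ℝ) : ℂ := Complex.exp (Complex.I * (t : ℂ) * (z : ℂ))

lemma norm_expo (t z : ℝ) : ‖expo t z‖ = 1 := by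
  unfold expo
  rw [show Complex.I * (t : ℂ) * (z : ℂ) = ((t * z : ℝ) : ℂ) * Complex.I by push_cast; ring]
  exact Complex.norm_exp_ofReal_mul_I _

lemma continuous_expo_uncurry : Continuous (fun p : ℝ × ℝ => expo p.1 p.2) := by
  unfold expo
  fun_prop

lemma continuous_expo (t : ℝ) : Continuous (expo t) := by
  unfold expo
  fun_prop

lemma norm_expo_sub_expo_le (t s z : ℝ) : ‖expo t z - expo s z‖ ≤ |t - s| * |z| := by
  have h : expo t z - expo s z = expo s z * (Complex.exp (Complex.I * ((t - s) * z : ℝ)) - 1) := by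
    unfold expo
    rw [mul_sub, ← Complex.exp_add, mul_one]
    congr 2
    push_cast
    ring
  rw [h, norm_mul, norm_expo, one_mul, ← abs_mul]
  exact Real.norm_exp_I_mul_ofReal_sub_one_le

lemma memLp_of_bound {S : ℝ → ℝ} (hS : Integrable S) {F : ℝ → ℂ}
    (hF : AEStronglyMeasurable F) {C : ℝ} (hC : ∀ z, ‖F z‖ ≤ C) :
    MemLp F 2 (spectralMeasure S) := by
  have := isFiniteMeasure_spectralMeasure hS
  exact MemLp.of_bound (hF.mono_ac (withDensity_absolutelyContinuous _ _)) C
    (Eventually.of_forall hC)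

lemma memLp_expo {S : ℝ → ℝ} (hS : Integrable S) (t : ℝ) :
    MemLp (expo t) 2 (spectralMeasure S) :=
  memLp_of_bound hS (continuous_expo t).aestronglyMeasurable (C := 1) fun z => (norm_expo t z).le

section

variable {Ω : Type*} [MeasurableSpace Ω] {P : Measure Ω} {X : ℝ → Ω → ℂ} {R : ℝ → ℂ} {S : ℝ → ℝ}

/-- The graph of the spectral isometry: the closed linear span in `L²(P) × L²(μ)` of the pairs
`(X(t), e^{itz})`, where `μ` is the spectral measure. -/
noncomputable def spectralGraph (hX : ∀ t, MemLp (X t) 2 P) (hS : Integrable S) :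
    Submodule ℂ (Lp ℂ 2 P × Lp ℂ 2 (spectralMeasure S)) :=
  (Submodule.span ℂ (Set.range fun t : ℝ =>
    ((hX t).toLp (X t), (memLp_expo hS t).toLp (expo t)))).topologicalClosure

lemma generator_mem_spectralGraph (hX : ∀ t, MemLp (X t) 2 P) (hS : Integrable S) (t : ℝ) :
    ((hX t).toLp (X t), (memLp_expo hS t).toLp (expo t)) ∈ spectralGraph hX hS :=
  Submodule.le_topologicalClosure _ (Submodule.subset_span ⟨t, rfl⟩)

lemma inner_generators (hX : ∀ t, MemLp (X t) 2 P) (hR : IsSpectralDensity R S)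
    (hG : IsStationaryGaussian P X R) (s t : ℝ) :
    inner ℂ ((hX t).toLp (X t)) ((hX s).toLp (X s)) =
      inner ℂ ((memLp_expo hR.integrable t).toLp (expo t))
        ((memLp_expo hR.integrable s).toLp (expo s)) := by
  rw [L2.inner_def, L2.inner_def]
  have h1 : ∫ ω, inner ℂ ((hX t).toLp (X t) ω) ((hX s).toLp (X s) ω) ∂P = R (s - t) := by
    rw [← hG.covariance s t]
    refine integral_congr_ae ?_
    filter_upwards [(hX t).coeFn_toLp, (hX s).coeFn_toLp] with ω h1 h2
    rw [h1, h2, RCLike.inner_apply]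
  have h2 : ∫ z, inner ℂ ((memLp_expo hR.integrable t).toLp (expo t) z)
      ((memLp_expo hR.integrable s).toLp (expo s) z) ∂spectralMeasure S = R (s - t) := by
    have : ∫ z, inner ℂ ((memLp_expo hR.integrable t).toLp (expo t) z)
      ((memLp_expo hR.integrable s).toLp (expo s) z) ∂spectralMeasure S =
        ∫ z, expo (s - t) z ∂spectralMeasure S := by
      refine integral_congr_ae ?_
      filter_upwards [(memLp_expo hR.integrable t).coeFn_toLp,
        (memLp_expo hR.integrable s).coeFn_toLp] with z h1 h2
      rw [h1, h2, RCLike.inner_apply]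
      unfold expo
      rw [← Complex.exp_conj, ← Complex.exp_add]
      congr 1
      simp
      ring
    rw [this, integral_spectralMeasure hR.integrable hR.nonneg, hR.eq_integral]
    rfl
  rw [h1, h2]

/-- The isometry property extends from the generators to the closed span, one argument at a time. -/
lemma inner_eq_of_mem_spectralGraph (hX : ∀ t, MemLp (X t) 2 P) (hR : IsSpectralDensity R S)
    (hG : IsStationaryGaussian P X R) {p q : Lp ℂ 2 P × Lp ℂ 2 (spectralMeasure S)}
    (hp : p ∈ spectralGraph hX hR.integrable) (hq : q ∈ spectralGraph hX hR.integrable) :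
    inner ℂ p.1 q.1 = inner ℂ p.2 q.2 := by
  -- for fixed `a`, the pairs whose inner products with `a` agree form a closed subspace
  have key : ∀ a : Lp ℂ 2 P × Lp ℂ 2 (spectralMeasure S),
      (∀ t, inner ℂ a.1 ((hX t).toLp (X t)) =
        inner ℂ a.2 ((memLp_expo hR.integrable t).toLp (expo t))) →
      ∀ b ∈ spectralGraph hX hR.integrable, inner ℂ a.1 b.1 = inner ℂ a.2 b.2 := by
    intro a ha b hb
    let L : Lp ℂ 2 P × Lp ℂ 2 (spectralMeasure S) →L[ℂ] ℂ :=
      (innerSL ℂ a.1).comp (ContinuousLinearMap.fst ℂ _ _) -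
        (innerSL ℂ a.2).comp (ContinuousLinearMap.snd ℂ _ _)
    have hle : spectralGraph hX hR.integrable ≤ LinearMap.ker (L : _ →ₗ[ℂ] ℂ) := by
      refine Submodule.topologicalClosure_minimal _ ?_ L.isClosed_ker
      rw [Submodule.span_le]
      rintro _ ⟨t, rfl⟩
      change inner ℂ a.1 ((hX t).toLp (X t)) -
        inner ℂ a.2 ((memLp_expo hR.integrable t).toLp (expo t)) = 0
      rw [ha t, sub_self]
    have := hle hb
    change inner ℂ a.1 b.1 - inner ℂ a.2 b.2 = 0 at this
    exact sub_eq_zero.1 this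
  refine key p (fun t => ?_) q hq
  rw [← inner_conj_symm, ← inner_conj_symm p.2]
  congr 1
  exact key ((hX t).toLp (X t), (memLp_expo hR.integrable t).toLp (expo t))
    (fun s => inner_generators hX hR hG s t) p hp

lemma norm_eq_of_mem_spectralGraph (hX : ∀ t, MemLp (X t) 2 P) (hR : IsSpectralDensity R S)
    (hG : IsStationaryGaussian P X R) {p : Lp ℂ 2 P × Lp ℂ 2 (spectralMeasure S)}
    (hp : p ∈ spectralGraph hX hR.integrable) : ‖p.1‖ = ‖p.2‖ := by
  have h := inner_eq_of_mem_spectralGraph hX hR hG hp hp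
  rw [inner_self_eq_norm_sq_to_K, inner_self_eq_norm_sq_to_K] at h
  have h' : ‖p.1‖ ^ 2 = ‖p.2‖ ^ 2 := by exact_mod_cast h
  exact (pow_left_inj₀ (norm_nonneg _) (norm_nonneg _) two_ne_zero).1 h'

lemma coeFn_finset_sum {ι : Type*} (s : Finset ι) (f : ι → Lp ℝ 2 P) :
    ((∑ i ∈ s, f i : Lp ℝ 2 P) : Ω → ℝ) =ᵐ[P] fun ω => ∑ i ∈ s, f i ω := by
  classical
  induction s using Finset.induction_on with
  | empty =>
    simp only [Finset.sum_empty]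
    exact Lp.coeFn_zero ℝ 2 P
  | insert i s hi ih =>
    rw [Finset.sum_insert hi]
    filter_upwards [Lp.coeFn_add (f i) (∑ i ∈ s, f i), ih] with ω h1 h2
    rw [h1, Pi.add_apply, h2, Finset.sum_insert hi]

/-- Finite linear combinations of the process have Gaussian real-linear images, and the subgaussian
set is closed in `L²`. -/
lemma mem_subgaussianSet_of_mem_spectralGraph (hX : ∀ t, MemLp (X t) 2 P) (hS : Integrable S)
    (hG : IsStationaryGaussian P X R) {p : Lp ℂ 2 P × Lp ℂ 2 (spectralMeasure S)}
    (hp : p ∈ spectralGraph hX hS) (L : ℂ →L[ℝ] ℝ) : L.compLp p.1 ∈ subgaussianSet P := by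
  have hcont : Continuous fun p : Lp ℂ 2 P × Lp ℂ 2 (spectralMeasure S) =>
      (L.compLpL 2 P) p.1 := (L.compLpL 2 P).continuous.comp continuous_fst
  have hcl : IsClosed {p : Lp ℂ 2 P × Lp ℂ 2 (spectralMeasure S) |
      (L.compLpL 2 P) p.1 ∈ subgaussianSet P} := isClosed_subgaussianSet.preimage hcont
  refine closure_minimal ?_ hcl hp
  intro p hp
  obtain ⟨c, rfl⟩ := Finsupp.mem_span_range_iff_exists_finsupp.1 hp
  have hproc : IsGaussianProcess (fun t ω => (L.comp
      ((ContinuousLinearMap.mul ℂ ℂ (c t)).restrictScalars ℝ)) (X t ω)) P :=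
    hG.gaussian.comp_left _
  refine mem_subgaussianSet_of_hasGaussianLaw (hproc.hasGaussianLaw_fun_sum (I := c.support)) ?_ ?_
  · have hint : ∀ t, Integrable (X t) P := by
      intro t
      have := hG.gaussian.isProbabilityMeasure
      exact (hX t).integrable (by norm_num)
    rw [integral_finsetSum]
    · refine Finset.sum_eq_zero fun t _ => ?_
      rw [ContinuousLinearMap.integral_comp_comm _ (hint t), hG.centered t, map_zero]
    · intro t _
      exact ContinuousLinearMap.integrable_comp _ (hint t)
  · have h1 : (c.sum fun t a => a • ((hX t).toLp (X t), (memLp_expo hS t).toLp (expo t))).1 =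
        ∑ t ∈ c.support, c t • (hX t).toLp (X t) := by
      rw [Finsupp.sum, Prod.fst_sum]
      rfl
    change ((L.compLpL 2 P) (c.sum fun t a => a • ((hX t).toLp (X t),
      (memLp_expo hS t).toLp (expo t))).1 : Lp ℝ 2 P) =ᵐ[P] _
    rw [h1, map_sum]
    have h2 : ∀ t, ((L.compLpL 2 P) (c t • (hX t).toLp (X t)) : Lp ℝ 2 P) =ᵐ[P]
        fun ω => (L.comp ((ContinuousLinearMap.mul ℂ ℂ (c t)).restrictScalars ℝ)) (X t ω) := by
      intro t
      filter_upwards [L.coeFn_compLpL (c t • (hX t).toLp (X t)),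
        Lp.coeFn_smul (c t) ((hX t).toLp (X t)), (hX t).coeFn_toLp] with ω e1 e2 e3
      rw [e1, e2, Pi.smul_apply, e3]
      rfl
    refine (coeFn_finset_sum _ _).trans ?_
    filter_upwards [(ae_ball_iff c.support.countable_toSet).2 fun t _ => h2 t] with ω hω
    exact Finset.sum_congr rfl fun t ht => hω t ht

lemma integral_mem_spectralGraph (hX : ∀ t, MemLp (X t) 2 P) (hS : Integrable S)
    {f : ℝ → Lp ℂ 2 P × Lp ℂ 2 (spectralMeasure S)} (hf : Integrable f)
    (hmem : ∀ t, f t ∈ spectralGraph hX hS) : ∫ t, f t ∈ spectralGraph hX hS := by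
  set W := spectralGraph hX hS with hW
  have hcl : IsClosed (W : Set (Lp ℂ 2 P × Lp ℂ 2 (spectralMeasure S))) :=
    Submodule.isClosed_topologicalClosure _
  have h := W.mkQL.integral_comp_comm hf
  have h0 : ∀ t, W.mkQL (f t) = 0 := fun t => by
    rw [Submodule.mkQL_apply]
    exact (Submodule.Quotient.mk_eq_zero W).2 (hmem t)
  simp only [h0, integral_zero] at h
  rw [Submodule.mkQL_apply] at h
  exact (Submodule.Quotient.mk_eq_zero W).1 h.symm

lemma continuous_toLp_expo (hS : Integrable S)
    (hS2 : MemLp (fun z : ℝ => z) 2 (spectralMeasure S)) :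
    Continuous fun t : ℝ => (memLp_expo hS t).toLp (expo t) := by
  have h : LipschitzWith ‖hS2.toLp _‖₊ fun t : ℝ => (memLp_expo hS t).toLp (expo t) := by
    refine LipschitzWith.of_dist_le_mul fun t s => ?_
    rw [dist_eq_norm, Real.dist_eq, coe_nnnorm, mul_comm]
    refine Lp.norm_le_mul_norm_of_ae_le_mul ?_
    filter_upwards [hS2.coeFn_toLp, (memLp_expo hS t).coeFn_toLp, (memLp_expo hS s).coeFn_toLp,
      Lp.coeFn_sub ((memLp_expo hS t).toLp (expo t)) ((memLp_expo hS s).toLp (expo s))]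
      with z h1 h2 h3 h4
    rw [h4, Pi.sub_apply, h1, h2, h3, Real.norm_eq_abs]
    exact norm_expo_sub_expo_le t s z
  exact h.continuous

/-- Mean-square integrals of the exponentials are computed pointwise in the frequency. -/
lemma integral_smul_toLp_expo (hS : Integrable S) {g : ℝ → ℂ} (hg : Integrable g)
    (hint : Integrable fun t => g t • (memLp_expo hS t).toLp (expo t))
    (hF : MemLp (fun z => ∫ t, g t * expo t z) 2 (spectralMeasure S)) :
    ∫ t, g t • (memLp_expo hS t).toLp (expo t) = hF.toLp _ := by
  have := isFiniteMeasure_spectralMeasure hS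
  refine ext_inner_left ℂ fun w => ?_
  rw [← integral_inner hint, L2.inner_def]
  have hw : Integrable w (spectralMeasure S) := (Lp.memLp w).integrable (by norm_num)
  have h1 : ∀ t, inner ℂ w (g t • (memLp_expo hS t).toLp (expo t)) =
      ∫ z, g t * expo t z * conj (w z) ∂spectralMeasure S := by
    intro t
    rw [inner_smul_right, L2.inner_def, ← integral_const_mul]
    refine integral_congr_ae ?_
    filter_upwards [(memLp_expo hS t).coeFn_toLp] with z hz
    rw [hz, RCLike.inner_apply, mul_assoc]
  have h2 : ∫ z, inner ℂ (w z) (hF.toLp (fun z => ∫ t, g t * expo t z) z) ∂spectralMeasure S =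
      ∫ z, (∫ t, g t * expo t z * conj (w z)) ∂spectralMeasure S := by
    refine integral_congr_ae ?_
    filter_upwards [hF.coeFn_toLp] with z hz
    rw [hz, RCLike.inner_apply]
    exact (integral_mul_const (conj (w z)) fun t => g t * expo t z).symm
  rw [h2]
  simp only [h1]
  refine integral_integral_swap (μ := volume) (ν := spectralMeasure S)
    (f := fun t z => g t * expo t z * conj (w z)) ?_
  have h3 : Integrable (fun p : ℝ × ℝ => g p.1 * conj (w p.2))
      (volume.prod (spectralMeasure S)) := by
    have hcw : Integrable (fun z => conj (w z)) (spectralMeasure S) :=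
      (Complex.conjCLE : ℂ →L[ℝ] ℂ).integrable_comp hw
    exact hg.mul_prod hcw
  have h4 := h3.bdd_mul (c := 1) (f := fun p : ℝ × ℝ => expo p.1 p.2)
    continuous_expo_uncurry.aestronglyMeasurable
    (Eventually.of_forall fun p => (norm_expo _ _).le)
  refine h4.congr (Eventually.of_forall fun p => ?_)
  simp only [Function.uncurry]
  ring

/-- The random variable `Z` corresponds to the function `F` of the frequency under the spectral
isometry. -/
def Represents (hX : ∀ t, MemLp (X t) 2 P) (hS : Integrable S) (Z : Ω → ℂ) (F : ℝ → ℂ) : Prop :=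
  ∃ (hZ : MemLp Z 2 P) (hF : MemLp F 2 (spectralMeasure S)),
    (hZ.toLp Z, hF.toLp F) ∈ spectralGraph hX hS

lemma represents_self (hX : ∀ t, MemLp (X t) 2 P) (hS : Integrable S) (t : ℝ) :
    Represents hX hS (X t) (expo t) :=
  ⟨hX t, memLp_expo hS t, generator_mem_spectralGraph hX hS t⟩

lemma Represents.sub {hX : ∀ t, MemLp (X t) 2 P} {hS : Integrable S} {Z Z' : Ω → ℂ} {F F' : ℝ → ℂ}
    (h : Represents hX hS Z F) (h' : Represents hX hS Z' F') :
    Represents hX hS (fun ω => Z ω - Z' ω) (fun z => F z - F' z) := by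
  obtain ⟨h1, h2, h3⟩ := h
  obtain ⟨h1', h2', h3'⟩ := h'
  exact ⟨h1.sub h1', h2.sub h2', Submodule.sub_mem _ h3 h3'⟩

lemma Represents.add {hX : ∀ t, MemLp (X t) 2 P} {hS : Integrable S} {Z Z' : Ω → ℂ} {F F' : ℝ → ℂ}
    (h : Represents hX hS Z F) (h' : Represents hX hS Z' F') :
    Represents hX hS (fun ω => Z ω + Z' ω) (fun z => F z + F' z) := by
  obtain ⟨h1, h2, h3⟩ := h
  obtain ⟨h1', h2', h3'⟩ := h'
  exact ⟨h1.add h1', h2.add h2', Submodule.add_mem _ h3 h3'⟩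

lemma Represents.mul_const {hX : ∀ t, MemLp (X t) 2 P} {hS : Integrable S} {Z : Ω → ℂ} {F : ℝ → ℂ}
    (h : Represents hX hS Z F) (c : ℂ) :
    Represents hX hS (fun ω => Z ω * c) (fun z => F z * c) := by
  obtain ⟨h1, h2, h3⟩ := h
  have e1 : (fun ω => Z ω * c) = c • Z := by ext; simp [mul_comm]
  have e2 : (fun z => F z * c) = c • F := by ext; simp [mul_comm]
  rw [e1, e2]
  exact ⟨h1.const_smul c, h2.const_smul c, Submodule.smul_mem _ c h3⟩

lemma represents_zero (hX : ∀ t, MemLp (X t) 2 P) (hS : Integrable S) :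
    Represents hX hS (fun _ => 0) (fun _ => 0) :=
  ⟨MemLp.zero, MemLp.zero, Submodule.zero_mem _⟩

lemma Represents.sum {hX : ∀ t, MemLp (X t) 2 P} {hS : Integrable S} {ι : Type*} {s : Finset ι}
    {Z : ι → Ω → ℂ} {F : ι → ℝ → ℂ} (h : ∀ i ∈ s, Represents hX hS (Z i) (F i)) :
    Represents hX hS (fun ω => ∑ i ∈ s, Z i ω) (fun z => ∑ i ∈ s, F i z) := by
  classical
  induction s using Finset.induction_on with
  | empty => simpa using represents_zero hX hS
  | insert i s hi ih =>
    simp only [Finset.sum_insert hi]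
    exact (h i (Finset.mem_insert_self i s)).add
      (ih fun j hj => h j (Finset.mem_insert_of_mem hj))

lemma Represents.eLpNorm_eq {hX : ∀ t, MemLp (X t) 2 P} {hR : IsSpectralDensity R S}
    {Z : Ω → ℂ} {F : ℝ → ℂ} (h : Represents hX hR.integrable Z F)
    (hG : IsStationaryGaussian P X R) : eLpNorm Z 2 P = eLpNorm F 2 (spectralMeasure S) := by
  obtain ⟨h1, h2, h3⟩ := h
  have := norm_eq_of_mem_spectralGraph hX hR hG h3
  rw [Lp.norm_toLp, Lp.norm_toLp] at this
  exact (ENNReal.toReal_eq_toReal_iff' h1.eLpNorm_ne_top h2.eLpNorm_ne_top).1 this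

lemma Represents.gaussianTail {hX : ∀ t, MemLp (X t) 2 P} {hS : Integrable S}
    {Z : Ω → ℂ} {F : ℝ → ℂ} (h : Represents hX hS Z F) (hG : IsStationaryGaussian P X R) :
    GaussianTail P Z := by
  obtain ⟨h1, h2, h3⟩ := h
  exact gaussianTail_of_mem_subgaussianSet h1.coeFn_toLp.symm
    (mem_subgaussianSet_of_mem_spectralGraph hX hS hG h3 Complex.reCLM)
    (mem_subgaussianSet_of_mem_spectralGraph hX hS hG h3 Complex.imCLM)

/-- The pairs `(X t, expo t)` are integrated in the product space, so that the integral stays in the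
closed span. The second moment of the spectral measure makes `t ↦ expo t` continuous in `L²`. -/
lemma represents_of_isMeanSquareIntegral (hX : ∀ t, MemLp (X t) 2 P) (hS : Integrable S)
    (hS2 : MemLp (fun z : ℝ => z) 2 (spectralMeasure S)) {g : ℝ → ℂ} (hg : Integrable g)
    {ξ : Ω → ℂ} (hξ : IsMeanSquareIntegral P X g ξ) :
    Represents hX hS ξ (fun z => ∫ t, g t * expo t z) := by
  obtain ⟨hX', hξ2, hint, heq⟩ := hξ
  have hFm : Measurable fun z : ℝ => ∫ t, g t * expo t z := by
    have : AEStronglyMeasurable g volume := hg.aestronglyMeasurable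
    have e : (fun z : ℝ => ∫ t, g t * expo t z) = fun z => ∫ t, this.mk g t * expo t z := by
      ext z
      refine integral_congr_ae ?_
      filter_upwards [this.ae_eq_mk] with t ht
      rw [ht]
    rw [e]
    have h : StronglyMeasurable (Function.uncurry fun z t : ℝ => this.mk g t * expo t z) := by
      refine StronglyMeasurable.mul ?_ ?_
      · exact this.stronglyMeasurable_mk.comp_measurable measurable_snd
      · exact (continuous_expo_uncurry.comp continuous_swap).stronglyMeasurable
    exact h.integral_prod_right.measurable
  have hF : MemLp (fun z => ∫ t, g t * expo t z) 2 (spectralMeasure S) := by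
    refine memLp_of_bound hS hFm.aestronglyMeasurable (C := ∫ t, ‖g t‖) fun z => ?_
    refine (norm_integral_le_integral_norm _).trans (le_of_eq ?_)
    simp [norm_expo]
  -- the exponentials all have the same norm, so `g` is the only integrability condition
  have hintE : Integrable fun t => g t • (memLp_expo hS t).toLp (expo t) := by
    have hc := continuous_toLp_expo hS hS2
    refine Integrable.mono' (g := fun t => ‖g t‖ * ‖(memLp_expo hS 0).toLp (expo 0)‖)
      (hg.norm.mul_const _) (hg.aestronglyMeasurable.smul hc.aestronglyMeasurable) ?_
    refine Eventually.of_forall fun t => ?_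
    rw [norm_smul]
    refine mul_le_mul_of_nonneg_left (le_of_eq ?_) (norm_nonneg _)
    rw [Lp.norm_toLp, Lp.norm_toLp]
    congr 1
    refine eLpNorm_congr_norm_ae (Eventually.of_forall fun z => ?_)
    rw [norm_expo, norm_expo]
  refine ⟨hξ2, hF, ?_⟩
  rw [heq, ← integral_smul_toLp_expo hS hg hintE hF, ← integral_pair hint hintE]
  exact integral_mem_spectralGraph hX hS (hint.prodMk hintE) fun t =>
    Submodule.smul_mem _ (g t) (generator_mem_spectralGraph hX hS t)

end

/-! ### Radially decreasing majorants -/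

/-- The almost everywhere bound of Assumption S, turned into pointwise bounds by continuity. -/
lemma AssumptionS.exists_majorant {f : ℝ → ℂ} (hf : AssumptionS f) (hc : Continuous f) :
    ∃ Φ : ℝ → ℝ, AntitoneOn Φ (Set.Ici 0) ∧ Integrable (fun x : ℝ => Φ |x|) ∧
      (∀ r, 0 ≤ r → 0 ≤ Φ r) ∧ (∀ y r, 0 ≤ r → r < |y| → ‖f y‖ ≤ Φ r) ∧ ∀ y, ‖f y‖ ≤ Φ 0 := by
  obtain ⟨Φ, hanti, hae, hint⟩ := hf
  have hdense : Dense {x : ℝ | ‖f x‖ ≤ Φ |x|} := Measure.dense_of_ae hae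
  have h1 : ∀ y r, 0 ≤ r → r < |y| → ‖f y‖ ≤ Φ r := by
    intro y r hr hy
    have hopen : IsOpen {x : ℝ | r < |x|} := isOpen_lt continuous_const continuous_abs
    have h := hdense.open_subset_closure_inter hopen
    have hcl : IsClosed {x : ℝ | ‖f x‖ ≤ Φ r} := isClosed_le hc.norm continuous_const
    refine closure_minimal ?_ hcl (h hy)
    rintro x ⟨hx1, hx2⟩
    exact le_trans hx2 (hanti hr (abs_nonneg x) (le_of_lt hx1))
  have h2 : ∀ y, ‖f y‖ ≤ Φ 0 := by
    intro y
    have hcl : IsClosed {x : ℝ | ‖f x‖ ≤ Φ 0} := isClosed_le hc.norm continuous_const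
    refine closure_minimal ?_ hcl (hdense y)
    intro x hx
    exact le_trans hx (hanti (Set.mem_Ici.2 le_rfl) (abs_nonneg x) (abs_nonneg x))
  refine ⟨Φ, hanti, hint, fun r hr => ?_, h1, h2⟩
  have := h1 (r + 1) r hr (by rw [abs_of_nonneg (by linarith)]; linarith)
  exact (norm_nonneg _).trans this

lemma AssumptionS.integrable {f : ℝ → ℂ} (hf : AssumptionS f) (hc : Continuous f) :
    Integrable f := by
  obtain ⟨Φ, -, hae, hint⟩ := hf
  exact hint.mono' hc.aestronglyMeasurable hae

/-- A nonincreasing integrable majorant `Φ` is at most of order `1/x`, since `x Φ(x)` is controlled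
by its integral. -/
lemma AssumptionS.exists_decay {f : ℝ → ℂ} (hf : AssumptionS f) (hc : Continuous f) :
    ∃ C : ℝ, 0 ≤ C ∧ (∀ y, ‖f y‖ ≤ C) ∧ ∀ y, |y| * ‖f y‖ ≤ C := by
  obtain ⟨Φ, hanti, hint, hnn, h1, h2⟩ := hf.exists_majorant hc
  have hI : 0 ≤ ∫ x, Φ |x| := integral_nonneg fun x => hnn _ (abs_nonneg x)
  refine ⟨Φ 0 + 2 * ∫ x, Φ |x|, add_nonneg (hnn 0 le_rfl) (by linarith), fun y => ?_, fun y => ?_⟩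
  · linarith [h2 y]
  rcases eq_or_ne y 0 with rfl | hy
  · rw [abs_zero, zero_mul]
    have := hnn 0 le_rfl
    linarith
  have hy0 : 0 < |y| := abs_pos.2 hy
  set r := |y| / 2 with hr
  have hr0 : 0 < r := by positivity
  have h3 : r * Φ r ≤ ∫ x, Φ |x| := by
    have e : r * Φ r = ∫ _ in Set.Ioc 0 r, Φ r := by
      simp [hr0.le]
    rw [e]
    calc ∫ _ in Set.Ioc 0 r, Φ r ≤ ∫ x in Set.Ioc 0 r, Φ |x| := by
          refine setIntegral_mono_on (integrableOn_const (by simp)) hint.integrableOn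
            measurableSet_Ioc fun x hx => ?_
          rw [abs_of_pos hx.1]
          exact hanti hx.1.le hr0.le hx.2
      _ ≤ ∫ x, Φ |x| :=
          setIntegral_le_integral hint (Eventually.of_forall fun x => hnn _ (abs_nonneg x))
  have h4 := h1 y r hr0.le (by linarith)
  have h5 : |y| * ‖f y‖ ≤ 2 * (r * Φ r) := by
    have : |y| = 2 * r := by rw [hr]; ring
    rw [this, mul_assoc]
    gcongr
  have := hnn 0 le_rfl
  linarith

lemma AssumptionS.exists_summable_bound {f : ℝ → ℂ} (hf : AssumptionS f) (hc : Continuous f)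
    (N : ℕ) : ∃ b : ℤ → ℝ, Summable b ∧ ∀ k : ℤ, ∀ x : ℝ, |x| ≤ N → ‖f (x - k)‖ ≤ b k := by
  obtain ⟨Φ, hanti, hint, hnn, h1, h2⟩ := hf.exists_majorant hc
  refine ⟨fun k => Φ (max (|(k : ℝ)| - N - 1) 0), ?_, fun k x hx => ?_⟩
  · have hs : Summable fun n : ℕ => Φ n := by
      refine AntitoneOn.summable_of_integrableOn_Ioi_zero hanti ?_ ?_
      · refine hint.integrableOn.congr_fun (fun x hx => ?_) measurableSet_Ioi
        simp only
        rw [abs_of_pos hx]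
      · intro x hx
        exact hnn x (le_of_lt hx)
    have hs' : Summable fun n : ℕ => Φ (max (((n : ℕ) : ℝ) - N - 1) 0) := by
      rw [← summable_nat_add_iff (N + 1)]
      refine hs.congr fun n => ?_
      have : (((n + (N + 1) : ℕ) : ℝ) - N - 1) = n := by push_cast; ring
      rw [this, max_eq_left (Nat.cast_nonneg n)]
    refine Summable.of_nat_of_neg ?_ ?_
    · simpa using hs'
    · simpa using hs'
  · rcases le_or_gt (|(k : ℝ)| - N - 1) 0 with h | h
    · simp only [max_eq_right h]
      exact h2 _
    · simp only [max_eq_left h.le]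
      refine h1 _ _ h.le ?_
      have := abs_sub_abs_le_abs_sub (k : ℝ) x
      rw [abs_sub_comm] at this
      linarith

lemma AssumptionS.summable {f : ℝ → ℂ} (hf : AssumptionS f) (hc : Continuous f) (x : ℝ) :
    Summable fun k : ℤ => ‖f (x - k)‖ := by
  obtain ⟨N, hN⟩ := exists_nat_ge |x|
  obtain ⟨b, hb, hle⟩ := hf.exists_summable_bound hc N
  exact Summable.of_nonneg_of_le (fun _ => norm_nonneg _) (fun k => hle k x hN) hb

lemma AssumptionS.exists_tsum_le {f : ℝ → ℂ} (hf : AssumptionS f) (hc : Continuous f) :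
    ∃ C : ℝ, ∀ x, ∑' k : ℤ, ‖f (x - k)‖ ≤ C := by
  obtain ⟨b, hb, hle⟩ := hf.exists_summable_bound hc 1
  refine ⟨∑' k, b k, fun x => ?_⟩
  have e : ∑' k : ℤ, ‖f (x - k)‖ = ∑' k : ℤ, ‖f (Int.fract x - k)‖ := by
    rw [← (Equiv.addRight ⌊x⌋).tsum_eq fun k : ℤ => ‖f (x - k)‖]
    refine tsum_congr fun k => ?_
    rw [Equiv.coe_addRight, Int.fract]
    congr 2
    push_cast
    ring
  rw [e]
  refine (hf.summable hc _).tsum_le_tsum (fun k => hle k _ ?_) hb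
  rw [abs_of_nonneg (Int.fract_nonneg x)]
  simpa using (Int.fract_lt_one x).le

/-! ### The Fourier transform -/

lemma ft_eq_integral (f : ℝ → ℂ) (y : ℝ) : ft f y = ∫ x, expo (-y) x * f x := by
  unfold ft expo
  congr 1
  ext x
  congr 2
  push_cast
  ring

open scoped FourierTransform in
lemma ft_two_pi_mul (f : ℝ → ℂ) (v : ℝ) : ft f (2 * Real.pi * v) = 𝓕 f v := by
  rw [Real.fourier_real_eq_integral_exp_smul, ft_eq_integral]
  congr 1
  ext x
  unfold expo
  rw [smul_eq_mul]
  congr 2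
  push_cast
  ring

lemma norm_ft_le {f : ℝ → ℂ} (y : ℝ) : ‖ft f y‖ ≤ ∫ x, ‖f x‖ := by
  rw [ft_eq_integral]
  refine (norm_integral_le_integral_norm _).trans (le_of_eq ?_)
  simp [norm_expo]

lemma continuous_ft {f : ℝ → ℂ} (hf : Integrable f) : Continuous (ft f) := by
  have h : ft f = fun y => ∫ x, expo (-y) x * f x := funext (ft_eq_integral f)
  rw [h]
  refine continuous_of_dominated (bound := fun x => ‖f x‖) (fun y => ?_) (fun y => ?_) hf.norm ?_
  · exact (continuous_expo _).aestronglyMeasurable.mul hf.aestronglyMeasurable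
  · exact Eventually.of_forall fun x => by rw [norm_mul, norm_expo, one_mul]
  · refine Eventually.of_forall fun x => ?_
    exact (continuous_expo_uncurry.comp (continuous_neg.prodMk continuous_const)).mul
      continuous_const

open scoped FourierTransform in
/-- Fourier inversion in the normalization of `ft`. -/
lemma integral_ft_mul_expo {f : ℝ → ℂ} (hc : Continuous f) (hf : Integrable f)
    (hft : Integrable (ft f)) (x : ℝ) :
    f x = (2 * (Real.pi : ℂ))⁻¹ * ∫ u, ft f u * expo x u := by
  have hF : Integrable (𝓕 f) := by
    have h := hft.comp_mul_left' (R := 2 * Real.pi) (by positivity)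
    refine h.congr (Eventually.of_forall fun v => ?_)
    exact ft_two_pi_mul f v
  have h := congrFun (hc.fourierInv_fourier_eq hf hF) x
  rw [← h, Real.fourierInv_eq']
  have h2 := Measure.integral_comp_mul_left (fun u => ft f u * expo x u) (2 * Real.pi)
  rw [abs_of_pos (by positivity), Complex.real_smul] at h2
  push_cast at h2
  rw [← h2]
  refine integral_congr_ae (Eventually.of_forall fun v => ?_)
  simp only
  rw [ft_two_pi_mul, smul_eq_mul, mul_comm]
  congr 1
  unfold expo
  congr 1
  simp
  ring

/-! ### Poisson summation almost everywhere -/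

/-- An integrable function on a period all of whose Fourier coefficients vanish is zero. -/
lemma ae_eq_zero_of_fourier_coeff_eq_zero {h : ℝ → ℂ} (hh : IntegrableOn h (Set.Ioc 0 1))
    (h0 : ∀ m : ℤ, ∫ v in Set.Ioc (0 : ℝ) 1, h v * fourier m (v : UnitAddCircle) = 0) :
    ∀ᵐ v ∂volume.restrict (Set.Ioc (0 : ℝ) 1), h v = 0 := by
  have hintg : ∀ g : C(UnitAddCircle, ℂ),
      IntegrableOn (fun v : ℝ => h v * g (v : UnitAddCircle)) (Set.Ioc 0 1) := by
    intro g
    refine Integrable.mul_bdd (c := ‖g‖) hh ?_ ?_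
    · exact (g.continuous.comp (AddCircle.continuous_mk' 1)).aestronglyMeasurable
    · exact Eventually.of_forall fun v => g.norm_coe_le_norm _
  -- the functional `g ↦ ∫ h g` on continuous functions on the circle
  let L : C(UnitAddCircle, ℂ) →ₗ[ℂ] ℂ :=
    { toFun := fun g => ∫ v in Set.Ioc (0 : ℝ) 1, h v * g (v : UnitAddCircle)
      map_add' := fun g₁ g₂ => by
        simp only [ContinuousMap.add_apply, mul_add]
        exact integral_add (hintg g₁) (hintg g₂)
      map_smul' := fun c g => by
        simp only [ContinuousMap.smul_apply, smul_eq_mul, RingHom.id_apply]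
        rw [← integral_const_mul]
        congr 1
        ext v
        ring }
  let Lc : C(UnitAddCircle, ℂ) →L[ℂ] ℂ := L.mkContinuous (∫ v in Set.Ioc (0 : ℝ) 1, ‖h v‖) fun g => by
    refine (norm_integral_le_integral_norm _).trans ?_
    rw [← integral_mul_const]
    refine integral_mono (hintg g).norm (hh.norm.mul_const _) fun v => ?_
    simp only [norm_mul]
    gcongr
    exact g.norm_coe_le_norm _
  have hL : ∀ g : C(UnitAddCircle, ℂ), Lc g = 0 := by
    have hle : (Submodule.span ℂ (Set.range <| @fourier 1)).topologicalClosure ≤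
        LinearMap.ker (Lc : C(UnitAddCircle, ℂ) →ₗ[ℂ] ℂ) := by
      refine Submodule.topologicalClosure_minimal _ ?_ Lc.isClosed_ker
      rw [Submodule.span_le]
      rintro _ ⟨m, rfl⟩
      exact h0 m
    rw [span_fourier_closure_eq_top] at hle
    intro g
    exact hle (Submodule.mem_top (x := g))
  have h1 : ∀ᵐ v : ℝ, v ∈ Set.Ioo (0 : ℝ) 1 → h v = 0 := by
    refine isOpen_Ioo.ae_eq_zero_of_integral_contDiff_smul_eq_zero
      ((hh.mono_set Set.Ioo_subset_Ioc_self).locallyIntegrableOn) fun g hg hgc hgs => ?_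
    have hg0 : ∀ v, v ∉ Set.Ioo (0 : ℝ) 1 → g v = 0 := fun v hv =>
      image_eq_zero_of_notMem_tsupport fun h' => hv (hgs h')
    let G : ℝ → ℂ := fun v => (g v : ℂ)
    have hGc : Continuous G := Complex.continuous_ofReal.comp hg.continuous
    let G' : C(UnitAddCircle, ℂ) := ⟨AddCircle.liftIco 1 0 G, by
      refine AddCircle.liftIco_continuous ?_ hGc.continuousOn
      simp only [G]
      rw [hg0 0 (by simp), hg0 (0 + 1) (by simp)]⟩
    have hG' : ∀ v ∈ Set.Ico (0 : ℝ) 1, G' (v : UnitAddCircle) = G v := by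
      intro v hv
      change AddCircle.liftIco (1 : ℝ) 0 G (v : AddCircle (1 : ℝ)) = G v
      exact AddCircle.liftIco_coe_apply (by simpa using hv)
    have h2 := hL G'
    have h3 : ∫ v in Set.Ioc (0 : ℝ) 1, h v * G' (v : UnitAddCircle) = 0 := h2
    rw [← h3, ← integral_indicator measurableSet_Ioc]
    refine integral_congr_ae (Eventually.of_forall fun v => ?_)
    simp only
    by_cases hv : v ∈ Set.Ioo (0 : ℝ) 1
    · rw [Set.indicator_of_mem (Set.Ioo_subset_Ioc_self hv)]
      rw [hG' v (Set.Ioo_subset_Ico_self hv), Complex.real_smul, mul_comm]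
    · rw [hg0 v hv, zero_smul]
      by_cases hv' : v ∈ Set.Ioc (0 : ℝ) 1
      · have hv1 : v = 1 := by
          by_contra hne
          exact hv ⟨hv'.1, lt_of_le_of_ne hv'.2 hne⟩
        rw [Set.indicator_of_mem hv', hv1]
        have e : ((1 : ℝ) : UnitAddCircle) = ((0 : ℝ) : UnitAddCircle) := by
          rw [AddCircle.coe_period]; rfl
        rw [e, hG' 0 (by simp)]
        simp only [G]
        rw [hg0 0 (by simp)]
        simp
      · rw [Set.indicator_of_notMem hv']
  rw [ae_restrict_iff' measurableSet_Ioc]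
  filter_upwards [h1, Measure.ae_ne volume (1 : ℝ)] with v hv hv1 hmem
  exact hv ⟨hmem.1, lt_of_le_of_ne hmem.2 hv1⟩

lemma ae_of_ae_restrict_of_periodic {p : ℝ → Prop} (hp : ∀ v (n : ℤ), p (v + n) → p v)
    (h : ∀ᵐ v ∂volume.restrict (Set.Ioc (0 : ℝ) 1), p v) : ∀ᵐ v : ℝ, p v := by
  rw [ae_restrict_iff' measurableSet_Ioc] at h
  have h1 : ∀ n : ℤ, ∀ᵐ v : ℝ, v + n ∈ Set.Ioc (0 : ℝ) 1 → p (v + n) := fun n =>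
    (measurePreserving_add_right volume (n : ℝ)).quasiMeasurePreserving.ae h
  filter_upwards [ae_all_iff.2 h1] with v hv
  refine hp v (-(⌈v⌉ - 1)) (hv _ ?_)
  have h2 := Int.ceil_lt_add_one v
  have h3 := Int.le_ceil v
  push_cast
  constructor <;> linarith

/-- The periodization in time, with phases: `∑ₖ f(x - k) e^{2πikv}`. -/
noncomputable def zak (f : ℝ → ℂ) (x v : ℝ) : ℂ :=
  ∑' k : ℤ, f (x - k) * expo k (2 * Real.pi * v)

lemma expo_int_add (k l : ℤ) (v : ℝ) :
    expo k (2 * Real.pi * (v + l)) = expo k (2 * Real.pi * v) := by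
  unfold expo
  rw [Complex.exp_eq_exp_iff_exists_int]
  exact ⟨k * l, by push_cast; ring⟩

lemma expo_add_left (s t z : ℝ) : expo (s + t) z = expo s z * expo t z := by
  unfold expo
  rw [← Complex.exp_add]
  congr 1
  push_cast
  ring

lemma expo_eq_fourier (m : ℤ) (v : ℝ) :
    expo m (2 * Real.pi * v) = fourier m (v : UnitAddCircle) := by
  rw [fourier_coe_apply]
  unfold expo
  congr 1
  push_cast
  ring

lemma integral_expo_int (m : ℤ) :
    ∫ v in Set.Ioc (0 : ℝ) 1, expo m (2 * Real.pi * v) = if m = 0 then 1 else 0 := by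
  rcases eq_or_ne m 0 with rfl | hm
  · simp [expo]
  · rw [if_neg hm, ← intervalIntegral.integral_of_le zero_le_one]
    have hc : Complex.I * (m : ℂ) * (2 * Real.pi) ≠ 0 := by
      have : (m : ℂ) ≠ 0 := Int.cast_ne_zero.2 hm
      have hpi : (Real.pi : ℂ) ≠ 0 := Complex.ofReal_ne_zero.2 Real.pi_ne_zero
      simp [this, hpi]
    have e : ∀ v : ℝ, expo m (2 * Real.pi * v) =
        Complex.exp (Complex.I * (m : ℂ) * (2 * Real.pi) * (v : ℂ)) := fun v => by
      unfold expo
      congr 1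
      push_cast
      ring
    simp only [e]
    rw [integral_exp_mul_complex hc]
    have e1 : Complex.exp (Complex.I * (m : ℂ) * (2 * Real.pi) * ((1 : ℝ) : ℂ)) = 1 :=
      Complex.exp_eq_one_iff.2 ⟨m, by push_cast; ring⟩
    rw [e1]
    simp

lemma summable_zak {f : ℝ → ℂ} (hf : AssumptionS f) (hc : Continuous f) (x v : ℝ) :
    Summable fun k : ℤ => f (x - k) * expo k (2 * Real.pi * v) := by
  refine Summable.of_norm ((hf.summable hc x).congr fun k => ?_)
  rw [norm_mul, norm_expo, mul_one]

/-- Absolute convergence in `L¹` gives convergence almost everywhere, with an integrable sum. -/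
lemma exists_integrable_hasSum {ι : Type*} [Countable ι] {μ : Measure ℝ} {F : ι → ℝ → ℂ}
    (hF : ∀ i, Integrable (F i) μ) (hs : Summable fun i => ∫ v, ‖F i v‖ ∂μ) :
    ∃ g : ℝ → ℂ, Integrable g μ ∧ ∀ᵐ v ∂μ, HasSum (fun i => F i v) (g v) := by
  set f : ι → Lp ℂ 1 μ := fun i => (memLp_one_iff_integrable.2 (hF i)).toLp (F i) with hf
  have h1 : ∀ i, ‖f i‖ₑ = ENNReal.ofReal (∫ v, ‖F i v‖ ∂μ) := by
    intro i
    rw [hf, Lp.enorm_toLp, eLpNorm_one_eq_lintegral_enorm, ofReal_integral_norm_eq_lintegral_enorm (hF i)]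
  have h2 : ∑' i, ‖f i‖ₑ ≠ ∞ := by
    simp only [h1]
    exact hs.tsum_ofReal_ne_top
  refine ⟨(∑' i, f i : Lp ℂ 1 μ), memLp_one_iff_integrable.1 (Lp.memLp _), ?_⟩
  have h3 : ∀ᵐ v ∂μ, ∀ i, f i v = F i v := ae_all_iff.2 fun i => MemLp.coeFn_toLp _
  filter_upwards [Lp.hasSum_coeFn_tsum h2, h3] with v h4 h5
  simpa only [h5] using h4

/-- Poisson summation for functions with integrable Fourier transform: the frequency side converges
absolutely for almost every `v` only. -/
lemma hasSum_ft_eq_zak {f : ℝ → ℂ} (hf : AssumptionS f) (hc : Continuous f)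
    (hft : Integrable (ft f)) (x : ℝ) :
    ∀ᵐ v : ℝ, HasSum (fun l : ℤ => ft f (2 * Real.pi * (v + l)) * expo x (2 * Real.pi * (v + l)))
      (zak f x v) := by
  set G : ℝ → ℂ := fun v => ft f (2 * Real.pi * v) * expo x (2 * Real.pi * v) with hG
  have hcG : Continuous G := by
    have := continuous_ft (hf.integrable hc)
    have := continuous_expo x
    fun_prop
  have hGi : Integrable G := by
    refine (hft.comp_mul_left' (R := 2 * Real.pi) (by positivity)).mono hcG.aestronglyMeasurable ?_
    refine Eventually.of_forall fun v => ?_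
    simp only [hG, norm_mul, norm_expo, mul_one]
    exact le_rfl
  set μ : Measure ℝ := volume.restrict (Set.Ioc (0 : ℝ) 1) with hμ
  have hsumG : Summable fun l : ℤ => ∫ v, ‖G (v + l)‖ ∂μ := by
    have := hGi.norm.hasSum_intervalIntegral_comp_add_int.summable
    simpa only [intervalIntegral.integral_of_le zero_le_one] using this
  have hGl : ∀ l : ℤ, Integrable (fun v => G (v + l)) μ := fun l =>
    (hGi.comp_add_right (l : ℝ)).restrict
  -- both series converge almost everywhere on a period, to `D` and `Z`
  obtain ⟨D, hD, hDae⟩ := exists_integrable_hasSum hGl hsumG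
  obtain ⟨Z, hZ, hZae⟩ := exists_integrable_hasSum (μ := μ)
    (F := fun (k : ℤ) v => f (x - k) * expo k (2 * Real.pi * v))
    (fun k => by
      refine (Continuous.integrableOn_Icc (a := 0) (b := 1) ?_).mono_set Set.Ioc_subset_Icc_self
      have := continuous_expo k
      fun_prop)
    (by
      refine (hf.summable hc x).congr fun k => ?_
      simp [norm_expo, hμ])
  have hnorm1 : ∀ (m : ℤ) (v : ℝ), ‖expo m (2 * Real.pi * v)‖ ≤ 1 := fun m v => (norm_expo _ _).le
  have hmeas1 : ∀ m : ℤ, AEStronglyMeasurable (fun v : ℝ => expo m (2 * Real.pi * v)) μ := by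
    intro m
    have := continuous_expo m
    exact (by fun_prop : Continuous fun v : ℝ => expo m (2 * Real.pi * v)).aestronglyMeasurable
  -- both sides have the Fourier coefficients `f (x + m)`
  have hcoefD : ∀ m : ℤ, ∫ v, D v * expo m (2 * Real.pi * v) ∂μ = f (x + m) := by
    intro m
    have hGm : Integrable fun v => G v * expo m (2 * Real.pi * v) := by
      refine hGi.mul_bdd (c := 1) ?_ (Eventually.of_forall (hnorm1 m))
      have := continuous_expo m
      exact (by fun_prop : Continuous fun v : ℝ => expo m (2 * Real.pi * v)).aestronglyMeasurable
    have h1 := hGm.hasSum_intervalIntegral_comp_add_int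
    simp only [intervalIntegral.integral_of_le zero_le_one, expo_int_add] at h1
    have h2 := hasSum_integral_of_summable_integral_norm (μ := μ)
      (F := fun (l : ℤ) v => G (v + l) * expo m (2 * Real.pi * v))
      (fun l => (hGl l).mul_bdd (c := 1) (hmeas1 m) (Eventually.of_forall (hnorm1 m)))
      (by simpa only [norm_mul, norm_expo, mul_one] using hsumG)
    have h3 : ∫ v, D v * expo m (2 * Real.pi * v) ∂μ =
        ∫ v, ∑' l : ℤ, G (v + l) * expo m (2 * Real.pi * v) ∂μ := by
      refine integral_congr_ae ?_
      filter_upwards [hDae] with v hv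
      exact ((hv.mul_right _).tsum_eq).symm
    rw [h3, h2.unique h1, integral_ft_mul_expo hc (hf.integrable hc) hft (x + m)]
    have h4 := Measure.integral_comp_mul_left (fun u => ft f u * expo (x + m) u) (2 * Real.pi)
    rw [abs_of_pos (by positivity), Complex.real_smul] at h4
    push_cast at h4
    rw [← h4]
    refine integral_congr_ae (Eventually.of_forall fun v => ?_)
    simp only [hG]
    rw [expo_add_left, mul_assoc]
  have hcoefZ : ∀ m : ℤ, ∫ v, Z v * expo m (2 * Real.pi * v) ∂μ = f (x + m) := by
    intro m
    have h2 := hasSum_integral_of_summable_integral_norm (μ := μ)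
      (F := fun (k : ℤ) v => f (x - k) * expo k (2 * Real.pi * v) * expo m (2 * Real.pi * v))
      (fun k => by
        refine (Continuous.integrableOn_Icc (a := 0) (b := 1) ?_).mono_set Set.Ioc_subset_Icc_self
        have := continuous_expo k
        have := continuous_expo m
        fun_prop)
      (by
        refine (hf.summable hc x).congr fun k => ?_
        simp [norm_expo, hμ])
    have h3 : ∫ v, Z v * expo m (2 * Real.pi * v) ∂μ =
        ∫ v, ∑' k : ℤ, f (x - k) * expo k (2 * Real.pi * v) * expo m (2 * Real.pi * v) ∂μ := by
      refine integral_congr_ae ?_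
      filter_upwards [hZae] with v hv
      exact ((hv.mul_right _).tsum_eq).symm
    have h4 : ∀ k : ℤ, ∫ v, f (x - k) * expo k (2 * Real.pi * v) * expo m (2 * Real.pi * v) ∂μ =
        if k = -m then f (x + m) else 0 := by
      intro k
      have e : ∀ v : ℝ, f (x - k) * expo k (2 * Real.pi * v) * expo m (2 * Real.pi * v) =
          f (x - k) * expo ((k + m : ℤ) : ℝ) (2 * Real.pi * v) := fun v => by
        rw [mul_assoc, ← expo_add_left]
        push_cast
        rfl
      simp only [e]
      rw [integral_const_mul, integral_expo_int]
      by_cases hk : k = -m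
      · subst hk
        simp
      · rw [if_neg hk, if_neg (by omega), mul_zero]
    simp only [h4] at h2
    rw [h3]
    exact h2.unique (hasSum_ite_eq (-m) (f (x + m)))
  have hzero := ae_eq_zero_of_fourier_coeff_eq_zero (h := fun v => D v - Z v) (hD.sub hZ)
    fun m => by
      have e : ∀ v : ℝ, (D v - Z v) * fourier m (v : UnitAddCircle) =
          D v * expo m (2 * Real.pi * v) - Z v * expo m (2 * Real.pi * v) := fun v => by
        rw [expo_eq_fourier, sub_mul]
      simp only [e]
      rw [integral_sub (hD.mul_bdd (c := 1) (hmeas1 m) (Eventually.of_forall (hnorm1 m)))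
        (hZ.mul_bdd (c := 1) (hmeas1 m) (Eventually.of_forall (hnorm1 m))), hcoefD, hcoefZ,
        sub_self]
  refine ae_of_ae_restrict_of_periodic (fun v n hv => ?_) ?_ (p := fun v => HasSum
    (fun l : ℤ => ft f (2 * Real.pi * (v + l)) * expo x (2 * Real.pi * (v + l))) (zak f x v))
  · have e : zak f x (v + n) = zak f x v := by
      unfold zak
      exact tsum_congr fun k => by rw [expo_int_add]
    rw [e] at hv
    rw [← (Equiv.addLeft n).hasSum_iff]
    refine hv.congr_fun fun l => ?_
    simp only [Function.comp, Equiv.coe_addLeft]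
    push_cast
    rw [add_assoc]
  · filter_upwards [hDae, hZae, hzero] with v h1 h2 h3
    rw [zak, h2.tsum_eq, ← sub_eq_zero.1 h3]
    exact h1

/-! ### Trigonometric series with summable coefficients -/

/-- The trigonometric series `∑ₖ aₖ e^{2πikv}`. -/
noncomputable def trig (a : ℤ → ℂ) (v : ℝ) : ℂ :=
  ∑' k : ℤ, a k * expo k (2 * Real.pi * v)

lemma zak_eq_trig (f : ℝ → ℂ) (x v : ℝ) : zak f x v = trig (fun k => f (x - k)) v := rfl

lemma summable_trig {a : ℤ → ℂ} (ha : Summable fun k => ‖a k‖) (v : ℝ) :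
    Summable fun k : ℤ => a k * expo k (2 * Real.pi * v) := by
  refine Summable.of_norm (ha.congr fun k => ?_)
  rw [norm_mul, norm_expo, mul_one]

lemma norm_trig_le {a : ℤ → ℂ} (ha : Summable fun k => ‖a k‖) (v : ℝ) :
    ‖trig a v‖ ≤ ∑' k, ‖a k‖ := by
  refine tsum_of_norm_bounded ha.hasSum fun k => ?_
  rw [norm_mul, norm_expo, mul_one]

lemma continuous_trig {a : ℤ → ℂ} (ha : Summable fun k => ‖a k‖) : Continuous (trig a) := by
  refine continuous_tsum (fun k => ?_) ha fun k v => ?_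
  · have := continuous_expo k
    fun_prop
  · rw [norm_mul, norm_expo, mul_one]

lemma trig_add_int (a : ℤ → ℂ) (v : ℝ) (n : ℤ) : trig a (v + n) = trig a v :=
  tsum_congr fun k => by rw [expo_int_add]

lemma trig_sub {a b : ℤ → ℂ} (ha : Summable fun k => ‖a k‖) (hb : Summable fun k => ‖b k‖)
    (v : ℝ) : trig (fun k => a k - b k) v = trig a v - trig b v := by
  unfold trig
  rw [← (summable_trig ha v).tsum_sub (summable_trig hb v)]
  exact tsum_congr fun k => by ring

lemma trig_add {a b : ℤ → ℂ} (ha : Summable fun k => ‖a k‖) (hb : Summable fun k => ‖b k‖)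
    (v : ℝ) : trig (fun k => a k + b k) v = trig a v + trig b v := by
  unfold trig
  rw [← (summable_trig ha v).tsum_add (summable_trig hb v)]
  exact tsum_congr fun k => by ring

lemma integral_trig_mul_expo {a : ℤ → ℂ} (ha : Summable fun k => ‖a k‖) (m : ℤ) :
    ∫ v in Set.Ioc (0 : ℝ) 1, trig a v * expo m (2 * Real.pi * v) = a (-m) := by
  have h2 := hasSum_integral_of_summable_integral_norm
    (μ := volume.restrict (Set.Ioc (0 : ℝ) 1))
    (F := fun (k : ℤ) v => a k * expo k (2 * Real.pi * v) * expo m (2 * Real.pi * v))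
    (fun k => by
      refine (Continuous.integrableOn_Icc (a := 0) (b := 1) ?_).mono_set Set.Ioc_subset_Icc_self
      have := continuous_expo k
      have := continuous_expo m
      fun_prop)
    (by
      refine ha.congr fun k => ?_
      simp [norm_expo])
  have h4 : ∀ k : ℤ, ∫ v in Set.Ioc (0 : ℝ) 1,
      a k * expo k (2 * Real.pi * v) * expo m (2 * Real.pi * v) =
      if k = -m then a (-m) else 0 := by
    intro k
    have e : ∀ v : ℝ, a k * expo k (2 * Real.pi * v) * expo m (2 * Real.pi * v) =
        a k * expo ((k + m : ℤ) : ℝ) (2 * Real.pi * v) := fun v => by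
      rw [mul_assoc, ← expo_add_left]
      push_cast
      rfl
    simp only [e]
    rw [integral_const_mul, integral_expo_int]
    by_cases hk : k = -m
    · subst hk
      simp
    · rw [if_neg hk, if_neg (by omega), mul_zero]
  simp only [h4] at h2
  have h5 := h2.unique (hasSum_ite_eq (-m) (a (-m)))
  rw [← h5]
  exact integral_congr_ae (Eventually.of_forall fun v => ((summable_trig ha v).tsum_mul_right _).symm)

lemma conj_expo (t z : ℝ) : conj (expo t z) = expo (-t) z := by
  unfold expo
  rw [← Complex.exp_conj]
  congr 1
  simp

lemma summable_norm_sq {a : ℤ → ℂ} (ha : Summable fun k => ‖a k‖) :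
    Summable fun k => ‖a k‖ ^ 2 := by
  have h : ∀ k, ‖a k‖ ≤ ∑' k, ‖a k‖ := fun k => ha.le_tsum k fun _ _ => norm_nonneg _
  refine Summable.of_nonneg_of_le (fun _ => by positivity) (fun k => ?_)
    (ha.mul_left (∑' k, ‖a k‖))
  rw [pow_two]
  exact mul_le_mul_of_nonneg_right (h k) (norm_nonneg _)

/-- Parseval's identity for summable coefficients. -/
lemma integral_norm_sq_trig {a : ℤ → ℂ} (ha : Summable fun k => ‖a k‖) :
    ∫ v in Set.Ioc (0 : ℝ) 1, ‖trig a v‖ ^ 2 = ∑' k, ‖a k‖ ^ 2 := by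
  have hcont := continuous_trig ha
  have hint : ∀ g : ℝ → ℂ, Continuous g → IntegrableOn g (Set.Ioc (0 : ℝ) 1) := fun g hg =>
    (hg.integrableOn_Icc (a := 0) (b := 1)).mono_set Set.Ioc_subset_Icc_self
  have h2 := hasSum_integral_of_summable_integral_norm
    (μ := volume.restrict (Set.Ioc (0 : ℝ) 1))
    (F := fun (k : ℤ) v => conj (a k) * (trig a v * expo (-k : ℤ) (2 * Real.pi * v)))
    (fun k => hint _ (by
      have := continuous_expo (-k : ℤ)
      fun_prop))
    (by
      refine Summable.of_nonneg_of_le (fun k => integral_nonneg fun _ => norm_nonneg _)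
        (fun k => ?_) (ha.mul_right (∑' k, ‖a k‖))
      calc ∫ v in Set.Ioc (0 : ℝ) 1, ‖conj (a k) * (trig a v * expo (-k : ℤ) (2 * Real.pi * v))‖
          ≤ ∫ _ in Set.Ioc (0 : ℝ) 1, ‖a k‖ * ∑' k, ‖a k‖ := by
            refine integral_mono_of_nonneg (Eventually.of_forall fun _ => norm_nonneg _)
              (integrableOn_const (by simp)) (Eventually.of_forall fun v => ?_)
            simp only [norm_mul, norm_expo, mul_one, RCLike.norm_conj]
            exact mul_le_mul_of_nonneg_left (norm_trig_le ha v) (norm_nonneg _)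
        _ = _ := by simp)
  have h3 : ∀ v, ∑' k : ℤ, conj (a k) * (trig a v * expo (-k : ℤ) (2 * Real.pi * v)) =
      ((‖trig a v‖ ^ 2 : ℝ) : ℂ) := by
    intro v
    have e : ∀ k : ℤ, conj (a k) * (trig a v * expo (-k : ℤ) (2 * Real.pi * v)) =
        trig a v * conj (a k * expo k (2 * Real.pi * v)) := fun k => by
      rw [map_mul, conj_expo]
      push_cast
      ring
    simp only [e]
    rw [tsum_mul_left, ← Complex.conj_tsum]
    change trig a v * conj (trig a v) = _
    rw [Complex.mul_conj, Complex.normSq_eq_norm_sq]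
  simp only [integral_const_mul, integral_trig_mul_expo ha, neg_neg, h3] at h2
  rw [integral_complex_ofReal] at h2
  have h4 : HasSum (fun k => ((‖a k‖ ^ 2 : ℝ) : ℂ))
      ((∫ v in Set.Ioc (0 : ℝ) 1, ‖trig a v‖ ^ 2 : ℝ) : ℂ) := by
    refine h2.congr_fun fun k => ?_
    rw [mul_comm, Complex.mul_conj, Complex.normSq_eq_norm_sq]
  exact (Complex.hasSum_ofReal.1 h4).tsum_eq.symm

lemma lintegral_norm_sq_trig {a : ℤ → ℂ} (ha : Summable fun k => ‖a k‖) :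
    ∫⁻ v in Set.Ioc (0 : ℝ) 1, ENNReal.ofReal (‖trig a v‖ ^ 2) =
      ENNReal.ofReal (∑' k, ‖a k‖ ^ 2) := by
  rw [← integral_norm_sq_trig ha, ofReal_integral_eq_lintegral_ofReal]
  · have := continuous_trig ha
    exact ((by fun_prop : Continuous fun v => ‖trig a v‖ ^ 2).integrableOn_Icc
      (a := 0) (b := 1)).mono_set Set.Ioc_subset_Icc_self
  · exact Eventually.of_forall fun _ => by positivity

lemma lintegral_eq_tsum_lintegral_Ioc (h : ℝ → ℝ≥0∞) :
    ∫⁻ v, h v = ∑' n : ℤ, ∫⁻ v in Set.Ioc (0 : ℝ) 1, h (v + n) := by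
  rw [← setLIntegral_univ, ← iUnion_Ioc_intCast ℝ, lintegral_iUnion (fun _ => measurableSet_Ioc)
    (Set.pairwise_disjoint_Ioc_intCast ℝ)]
  refine tsum_congr fun n => ?_
  have e : (fun v : ℝ => v + n) ⁻¹' Set.Ioc (n : ℝ) (n + 1) = Set.Ioc (0 : ℝ) 1 := by
    ext v
    simp only [Set.mem_preimage, Set.mem_Ioc]
    constructor <;> rintro ⟨h1, h2⟩ <;> constructor <;> linarith
  rw [← e, (measurePreserving_add_right volume (n : ℝ)).setLIntegral_comp_preimage_emb
    (measurableEmbedding_addRight (n : ℝ))]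

/-- A differentiable function is bounded on a unit interval by its mean there plus the integral of
the absolute value of its derivative. -/
lemma le_integral_add_integral_abs_deriv {G : ℝ → ℝ} (hd : Differentiable ℝ G)
    (hG : Integrable G) (hG' : Integrable (deriv G)) (n : ℝ) {v : ℝ} (hv : v ∈ Set.Ioc n (n + 1)) :
    G v ≤ ∫ w in Set.Ioc n (n + 1), (G w + |deriv G w|) := by
  have h1 : ∀ w ∈ Set.Ioc n (n + 1), G v - ∫ x in Set.Ioc n (n + 1), |deriv G x| ≤ G w := by
    intro w hw
    have h2 : ∫ x in w..v, deriv G x = G v - G w :=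
      intervalIntegral.integral_eq_sub_of_hasDerivAt (fun x _ => (hd x).hasDerivAt)
        hG'.intervalIntegrable
    have h3 : |∫ x in w..v, deriv G x| ≤ ∫ x in Set.Ioc n (n + 1), |deriv G x| := by
      refine (intervalIntegral.norm_integral_le_integral_norm_uIoc (f := deriv G) (μ := volume)).trans ?_
      have hsub : Set.uIoc w v ⊆ Set.Ioc n (n + 1) := by
        intro x hx
        rw [Set.mem_uIoc] at hx
        rcases hx with hx | hx
        · exact ⟨hw.1.trans hx.1, hx.2.trans hv.2⟩
        · exact ⟨hv.1.trans hx.1, hx.2.trans hw.2⟩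
      exact setIntegral_mono_set hG'.norm.integrableOn
        (Eventually.of_forall fun _ => norm_nonneg _) hsub.eventuallyLE
    have := le_abs_self (∫ x in w..v, deriv G x)
    linarith
  rw [integral_add hG.integrableOn hG'.abs.integrableOn]
  have h4 : ∫ w in Set.Ioc n (n + 1), (G v - ∫ x in Set.Ioc n (n + 1), |deriv G x|) ≤
      ∫ w in Set.Ioc n (n + 1), G w :=
    setIntegral_mono_on (integrableOn_const (by simp)) hG.integrableOn measurableSet_Ioc h1
  simp at h4
  linarith

/-- The weighted `L²` norm on the line of a trigonometric series is controlled by its coefficients,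
since on each period the weight is at most its mean plus its variation. -/
lemma lintegral_mul_norm_sq_trig_le {a : ℤ → ℂ} (ha : Summable fun k => ‖a k‖) {G : ℝ → ℝ}
    (h0 : ∀ v, 0 ≤ G v) (hd : Differentiable ℝ G) (hG : Integrable G)
    (hG' : Integrable (deriv G)) :
    ∫⁻ v, ENNReal.ofReal (G v * ‖trig a v‖ ^ 2) ≤
      ENNReal.ofReal (((∫ v, G v) + ∫ v, |deriv G v|) * ∑' k, ‖a k‖ ^ 2) := by
  have hnn : ∀ n : ℤ, 0 ≤ ∫ w in Set.Ioc (n : ℝ) (n + 1), (G w + |deriv G w|) := fun n =>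
    integral_nonneg fun w => add_nonneg (h0 w) (abs_nonneg _)
  have hGG : Integrable fun w => G w + |deriv G w| := hG.add hG'.abs
  have hsum : HasSum (fun n : ℤ => ∫ w in Set.Ioc (n : ℝ) (n + 1), (G w + |deriv G w|))
      (∫ w, (G w + |deriv G w|)) := by
    have := hasSum_integral_iUnion (μ := volume) (s := fun n : ℤ => Set.Ioc (n : ℝ) (n + 1))
      (f := fun w => G w + |deriv G w|) (fun _ => measurableSet_Ioc)
      (Set.pairwise_disjoint_Ioc_intCast ℝ) hGG.integrableOn
    rwa [iUnion_Ioc_intCast, setIntegral_univ] at this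
  calc ∫⁻ v, ENNReal.ofReal (G v * ‖trig a v‖ ^ 2)
      = ∑' n : ℤ, ∫⁻ v in Set.Ioc (0 : ℝ) 1, ENNReal.ofReal (G (v + n) * ‖trig a v‖ ^ 2) := by
        rw [lintegral_eq_tsum_lintegral_Ioc]
        simp only [trig_add_int]
    _ ≤ ∑' n : ℤ, ENNReal.ofReal (∫ w in Set.Ioc (n : ℝ) (n + 1), (G w + |deriv G w|)) *
          ENNReal.ofReal (∑' k, ‖a k‖ ^ 2) := by
        refine ENNReal.tsum_le_tsum fun n => ?_
        rw [← lintegral_norm_sq_trig ha, ← lintegral_const_mul' _ _ ENNReal.ofReal_ne_top]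
        refine setLIntegral_mono' measurableSet_Ioc fun v hv => ?_
        rw [← ENNReal.ofReal_mul (hnn n)]
        refine ENNReal.ofReal_le_ofReal (mul_le_mul_of_nonneg_right ?_ (by positivity))
        refine le_integral_add_integral_abs_deriv hd hG hG' n ?_
        constructor <;> linarith [hv.1, hv.2]
    _ = _ := by
        rw [ENNReal.tsum_mul_right, ← ENNReal.ofReal_tsum_of_nonneg hnn hsum.summable,
          hsum.tsum_eq, integral_add hG hG'.abs, ← ENNReal.ofReal_mul]
        exact add_nonneg (integral_nonneg h0) (integral_nonneg fun _ => abs_nonneg _)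

/-! ### The two-scale identity -/

lemma ae_comp_mul_add {p : ℝ → Prop} (h : ∀ᵐ y : ℝ, p y) {a : ℝ} (ha : a ≠ 0) (b : ℝ) :
    ∀ᵐ v : ℝ, p (a * v + b) := by
  have h1 : Measure.QuasiMeasurePreserving (fun v : ℝ => a * v) volume volume := by
    refine ⟨measurable_const_mul a, ?_⟩
    rw [Real.map_volume_mul_left ha]
    exact Measure.smul_absolutelyContinuous
  have h2 : Measure.QuasiMeasurePreserving (fun v : ℝ => v + b) volume volume :=
    (measurePreserving_add_right volume b).quasiMeasurePreserving
  exact h1.ae (h2.ae h)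

lemma hasSum_int_even_add_odd {E : Type*} [NormedAddCommGroup E] {f : ℤ → E} {a b : E}
    (ha : HasSum (fun p : ℤ => f (2 * p)) a) (hb : HasSum (fun p : ℤ => f (2 * p + 1)) b) :
    HasSum f (a + b) := by
  have h2 : Function.Injective fun p : ℤ => 2 * p := fun p q h => by
    have : 2 * p = 2 * q := h
    omega
  have h3 : Function.Injective fun p : ℤ => 2 * p + 1 := fun p q h => by
    have : 2 * p + 1 = 2 * q + 1 := h
    omega
  have ha' := h2.hasSum_range_iff.2 ha
  have hb' := h3.hasSum_range_iff.2 hb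
  refine HasSum.add_isCompl (s := Set.range fun p : ℤ => 2 * p)
    (t := Set.range fun p : ℤ => 2 * p + 1) ⟨?_, ?_⟩ ha' hb'
  · rw [Set.disjoint_left]
    rintro _ ⟨p, rfl⟩ ⟨q, hq⟩
    have : 2 * q + 1 = 2 * p := hq
    omega
  · refine codisjoint_iff.2 (Set.eq_univ_iff_forall.2 fun l => ?_)
    rcases Int.even_or_odd' l with ⟨m, rfl | rfl⟩
    · exact Or.inl ⟨m, rfl⟩
    · exact Or.inr ⟨m, rfl⟩

/-- Almost every frequency carries values `a`, `b` of the low-pass filter (at `2πv` and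
`2πv + π`) that relate the Fourier transforms on two consecutive scales. -/
lemma IsWaveletPair.ae_exists_filter {φ ψ : ℝ → ℂ} (h : IsWaveletPair φ ψ) :
    ∀ᵐ v : ℝ, ∃ a b : ℂ, ‖a‖ ^ 2 + ‖b‖ ^ 2 = 1 ∧
      (∀ p : ℤ, ft φ (2 * Real.pi * (2 * v + (2 * p : ℤ))) = a * ft φ (2 * Real.pi * (v + p))) ∧
      (∀ p : ℤ, ft φ (2 * Real.pi * (2 * v + (2 * p + 1 : ℤ))) =
        b * ft φ (2 * Real.pi * (v + 1 / 2 + p))) ∧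
      (∀ p : ℤ, ft ψ (2 * Real.pi * (2 * v + (2 * p : ℤ))) =
        conj b * expo (-1) (2 * Real.pi * v) * ft φ (2 * Real.pi * (v + p))) ∧
      (∀ p : ℤ, ft ψ (2 * Real.pi * (2 * v + (2 * p + 1 : ℤ))) =
        -(conj a * expo (-1) (2 * Real.pi * v) * ft φ (2 * Real.pi * (v + 1 / 2 + p)))) := by
  obtain ⟨m, hper, -, hφ, hψ⟩ := h.exists_filter
  have hpi := Real.pi_pos
  have e1 : ∀ᵐ v : ℝ, ∀ l : ℤ, ft φ (4 * Real.pi * v + 2 * Real.pi * l) =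
      m ((4 * Real.pi * v + 2 * Real.pi * l) / 2) * ft φ ((4 * Real.pi * v + 2 * Real.pi * l) / 2) :=
    ae_all_iff.2 fun l => ae_comp_mul_add hφ (by positivity) _
  have e2 : ∀ᵐ v : ℝ, ∀ l : ℤ, ft ψ (4 * Real.pi * v + 2 * Real.pi * l) =
      conj (m ((4 * Real.pi * v + 2 * Real.pi * l) / 2 + Real.pi)) *
        Complex.exp (-(Complex.I * ((4 * Real.pi * v + 2 * Real.pi * l : ℝ) : ℂ) / 2)) *
        ft φ ((4 * Real.pi * v + 2 * Real.pi * l) / 2) :=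
    ae_all_iff.2 fun l => ae_comp_mul_add hψ (by positivity) _
  have e3 := ae_comp_mul_add h.partition (a := 4 * Real.pi) (by positivity) 0
  have e4 := ae_comp_mul_add h.partition (a := 2 * Real.pi) (by positivity) 0
  have e5 := ae_comp_mul_add h.partition (a := 2 * Real.pi) (by positivity) Real.pi
  filter_upwards [e1, e2, e3, e4, e5] with v h1 h2 h3 h4 h5
  -- periodicity of the filter reduces the even and the odd frequencies to two values
  have k1 : ∀ p : ℤ, m ((4 * Real.pi * v + 2 * Real.pi * (2 * p : ℤ)) / 2) =
      m (2 * Real.pi * v) := by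
    intro p
    rw [← hper.int_mul p (2 * Real.pi * v)]
    congr 1
    push_cast
    ring
  have k2 : ∀ p : ℤ, m ((4 * Real.pi * v + 2 * Real.pi * (2 * p + 1 : ℤ)) / 2) =
      m (2 * Real.pi * v + Real.pi) := by
    intro p
    rw [← hper.int_mul p (2 * Real.pi * v + Real.pi)]
    congr 1
    push_cast
    ring
  have k3 : ∀ p : ℤ, m ((4 * Real.pi * v + 2 * Real.pi * (2 * p : ℤ)) / 2 + Real.pi) =
      m (2 * Real.pi * v + Real.pi) := by
    intro p
    rw [← hper.int_mul p (2 * Real.pi * v + Real.pi)]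
    congr 1
    push_cast
    ring
  have k4 : ∀ p : ℤ, m ((4 * Real.pi * v + 2 * Real.pi * (2 * p + 1 : ℤ)) / 2 + Real.pi) =
      m (2 * Real.pi * v) := by
    intro p
    rw [← hper.int_mul (p + 1) (2 * Real.pi * v)]
    congr 1
    push_cast
    ring
  have k5 : ∀ p : ℤ, Complex.exp
      (-(Complex.I * ((4 * Real.pi * v + 2 * Real.pi * (2 * p : ℤ) : ℝ) : ℂ) / 2)) =
      expo (-1) (2 * Real.pi * v) := by
    intro p
    unfold expo
    rw [Complex.exp_eq_exp_iff_exists_int]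
    exact ⟨-p, by push_cast; ring⟩
  have k6 : ∀ p : ℤ, Complex.exp
      (-(Complex.I * ((4 * Real.pi * v + 2 * Real.pi * (2 * p + 1 : ℤ) : ℝ) : ℂ) / 2)) =
      -expo (-1) (2 * Real.pi * v) := by
    intro p
    have e : -expo (-1) (2 * Real.pi * v) =
        Complex.exp (Real.pi * Complex.I) * expo (-1) (2 * Real.pi * v) := by
      rw [Complex.exp_pi_mul_I, neg_one_mul]
    rw [e]
    unfold expo
    rw [← Complex.exp_add, Complex.exp_eq_exp_iff_exists_int]
    exact ⟨-p - 1, by push_cast; ring⟩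
  have f1 : ∀ p : ℤ, ft φ (2 * Real.pi * (2 * v + (2 * p : ℤ))) =
      m (2 * Real.pi * v) * ft φ (2 * Real.pi * (v + p)) := by
    intro p
    have := h1 (2 * p)
    rw [k1] at this
    convert this using 3 <;> push_cast <;> ring
  have f2 : ∀ p : ℤ, ft φ (2 * Real.pi * (2 * v + (2 * p + 1 : ℤ))) =
      m (2 * Real.pi * v + Real.pi) * ft φ (2 * Real.pi * (v + 1 / 2 + p)) := by
    intro p
    have := h1 (2 * p + 1)
    rw [k2] at this
    convert this using 3 <;> push_cast <;> ring
  refine ⟨m (2 * Real.pi * v), m (2 * Real.pi * v + Real.pi), ?_, f1, f2, fun p => ?_, fun p => ?_⟩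
  · have s1 : HasSum (fun l : ℤ => ‖ft φ (2 * Real.pi * (2 * v + l))‖ ^ 2) 1 := by
      refine h3.congr_fun fun l => ?_
      congr 3
      ring
    have s2 : HasSum (fun l : ℤ => ‖ft φ (2 * Real.pi * (v + l))‖ ^ 2) 1 := by
      refine h4.congr_fun fun l => ?_
      congr 3
      ring
    have s3 : HasSum (fun l : ℤ => ‖ft φ (2 * Real.pi * (v + 1 / 2 + l))‖ ^ 2) 1 := by
      refine h5.congr_fun fun l => ?_
      congr 3
      ring
    -- the partition of unity at `2v`, split into even and odd shifts, gives `‖a‖² + ‖b‖² = 1`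
    have s4 := hasSum_int_even_add_odd (f := fun l : ℤ => ‖ft φ (2 * Real.pi * (2 * v + l))‖ ^ 2)
      ((s2.mul_left (‖m (2 * Real.pi * v)‖ ^ 2)).congr_fun fun p => by
        rw [f1, norm_mul, mul_pow])
      ((s3.mul_left (‖m (2 * Real.pi * v + Real.pi)‖ ^ 2)).congr_fun fun p => by
        rw [f2, norm_mul, mul_pow])
    have := s4.unique s1
    linarith
  · have := h2 (2 * p)
    rw [k3, k5] at this
    convert this using 3 <;> push_cast <;> ring
  · have := h2 (2 * p + 1)
    rw [k4, k6] at this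
    rw [mul_neg, neg_mul] at this
    have x1 : 2 * Real.pi * (2 * v + (2 * p + 1 : ℤ)) =
        4 * Real.pi * v + 2 * Real.pi * (2 * p + 1 : ℤ) := by ring
    have x2 : 2 * Real.pi * (v + 1 / 2 + p) =
        (4 * Real.pi * v + 2 * Real.pi * (2 * p + 1 : ℤ)) / 2 := by push_cast; ring
    rw [x1, x2]
    exact this

/-- The projection onto one scale splits into the projection onto the previous scale and the
wavelet level in between. -/
lemma IsWaveletPair.two_scale {φ ψ : ℝ → ℂ} (h : IsWaveletPair φ ψ) (hφ : Integrable (ft φ))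
    (hψ : Integrable (ft ψ)) (x : ℝ) :
    ∀ᵐ v : ℝ, conj (ft φ (2 * Real.pi * (2 * v))) * zak φ x (2 * v) +
      conj (ft ψ (2 * Real.pi * (2 * v))) * zak ψ x (2 * v) =
      conj (ft φ (2 * Real.pi * v)) * zak φ (2 * x) v := by
  have z1 := hasSum_ft_eq_zak h.assumptionS_scaling h.continuous_scaling hφ
  have z2 := hasSum_ft_eq_zak h.assumptionS_wavelet h.continuous_wavelet hψ
  have e1 := ae_comp_mul_add (z1 x) two_ne_zero 0
  have e2 := ae_comp_mul_add (z2 x) two_ne_zero 0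
  have e3 := z1 (2 * x)
  have e4 := ae_comp_mul_add (z1 (2 * x)) one_ne_zero (1 / 2)
  filter_upwards [h.ae_exists_filter, e1, e2, e3, e4] with v ⟨a, b, hab, f1, f2, g1, g2⟩ h1 h2 h3 h4
  simp only [add_zero, one_mul] at h1 h2 h4
  have x1 : ∀ p : ℤ, expo x (2 * Real.pi * (2 * v + (2 * p : ℤ))) =
      expo (2 * x) (2 * Real.pi * (v + p)) := fun p => by
    unfold expo
    congr 1
    push_cast
    ring
  have x2 : ∀ p : ℤ, expo x (2 * Real.pi * (2 * v + (2 * p + 1 : ℤ))) =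
      expo (2 * x) (2 * Real.pi * (v + 1 / 2 + p)) := fun p => by
    unfold expo
    congr 1
    push_cast
    ring
  -- the even and the odd shifts of the dual series
  have r1 : zak φ x (2 * v) = a * zak φ (2 * x) v + b * zak φ (2 * x) (v + 1 / 2) := by
    refine h1.unique (hasSum_int_even_add_odd ?_ ?_)
    · exact (h3.mul_left a).congr_fun fun p => by rw [f1, x1, mul_assoc]
    · exact (h4.mul_left b).congr_fun fun p => by rw [f2, x2, mul_assoc]
  have r2 : zak ψ x (2 * v) = conj b * expo (-1) (2 * Real.pi * v) * zak φ (2 * x) v +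
      -(conj a * expo (-1) (2 * Real.pi * v)) * zak φ (2 * x) (v + 1 / 2) := by
    refine h2.unique (hasSum_int_even_add_odd ?_ ?_)
    · exact (h3.mul_left _).congr_fun fun p => by rw [g1, x1, mul_assoc]
    · exact (h4.mul_left _).congr_fun fun p => by rw [g2, x2]; ring
  have f0 := f1 0
  have g0 := g1 0
  simp only [mul_zero, Int.cast_zero, add_zero] at f0 g0
  rw [r1, r2, f0, g0]
  have hee : conj (expo (-1) (2 * Real.pi * v)) * expo (-1) (2 * Real.pi * v) = 1 := by
    rw [mul_comm, Complex.mul_conj, Complex.normSq_eq_norm_sq, norm_expo]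
    norm_num
  have haa : a * conj a + b * conj b = 1 := by
    rw [Complex.mul_conj, Complex.mul_conj, Complex.normSq_eq_norm_sq, Complex.normSq_eq_norm_sq]
    exact_mod_cast hab
  simp only [map_mul, Complex.conj_conj]
  set E := expo (-1) (2 * Real.pi * v)
  set Z := zak φ (2 * x) v
  set Z' := zak φ (2 * x) (v + 1 / 2)
  set F := conj (ft φ (2 * Real.pi * v))
  -- the coefficients of `Z` add up by `haa`, those of `Z'` cancel
  linear_combination (b * F * (conj b * Z - conj a * Z')) * hee + F * Z * haa

lemma eq_of_ae_eq_of_continuous {f g : ℝ → ℝ} (hf : Continuous f) (hg : Continuous g)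
    (h : ∀ᵐ v : ℝ, f v = g v) (v : ℝ) : f v = g v :=
  congrFun (hf.ae_eq_iff_eq volume hg |>.1 h) v

/-- The Fourier transform of the scaling function vanishes at the nonzero multiples of `2π`. -/
lemma IsWaveletPair.ft_two_pi_mul_int {φ ψ : ℝ → ℂ} (h : IsWaveletPair φ ψ) (l : ℤ) (hl : l ≠ 0) :
    ft φ (2 * Real.pi * l) = 0 := by
  have hc := continuous_ft (h.assumptionS_scaling.integrable h.continuous_scaling)
  have hle : ∀ v : ℝ, ‖ft φ (2 * Real.pi * (2 * v))‖ ≤ ‖ft φ (2 * Real.pi * v)‖ := by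
    have hae : ∀ᵐ v : ℝ, ‖ft φ (2 * Real.pi * (2 * v))‖ ≤ ‖ft φ (2 * Real.pi * v)‖ := by
      filter_upwards [h.ae_exists_filter] with v ⟨a, b, hab, f1, _⟩
      have f0 := f1 0
      simp only [mul_zero, Int.cast_zero, add_zero] at f0
      rw [f0, norm_mul]
      refine mul_le_of_le_one_left (norm_nonneg _) ?_
      nlinarith [sq_nonneg ‖b‖, norm_nonneg a]
    intro v
    have hd := Measure.dense_of_ae hae
    have hcl : IsClosed {v : ℝ | ‖ft φ (2 * Real.pi * (2 * v))‖ ≤ ‖ft φ (2 * Real.pi * v)‖} :=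
      isClosed_le (by fun_prop) (by fun_prop)
    exact closure_minimal subset_rfl hcl (hd v)
  have hodd : ∀ q : ℤ, ft φ (2 * Real.pi * (2 * q + 1 : ℤ)) = 0 := by
    intro q
    -- an identity between continuous functions that holds almost everywhere, evaluated at zero,
    -- where its right-hand side vanishes
    have hid := eq_of_ae_eq_of_continuous
      (f := fun v => ‖ft φ (2 * Real.pi * v)‖ ^ 2 *
        ‖ft φ (2 * Real.pi * (2 * v + (2 * q + 1 : ℤ)))‖ ^ 2)
      (g := fun v => (‖ft φ (2 * Real.pi * v)‖ ^ 2 - ‖ft φ (2 * Real.pi * (2 * v))‖ ^ 2) *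
        ‖ft φ (2 * Real.pi * (v + 1 / 2 + q))‖ ^ 2)
      (by fun_prop) (by fun_prop)
      (by
        filter_upwards [h.ae_exists_filter] with v ⟨a, b, hab, f1, f2, _⟩
        have f0 := f1 0
        simp only [mul_zero, Int.cast_zero, add_zero] at f0
        rw [f0, f2, norm_mul, norm_mul]
        have : ‖b‖ ^ 2 = 1 - ‖a‖ ^ 2 := by linarith
        rw [mul_pow, mul_pow, this]
        ring) 0
    simp only [mul_zero, zero_add, sub_self, zero_mul] at hid
    rcases mul_eq_zero.1 hid with h0 | h0
    · exact absurd (by simpa using h0) h.ft_zero_ne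
    · simpa using h0
  -- every nonzero integer is odd, or twice a smaller one
  induction hn : l.natAbs using Nat.strong_induction_on generalizing l with
  | _ n ih =>
    rcases Int.even_or_odd' l with ⟨m, rfl | rfl⟩
    · have hm : ft φ (2 * Real.pi * m) = 0 := ih m.natAbs (by omega) m (by omega) rfl
      have := hle m
      rw [hm, norm_zero] at this
      push_cast
      exact norm_le_zero_iff.1 this
    · exact hodd m

/-! ### Completeness of the multiresolution -/

lemma continuous_zak_left {f : ℝ → ℂ} (hf : AssumptionS f) (hc : Continuous f) (v : ℝ) :
    Continuous fun x => zak f x v := by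
  rw [continuous_iff_continuousAt]
  intro x
  obtain ⟨N, hN⟩ := exists_nat_gt |x|
  obtain ⟨b, hb, hle⟩ := hf.exists_summable_bound hc N
  have h : ContinuousOn (fun x => zak f x v) {x : ℝ | |x| ≤ N} := by
    refine continuousOn_tsum (fun k => ?_) hb fun k y hy => ?_
    · exact Continuous.continuousOn (by fun_prop)
    · rw [norm_mul, norm_expo, mul_one]
      exact hle k y hy
  refine h.continuousAt ?_
  filter_upwards [(isOpen_lt continuous_abs continuous_const).mem_nhds hN] with y hy
  exact le_of_lt hy

lemma summable_shift {f : ℝ → ℂ} (hf : AssumptionS f) (hc : Continuous f) (x : ℝ) :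
    Summable fun k : ℤ => ‖(fun k : ℤ => f (x - k)) k‖ := hf.summable hc x

lemma exists_norm_zak_le {f : ℝ → ℂ} (hf : AssumptionS f) (hc : Continuous f) :
    ∃ C : ℝ, ∀ x v, ‖zak f x v‖ ≤ C := by
  obtain ⟨C, hC⟩ := hf.exists_tsum_le hc
  exact ⟨C, fun x v => (norm_trig_le (summable_shift hf hc x) v).trans (hC x)⟩

open scoped FourierTransform in
/-- The integer translates of the scaling function sum to a constant. -/
lemma IsWaveletPair.zak_zero {φ ψ : ℝ → ℂ} (h : IsWaveletPair φ ψ) (x : ℝ) :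
    zak φ x 0 = ft φ 0 := by
  have hf0 : ∀ n : ℤ, n ≠ 0 → 𝓕 φ (n : ℝ) = 0 := fun n hn => by
    rw [← ft_two_pi_mul, h.ft_two_pi_mul_int n hn]
  have hp := Real.tsum_eq_tsum_fourier (f := ⟨φ, h.continuous_scaling⟩) (fun K => ?_) ?_ x
  · have e1 : ∑' n : ℤ, 𝓕 φ (n : ℝ) * fourier n (x : UnitAddCircle) = ft φ 0 := by
      rw [tsum_eq_single 0 fun n hn => by rw [hf0 n hn, zero_mul]]
      rw [← ft_two_pi_mul]
      simp
    have e2 : ∑' n : ℤ, φ (x + n) = zak φ x 0 := by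
      unfold zak
      rw [← (Equiv.neg ℤ).tsum_eq]
      refine tsum_congr fun k => ?_
      simp [expo, sub_eq_add_neg]
    rw [← e1, ← e2]
    exact hp
  · obtain ⟨N, hN⟩ := K.isCompact.isBounded.exists_norm_le
    obtain ⟨M, hM⟩ := exists_nat_ge N
    obtain ⟨b, hb, hle⟩ := h.assumptionS_scaling.exists_summable_bound h.continuous_scaling M
    have hb' : Summable fun n : ℤ => b (-n) := (Equiv.neg ℤ).summable_iff.2 hb
    refine Summable.of_nonneg_of_le (fun _ => norm_nonneg _) (fun n => ?_) hb'
    have hb0 : 0 ≤ b (-n) := (norm_nonneg _).trans (hle (-n) 0 (by simp))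
    rw [ContinuousMap.norm_le _ hb0]
    rintro ⟨y, hy⟩
    have := hle (-n) y ((hN y hy).trans hM)
    have e : y - ((-n : ℤ) : ℝ) = y + n := by push_cast; ring
    rw [e] at this
    exact this
  · exact summable_of_ne_finset_zero (s := {0}) fun n hn => hf0 n (by simpa using hn)

/-- The normalization of the scaling function: the mean square over one period of its Zak transform
equals one at almost every frequency, hence at frequency zero. -/
lemma IsWaveletPair.norm_ft_zero {φ ψ : ℝ → ℂ} (h : IsWaveletPair φ ψ)
    (hφ : Integrable (ft φ)) : ‖ft φ 0‖ = 1 := by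
  have hS := h.assumptionS_scaling
  have hc := h.continuous_scaling
  have hcF := continuous_ft (hS.integrable hc)
  obtain ⟨C, hC⟩ := exists_norm_zak_le hS hc
  have hcont : Continuous fun v => ∫ x in Set.Ioc (0 : ℝ) 1, ‖zak φ x v‖ ^ 2 := by
    refine continuous_of_dominated (bound := fun _ => C ^ 2) (fun v => ?_) (fun v => ?_)
      (integrableOn_const (by simp)) ?_
    · have := continuous_zak_left hS hc v
      exact (by fun_prop : Continuous fun x => ‖zak φ x v‖ ^ 2).aestronglyMeasurable
    · refine Eventually.of_forall fun x => ?_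
      rw [norm_pow, norm_norm]
      exact pow_le_pow_left₀ (norm_nonneg _) (hC x v) 2
    · refine Eventually.of_forall fun x => ?_
      have : Continuous fun v => zak φ x v := continuous_trig (summable_shift hS hc x)
      fun_prop
  have hae : ∀ᵐ v : ℝ, ∫ x in Set.Ioc (0 : ℝ) 1, ‖zak φ x v‖ ^ 2 = 1 := by
    -- Poisson summation at the countably many rational positions; continuity in the position does
    -- the rest
    have e1 : ∀ᵐ v : ℝ, ∀ q : ℚ, HasSum (fun l : ℤ => ft φ (2 * Real.pi * (v + l)) *
        expo (q : ℝ) (2 * Real.pi * (v + l))) (zak φ q v) :=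
      ae_all_iff.2 fun q => hasSum_ft_eq_zak hS hc hφ q
    have e2 := ae_comp_mul_add h.partition (a := 2 * Real.pi) (by positivity) 0
    filter_upwards [e1, e2] with v h1 h2
    have hsum : Summable fun l : ℤ => ‖ft φ (2 * Real.pi * (v + l))‖ := by
      have := (h1 0).summable.norm
      simpa only [norm_mul, norm_expo, mul_one] using this
    have h3 : ∀ q : ℚ, zak φ q v = expo q (2 * Real.pi * v) *
        trig (fun l => ft φ (2 * Real.pi * (v + l))) q := by
      intro q
      rw [← (h1 q).tsum_eq]
      unfold trig
      rw [← tsum_mul_left]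
      refine tsum_congr fun l => ?_
      have : expo (q : ℝ) (2 * Real.pi * (v + l)) =
          expo q (2 * Real.pi * v) * expo l (2 * Real.pi * q) := by
        unfold expo
        rw [← Complex.exp_add]
        congr 1
        push_cast
        ring
      rw [this]
      ring
    have h4 : (fun x => zak φ x v) = fun x => expo x (2 * Real.pi * v) *
        trig (fun l => ft φ (2 * Real.pi * (v + l))) x := by
      refine Rat.isDenseEmbedding_coe_real.dense.equalizer (continuous_zak_left hS hc v) ?_ ?_
      · refine Continuous.mul ?_ (continuous_trig hsum)
        exact continuous_expo_uncurry.comp (continuous_id.prodMk continuous_const)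
      · funext q
        exact h3 q
    have h5 : ∀ x, ‖zak φ x v‖ ^ 2 = ‖trig (fun l => ft φ (2 * Real.pi * (v + l))) x‖ ^ 2 := by
      intro x
      rw [congrFun h4 x, norm_mul, norm_expo, one_mul]
    simp only [h5]
    -- Parseval in the position, then the partition of unity
    rw [integral_norm_sq_trig hsum]
    refine HasSum.tsum_eq (h2.congr_fun fun l => ?_)
    congr 3
    ring
  -- both sides are continuous in the frequency; at zero the Zak transform is the constant `φ̂(0)`
  have h0 := eq_of_ae_eq_of_continuous hcont continuous_const hae 0
  simp only [h.zak_zero] at h0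
  simp at h0
  rcases h0 with h0 | h0
  · exact h0
  · linarith [norm_nonneg (ft φ 0)]

/-- The function of the frequency that represents the sum `∑ₖ ζ_{jk} 2^{j/2} aₖ`, where `ζ_{jk}` is
the coefficient of the process at scale `j` and position `k`. -/
noncomputable def levelFreq (f : ℝ → ℂ) (j : ℕ) (a : ℤ → ℂ) (z : ℝ) : ℂ :=
  conj (ft f (z / 2 ^ j)) * trig a (z / (2 * Real.pi * 2 ^ j))

/-- The contribution of scale `j` at time `t`. -/
noncomputable def fullLevel (f : ℝ → ℂ) (j : ℕ) (t : ℝ) (z : ℝ) : ℂ :=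
  levelFreq f j (fun k => f (2 ^ j * t - k)) z

/-- The two-scale identity at scale `j`, at the rescaled time and frequency. -/
lemma IsWaveletPair.fullLevel_succ {φ ψ : ℝ → ℂ} (h : IsWaveletPair φ ψ)
    (hφ : Integrable (ft φ)) (hψ : Integrable (ft ψ)) (j : ℕ) (t : ℝ) :
    ∀ᵐ z : ℝ, fullLevel φ (j + 1) t z = fullLevel φ j t z + fullLevel ψ j t z := by
  have e := ae_comp_mul_add (h.two_scale hφ hψ (2 ^ j * t)) (a := (2 * Real.pi * 2 ^ (j + 1))⁻¹)
    (by positivity) 0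
  filter_upwards [e] with z hz
  have x1 : 2 * ((2 * Real.pi * 2 ^ (j + 1))⁻¹ * z + 0) = z / (2 * Real.pi * 2 ^ j) := by
    rw [pow_succ]
    field_simp
    ring
  have x2 : (2 * Real.pi * 2 ^ (j + 1))⁻¹ * z + 0 = z / (2 * Real.pi * 2 ^ (j + 1)) := by
    rw [add_zero, div_eq_inv_mul]
  rw [x1, x2] at hz
  have x3 : ∀ i : ℕ, 2 * Real.pi * (z / (2 * Real.pi * 2 ^ i)) = z / 2 ^ i := fun i => by
    field_simp
  rw [x3, x3, show (2 : ℝ) * (2 ^ j * t) = 2 ^ (j + 1) * t by ring] at hz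
  exact hz.symm

lemma IsWaveletPair.fullLevel_eq_add_sum {φ ψ : ℝ → ℂ} (h : IsWaveletPair φ ψ)
    (hφ : Integrable (ft φ)) (hψ : Integrable (ft ψ)) (n : ℕ) (t : ℝ) :
    ∀ᵐ z : ℝ, fullLevel φ n t z =
      fullLevel φ 0 t z + ∑ j ∈ Finset.range n, fullLevel ψ j t z := by
  filter_upwards [ae_all_iff.2 fun j => h.fullLevel_succ hφ hψ j t] with z hz
  induction n with
  | zero => simp
  | succ n ih => rw [hz, ih, Finset.sum_range_succ, add_assoc]

lemma exists_norm_fullLevel_le {f : ℝ → ℂ} (hf : AssumptionS f) (hc : Continuous f) :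
    ∃ C : ℝ, ∀ j t z, ‖fullLevel f j t z‖ ≤ C := by
  obtain ⟨C, hC⟩ := exists_norm_zak_le hf hc
  refine ⟨(∫ x, ‖f x‖) * C, fun j t z => ?_⟩
  unfold fullLevel levelFreq
  rw [norm_mul, RCLike.norm_conj]
  exact mul_le_mul (norm_ft_le _) (hC (2 ^ j * t) _) (norm_nonneg _)
    (integral_nonneg fun _ => norm_nonneg _)

lemma zak_eq_expo_floor_mul {f : ℝ → ℂ} (x v : ℝ) :
    zak f x v = expo ⌊x⌋ (2 * Real.pi * v) * zak f (Int.fract x) v := by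
  unfold zak
  rw [← tsum_mul_left, ← (Equiv.addRight ⌊x⌋).tsum_eq]
  refine tsum_congr fun k => ?_
  rw [Equiv.coe_addRight]
  push_cast
  rw [expo_add_left, Int.fract]
  have : x - (k + ⌊x⌋) = x - ⌊x⌋ - k := by ring
  rw [this]
  ring

/-- The Zak transform is continuous at frequency zero, uniformly in the position within a period. -/
lemma tendsto_zak_sub {f : ℝ → ℂ} (hf : AssumptionS f) (hc : Continuous f) {x v : ℕ → ℝ}
    (hx : ∀ n, x n ∈ Set.Icc (0 : ℝ) 1) (hv : Tendsto v atTop (𝓝 0)) :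
    Tendsto (fun n => zak f (x n) (v n) - zak f (x n) 0) atTop (𝓝 0) := by
  obtain ⟨b, hb, hle⟩ := hf.exists_summable_bound hc 1
  have hle' : ∀ n (k : ℤ), ‖f (x n - k)‖ ≤ b k := fun n k => hle k _ (by
    rw [abs_of_nonneg (hx n).1]
    simpa using (hx n).2)
  have e : ∀ n, zak f (x n) (v n) - zak f (x n) 0 = ∑' k : ℤ, f (x n - k) *
      (expo k (2 * Real.pi * v n) - expo k (2 * Real.pi * 0)) := by
    intro n
    unfold zak
    rw [← (summable_zak hf hc _ _).tsum_sub (summable_zak hf hc _ _)]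
    exact tsum_congr fun k => by ring
  simp only [e]
  have h0 : ∑' _ : ℤ, (0 : ℂ) = 0 := tsum_zero
  rw [← h0]
  refine tendsto_tsum_of_dominated_convergence (bound := fun k => b k * 2) (hb.mul_right 2)
    (fun k => ?_) (Eventually.of_forall fun n k => ?_)
  · have h1 : Tendsto (fun n => expo k (2 * Real.pi * v n) - expo k (2 * Real.pi * 0)) atTop
        (𝓝 0) := by
      have := ((continuous_expo k).tendsto (2 * Real.pi * 0)).comp (hv.const_mul (2 * Real.pi))
      simpa using this.sub_const (expo k (2 * Real.pi * 0))
    refine squeeze_zero_norm (a := fun n => b k *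
      ‖expo k (2 * Real.pi * v n) - expo k (2 * Real.pi * 0)‖) (fun n => ?_) ?_
    · rw [norm_mul]
      exact mul_le_mul_of_nonneg_right (hle' n k) (norm_nonneg _)
    · simpa using (h1.norm).const_mul (b k)
  · rw [norm_mul]
    refine mul_le_mul (hle' n k) ?_ (norm_nonneg _) ((norm_nonneg _).trans (hle' n k))
    refine (norm_sub_le _ _).trans ?_
    rw [norm_expo, norm_expo]
    norm_num

/-- At every frequency the projections onto finer and finer scales converge to the exponential. -/
lemma IsWaveletPair.tendsto_fullLevel {φ ψ : ℝ → ℂ} (h : IsWaveletPair φ ψ)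
    (hφ : Integrable (ft φ)) (t z : ℝ) :
    Tendsto (fun n => fullLevel φ n t z) atTop (𝓝 (expo t z)) := by
  have hS := h.assumptionS_scaling
  have hc := h.continuous_scaling
  have hcF := continuous_ft (hS.integrable hc)
  have hp : Tendsto (fun n : ℕ => (2 : ℝ) ^ n) atTop atTop :=
    tendsto_pow_atTop_atTop_of_one_lt (by norm_num)
  have hw : Tendsto (fun n : ℕ => z / (2 : ℝ) ^ n) atTop (𝓝 0) := hp.const_div_atTop z
  have hv : Tendsto (fun n : ℕ => z / (2 * Real.pi * (2 : ℝ) ^ n)) atTop (𝓝 0) :=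
    (hp.const_mul_atTop (by positivity)).const_div_atTop z
  have h1 : Tendsto (fun n : ℕ => conj (ft φ (z / 2 ^ n))) atTop (𝓝 (conj (ft φ 0))) :=
    (Complex.continuous_conj.tendsto _).comp ((hcF.tendsto 0).comp hw)
  -- the integer part of `2^n t` contributes the exponential, the fractional part the constant
  -- `φ̂(0)`
  have h2 : Tendsto (fun n : ℕ => zak φ (Int.fract (2 ^ n * t)) (z / (2 * Real.pi * 2 ^ n))) atTop
      (𝓝 (ft φ 0)) := by
    have := tendsto_zak_sub hS hc (x := fun n => Int.fract (2 ^ n * t))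
      (fun n => ⟨Int.fract_nonneg _, (Int.fract_lt_one _).le⟩) hv
    simp only [h.zak_zero] at this
    simpa using this.add_const (ft φ 0)
  have h3 : Tendsto (fun n : ℕ => expo ⌊2 ^ n * t⌋ (2 * Real.pi * (z / (2 * Real.pi * 2 ^ n))))
      atTop (𝓝 (expo t z)) := by
    have e : ∀ n : ℕ, expo ⌊2 ^ n * t⌋ (2 * Real.pi * (z / (2 * Real.pi * 2 ^ n))) =
        expo (⌊2 ^ n * t⌋ / 2 ^ n) z := fun n => by
      unfold expo
      congr 1
      have : (Real.pi : ℂ) ≠ 0 := Complex.ofReal_ne_zero.2 Real.pi_ne_zero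
      push_cast
      field_simp
    simp only [e]
    have h4 : Tendsto (fun n : ℕ => (⌊2 ^ n * t⌋ : ℝ) / 2 ^ n) atTop (𝓝 t) := by
      have h5 : Tendsto (fun n : ℕ => 1 / (2 : ℝ) ^ n) atTop (𝓝 0) := hp.const_div_atTop 1
      refine tendsto_of_tendsto_of_tendsto_of_le_of_le (g := fun n : ℕ => t - 1 / (2 : ℝ) ^ n)
        (h := fun _ => t) ?_ tendsto_const_nhds (fun n => ?_) (fun n => ?_)
      · simpa using h5.const_sub t
      · have h6 := Int.lt_floor_add_one ((2 : ℝ) ^ n * t)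
        have h7 : (0 : ℝ) < 2 ^ n := by positivity
        simp only
        rw [le_div_iff₀ h7, sub_mul, div_mul_cancel₀ _ h7.ne']
        linarith
      · have h6 := Int.floor_le ((2 : ℝ) ^ n * t)
        have h7 : (0 : ℝ) < 2 ^ n := by positivity
        simp only
        rw [div_le_iff₀ h7]
        linarith
    have h10 : Continuous fun s : ℝ => expo s z :=
      continuous_expo_uncurry.comp (continuous_id.prodMk continuous_const)
    exact (h10.tendsto t).comp h4
  have h8 := h1.mul (h3.mul h2)
  have h9 : conj (ft φ 0) * (expo t z * ft φ 0) = expo t z := by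
    have : conj (ft φ 0) * ft φ 0 = 1 := by
      rw [mul_comm, Complex.mul_conj, Complex.normSq_eq_norm_sq, h.norm_ft_zero hφ]
      norm_num
    linear_combination expo t z * this
  rw [h9] at h8
  refine h8.congr fun n => ?_
  unfold fullLevel levelFreq
  rw [← zak_eq_trig, zak_eq_expo_floor_mul (2 ^ n * t)]

/-! ### Norms of the levels of the expansion -/

lemma eLpNorm_two_le_of_lintegral_le {Ω : Type*} [MeasurableSpace Ω] {μ : Measure Ω} {F : Ω → ℂ}
    {r : ℝ} (hr : 0 ≤ r)
    (h : ∫⁻ z, ‖F z‖ₑ ^ 2 ∂μ ≤ ENNReal.ofReal r) : eLpNorm F 2 μ ≤ ENNReal.ofReal (√r) := by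
  rw [eLpNorm_eq_lintegral_rpow_enorm_toReal (by norm_num) (by norm_num)]
  simp only [ENNReal.toReal_ofNat, ENNReal.rpow_ofNat]
  rw [Real.sqrt_eq_rpow, ← ENNReal.ofReal_rpow_of_nonneg hr (by norm_num)]
  exact ENNReal.rpow_le_rpow h (by norm_num)

/-- The block estimate `lintegral_mul_norm_sq_trig_le` for trigonometric series of period `L`. -/
lemma lintegral_mul_norm_sq_trig_div_le {a : ℤ → ℂ} (ha : Summable fun k => ‖a k‖) {H : ℝ → ℝ}
    {L : ℝ} (hL : 0 < L) (h0 : ∀ z, 0 ≤ H z) (hd : Differentiable ℝ H) (hH : Integrable H)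
    (hH' : Integrable (deriv H)) :
    ∫⁻ z, ENNReal.ofReal (H z * ‖trig a (z / L)‖ ^ 2) ≤
      ENNReal.ofReal (((∫ z, H z) + L * ∫ z, |deriv H z|) * ∑' k, ‖a k‖ ^ 2) := by
  have hder : ∀ v, HasDerivAt (fun v => L * H (L * v)) (L * (deriv H (L * v) * L)) v := by
    intro v
    have h1 : HasDerivAt (fun v => L * v) L v := by simpa using (hasDerivAt_id v).const_mul L
    exact ((hd _).hasDerivAt.comp v h1).const_mul L
  have hder' : deriv (fun v => L * H (L * v)) = fun v => L * (deriv H (L * v) * L) :=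
    funext fun v => (hder v).deriv
  have h1 := lintegral_mul_norm_sq_trig_le ha (G := fun v => L * H (L * v))
    (fun v => mul_nonneg hL.le (h0 _)) (fun v => (hder v).differentiableAt)
    ((hH.comp_mul_left' hL.ne').const_mul L)
    (by rw [hder']; exact (((hH'.comp_mul_left' hL.ne').mul_const L).const_mul L))
  have e1 : ∫ v, L * H (L * v) = ∫ z, H z := by
    rw [integral_const_mul, Measure.integral_comp_mul_left, smul_eq_mul,
      abs_of_pos (inv_pos.2 hL), mul_inv_cancel_left₀ hL.ne']
  have e2 : ∫ v, |deriv (fun v => L * H (L * v)) v| = L * ∫ z, |deriv H z| := by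
    rw [hder']
    simp only [abs_mul, abs_of_pos hL]
    rw [integral_const_mul, integral_mul_const,
      Measure.integral_comp_mul_left (fun z => |deriv H z|), smul_eq_mul,
      abs_of_pos (inv_pos.2 hL)]
    field_simp
  rw [e1, e2] at h1
  refine le_trans (le_of_eq ?_) h1
  have h2 : ∀ h : ℝ → ℝ≥0∞, ∫⁻ z, h z = ∫⁻ v, ENNReal.ofReal L * h (L * v) := by
    intro h
    have hemb : MeasurableEmbedding fun x : ℝ => L * x :=
      (Homeomorph.mulLeft₀ L hL.ne').measurableEmbedding
    conv_lhs => rw [← Real.smul_map_volume_mul_left hL.ne']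
    rw [lintegral_smul_measure, abs_of_pos hL, smul_eq_mul, hemb.lintegral_map,
      lintegral_const_mul' _ _ ENNReal.ofReal_ne_top]
  rw [h2]
  refine lintegral_congr fun v => ?_
  rw [← ENNReal.ofReal_mul hL.le, mul_div_cancel_left₀ _ hL.ne', mul_assoc]

lemma lintegral_spectralMeasure {S : ℝ → ℝ} (hS : Integrable S) {g : ℝ → ℝ≥0∞}
    (hg : Measurable g) :
    ∫⁻ z, g z ∂spectralMeasure S = ∫⁻ z, ENNReal.ofReal (S z / (2 * Real.pi)) * g z := by
  unfold spectralMeasure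
  rw [lintegral_withDensity_eq_lintegral_mul₀
    (hS.div_const (2 * Real.pi)).aemeasurable.ennreal_ofReal hg.aemeasurable]
  rfl

lemma continuous_levelFreq {f : ℝ → ℂ} (hf : Continuous (ft f)) {a : ℤ → ℂ}
    (ha : Summable fun k => ‖a k‖) (j : ℕ) : Continuous (levelFreq f j a) := by
  have := continuous_trig ha
  unfold levelFreq
  exact (Complex.continuous_conj.comp (hf.comp (continuous_id.div_const _))).mul
    (this.comp (continuous_id.div_const _))

lemma lintegral_levelFreq_eq {S : ℝ → ℝ} (hS : Integrable S) (hS0 : ∀ z, 0 ≤ S z) {f : ℝ → ℂ}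
    (hf : Continuous (ft f)) {a : ℤ → ℂ} (ha : Summable fun k => ‖a k‖) (j : ℕ) :
    ∫⁻ z, ‖levelFreq f j a z‖ₑ ^ 2 ∂spectralMeasure S =
      ∫⁻ z, ENNReal.ofReal (‖ft f (z / 2 ^ j)‖ ^ 2 * S z / (2 * Real.pi) *
        ‖trig a (z / (2 * Real.pi * 2 ^ j))‖ ^ 2) := by
  have hm := (continuous_levelFreq hf ha j).measurable
  rw [lintegral_spectralMeasure hS (by fun_prop)]
  refine lintegral_congr fun z => ?_
  have h0 : 0 ≤ S z / (2 * Real.pi) := div_nonneg (hS0 z) (by positivity)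
  rw [← ofReal_norm, ← ENNReal.ofReal_pow (norm_nonneg _), ← ENNReal.ofReal_mul h0]
  congr 1
  unfold levelFreq
  rw [norm_mul, RCLike.norm_conj]
  ring

/-- The norm of a level, when the energy of the level in the spectrum and its variation are bounded
by the integrals of `h₀` and `h₁`. -/
lemma lintegral_levelFreq_le {S : ℝ → ℝ} (hS : Integrable S) (hS0 : ∀ z, 0 ≤ S z)
    (hSd : Differentiable ℝ S) {f : ℝ → ℂ} (hd : Differentiable ℝ (ft f)) {j : ℕ} {h₀ h₁ : ℝ → ℝ}
    (hh₀ : Integrable h₀) (hh₁ : Integrable h₁)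
    (b₀ : ∀ z, ‖ft f (z / 2 ^ j)‖ ^ 2 * S z ≤ h₀ z)
    (b₁ : ∀ z, 2 * ‖ft f (z / 2 ^ j)‖ * (‖deriv (ft f) (z / 2 ^ j)‖ / 2 ^ j) * S z +
      ‖ft f (z / 2 ^ j)‖ ^ 2 * |deriv S z| ≤ h₁ z)
    {a : ℤ → ℂ} (ha : Summable fun k => ‖a k‖) :
    ∫⁻ z, ‖levelFreq f j a z‖ₑ ^ 2 ∂spectralMeasure S ≤
      ENNReal.ofReal (((2 * Real.pi)⁻¹ * (∫ z, h₀ z) + 2 ^ j * ∫ z, h₁ z) * ∑' k, ‖a k‖ ^ 2) := by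
  rw [lintegral_levelFreq_eq hS hS0 hd.continuous ha]
  set H : ℝ → ℝ := fun z => ‖ft f (z / 2 ^ j)‖ ^ 2 * S z / (2 * Real.pi) with hH
  have hp : (0 : ℝ) < 2 ^ j := by positivity
  have hpi : (0 : ℝ) < 2 * Real.pi := by positivity
  have hder : ∀ z, HasDerivAt H ((2 * inner ℝ (ft f (z / 2 ^ j))
      ((1 / 2 ^ j : ℝ) • deriv (ft f) (z / 2 ^ j)) * S z +
      ‖ft f (z / 2 ^ j)‖ ^ 2 * deriv S z) / (2 * Real.pi)) z := by
    intro z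
    have h1 : HasDerivAt (fun z : ℝ => z / 2 ^ j) (1 / 2 ^ j) z := (hasDerivAt_id z).div_const _
    have h2 : HasDerivAt (fun z => ft f (z / 2 ^ j))
        ((1 / 2 ^ j : ℝ) • deriv (ft f) (z / 2 ^ j)) z := (hd _).hasDerivAt.scomp z h1
    exact ((h2.norm_sq).mul (hSd z).hasDerivAt).div_const _
  have hH0 : ∀ z, 0 ≤ H z := fun z => by
    have := hS0 z
    positivity
  have hHle : ∀ z, H z ≤ (2 * Real.pi)⁻¹ * h₀ z := fun z => by
    rw [hH, inv_mul_eq_div]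
    exact div_le_div_of_nonneg_right (b₀ z) hpi.le
  have hHd : Differentiable ℝ H := fun z => (hder z).differentiableAt
  have hH'le : ∀ z, |deriv H z| ≤ (2 * Real.pi)⁻¹ * h₁ z := fun z => by
    rw [(hder z).deriv, abs_div, abs_of_pos hpi, inv_mul_eq_div]
    refine div_le_div_of_nonneg_right (le_trans ?_ (b₁ z)) hpi.le
    refine (abs_add_le _ _).trans (add_le_add ?_ ?_)
    · rw [abs_mul, abs_of_nonneg (hS0 z), abs_mul, abs_two]
      refine mul_le_mul_of_nonneg_right ?_ (hS0 z)
      rw [mul_assoc]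
      refine mul_le_mul_of_nonneg_left ?_ two_pos.le
      refine (abs_real_inner_le_norm _ _).trans (le_of_eq ?_)
      rw [norm_smul, Real.norm_eq_abs, abs_of_pos (by positivity)]
      ring
    · rw [abs_mul, abs_of_nonneg (by positivity : (0 : ℝ) ≤ ‖ft f (z / 2 ^ j)‖ ^ 2)]
  have hHi : Integrable H := (hh₀.const_mul _).mono' hHd.continuous.aestronglyMeasurable
    (Eventually.of_forall fun z => by
      rw [Real.norm_eq_abs, abs_of_nonneg (hH0 z)]
      exact hHle z)
  have hH'i : Integrable (deriv H) := (hh₁.const_mul _).mono'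
    (stronglyMeasurable_deriv H).aestronglyMeasurable (Eventually.of_forall hH'le)
  refine (lintegral_mul_norm_sq_trig_div_le ha (L := 2 * Real.pi * 2 ^ j) (by positivity) hH0 hHd
    hHi hH'i).trans (ENNReal.ofReal_le_ofReal ?_)
  refine mul_le_mul_of_nonneg_right ?_ (tsum_nonneg fun _ => by positivity)
  have i1 : ∫ z, H z ≤ (2 * Real.pi)⁻¹ * ∫ z, h₀ z := by
    rw [← integral_const_mul]
    exact integral_mono hHi (hh₀.const_mul _) hHle
  have i2 : ∫ z, |deriv H z| ≤ (2 * Real.pi)⁻¹ * ∫ z, h₁ z := by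
    rw [← integral_const_mul]
    exact integral_mono hH'i.abs (hh₁.const_mul _) hH'le
  have i3 : 2 * Real.pi * 2 ^ j * ∫ z, |deriv H z| ≤ 2 ^ j * ∫ z, h₁ z := by
    calc 2 * Real.pi * 2 ^ j * ∫ z, |deriv H z|
        ≤ 2 * Real.pi * 2 ^ j * ((2 * Real.pi)⁻¹ * ∫ z, h₁ z) := by gcongr
      _ = 2 ^ j * ∫ z, h₁ z := by field_simp
  linarith

/-- The norm of a level whose trigonometric series is bounded by `s`. Unlike
`lintegral_levelFreq_le`, it does not involve the variation of the spectral weight. -/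
lemma lintegral_levelFreq_le_of_norm_le {S : ℝ → ℝ} (hS : Integrable S) (hS0 : ∀ z, 0 ≤ S z)
    {f : ℝ → ℂ} (hd : Continuous (ft f)) {j : ℕ} {h₀ : ℝ → ℝ}
    (hh₀ : Integrable h₀) (b₀ : ∀ z, ‖ft f (z / 2 ^ j)‖ ^ 2 * S z ≤ h₀ z)
    {a : ℤ → ℂ} (ha : Summable fun k => ‖a k‖) {s : ℝ} (hs : ∀ v, ‖trig a v‖ ≤ s) :
    ∫⁻ z, ‖levelFreq f j a z‖ₑ ^ 2 ∂spectralMeasure S ≤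
      ENNReal.ofReal ((2 * Real.pi)⁻¹ * (∫ z, h₀ z) * s ^ 2) := by
  have hh0 : ∀ z, 0 ≤ h₀ z := fun z =>
    (mul_nonneg (by positivity) (hS0 z)).trans (b₀ z)
  rw [lintegral_levelFreq_eq hS hS0 hd ha, ← integral_const_mul, ← integral_mul_const,
    ofReal_integral_eq_lintegral_ofReal ((hh₀.const_mul _).mul_const _)
      (Eventually.of_forall fun z => by have := hh0 z; positivity)]
  refine lintegral_mono fun z => ENNReal.ofReal_le_ofReal ?_
  have := hh0 z
  refine mul_le_mul ?_ (pow_le_pow_left₀ (norm_nonneg _) (hs _) 2) (by positivity) (by positivity)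
  rw [inv_mul_eq_div]
  exact div_le_div_of_nonneg_right (b₀ z) (by positivity)

/-! ### Bounds for the Fourier transforms -/

lemma norm_ft_le_cφ {φ ψ : ℝ → ℂ} {α γ : ℝ} (h : WaveletConditions φ ψ α γ) (u : ℝ) :
    ‖ft φ u‖ ≤ cφ φ := le_ciSup h.bdd_ft_scaling u

lemma norm_deriv_ft_le_cφ' {φ ψ : ℝ → ℂ} {α γ : ℝ} (h : WaveletConditions φ ψ α γ) (u : ℝ) :
    ‖deriv (ft φ) u‖ ≤ cφ' φ := le_ciSup h.bdd_deriv_ft_scaling u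

lemma norm_deriv2_ft_le_cψ'' {φ ψ : ℝ → ℂ} {α γ : ℝ} (h : WaveletConditions φ ψ α γ) (u : ℝ) :
    ‖deriv (deriv (ft ψ)) u‖ ≤ cψ'' ψ := le_ciSup h.bdd_deriv2_ft_wavelet u

lemma cψ''_nonneg {φ ψ : ℝ → ℂ} {α γ : ℝ} (h : WaveletConditions φ ψ α γ) : 0 ≤ cψ'' ψ :=
  (norm_nonneg _).trans (norm_deriv2_ft_le_cψ'' h 0)

lemma norm_deriv_ft_wavelet_le {φ ψ : ℝ → ℂ} {α γ : ℝ} (h : WaveletConditions φ ψ α γ) (u : ℝ) :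
    ‖deriv (ft ψ) u‖ ≤ cψ'' ψ * |u| := by
  have := convex_univ.norm_image_sub_le_of_norm_deriv_le (f := deriv (ft ψ)) (C := cψ'' ψ)
    (fun x _ => h.differentiable_deriv_ft_wavelet x) (fun x _ => norm_deriv2_ft_le_cψ'' h x)
    (Set.mem_univ 0) (Set.mem_univ u)
  rwa [h.deriv_ft_wavelet_zero, sub_zero, sub_zero, Real.norm_eq_abs] at this

/-- Taylor's formula at the double zero of `ψ̂`. -/
lemma norm_ft_wavelet_le {φ ψ : ℝ → ℂ} {α γ : ℝ} (h : WaveletConditions φ ψ α γ) (u : ℝ) :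
    ‖ft ψ u‖ ≤ cψ'' ψ * u ^ 2 / 2 := by
  have hder : ∀ s : ℝ, HasDerivAt (fun s : ℝ => ft ψ (s * u)) (u • deriv (ft ψ) (s * u)) s := by
    intro s
    have h1 : HasDerivAt (fun s : ℝ => s * u) u s := by simpa using (hasDerivAt_id s).mul_const u
    exact (h.differentiable_ft_wavelet _).hasDerivAt.scomp s h1
  have hB : ∀ s : ℝ, HasDerivAt (fun s : ℝ => cψ'' ψ * u ^ 2 * (s ^ 2 / 2))
      (cψ'' ψ * u ^ 2 * s) s := by
    intro s
    have h1 : HasDerivAt (fun s : ℝ => s ^ 2 / 2) s s := by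
      simpa using (hasDerivAt_pow 2 s).div_const 2
    exact h1.const_mul _
  have h2 := image_norm_le_of_norm_deriv_right_le_deriv_boundary (a := 0) (b := 1)
    (f := fun s : ℝ => ft ψ (s * u)) (f' := fun s => u • deriv (ft ψ) (s * u))
    (fun s _ => (hder s).continuousAt.continuousWithinAt)
    (fun s _ => (hder s).hasDerivWithinAt) (B := fun s : ℝ => cψ'' ψ * u ^ 2 * (s ^ 2 / 2))
    (B' := fun s : ℝ => cψ'' ψ * u ^ 2 * s) (by simp [h.ft_wavelet_zero]) hB
    (fun s hs => by
      rw [norm_smul, Real.norm_eq_abs]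
      calc |u| * ‖deriv (ft ψ) (s * u)‖ ≤ |u| * (cψ'' ψ * |s * u|) := by
            gcongr
            exact norm_deriv_ft_wavelet_le h _
        _ = cψ'' ψ * u ^ 2 * s := by
            rw [abs_mul, abs_of_nonneg hs.1, ← sq_abs u]
            ring)
    (Set.right_mem_Icc.2 zero_le_one)
  simp only [one_mul, one_pow] at h2
  linarith

lemma SpectralConditions.integrable_mul_pow_three {S : ℝ → ℝ} (hS : SpectralConditions S)
    (hi : Integrable S) : Integrable fun z : ℝ => |S z| * |z| ^ 3 := by
  have hc := hS.differentiable.continuous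
  refine (hi.abs.add hS.integrable_mul_pow).mono'
    (by fun_prop : Continuous fun z : ℝ => |S z| * |z| ^ 3).aestronglyMeasurable
    (Eventually.of_forall fun z => ?_)
  rw [Real.norm_eq_abs, abs_of_nonneg (by positivity)]
  have h1 : |z| ^ 3 ≤ 1 + |z| ^ 4 := by
    rcases le_total |z| 1 with h | h
    · have := pow_le_one₀ (n := 3) (abs_nonneg z) h
      have : 0 ≤ |z| ^ 4 := by positivity
      linarith
    · have := pow_le_pow_right₀ h (show 3 ≤ 4 by norm_num)
      linarith
  calc |S z| * |z| ^ 3 ≤ |S z| * (1 + |z| ^ 4) := by gcongr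
    _ = |S z| + |S z| * |z| ^ 4 := by ring

/-- The weight of a wavelet level. By `|ψ̂(u)| ≤ c u² / 2` and `|ψ̂'(u)| ≤ c |u|`, the energy of the
level in the spectrum is of order `2^{-4j}` and its variation, times the period, of order `2^{-3j}`;
the second bound, without the variation, serves for a single coefficient. -/
lemma lintegral_levelFreq_wavelet_le {φ ψ : ℝ → ℂ} {α γ : ℝ} {R : ℝ → ℂ} {S : ℝ → ℝ}
    (h : WaveletConditions φ ψ α γ) (hR : IsSpectralDensity R S) (hS : SpectralConditions S)
    (j : ℕ) {a : ℤ → ℂ} (ha : Summable fun k => ‖a k‖) :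
    ∫⁻ z, ‖levelFreq ψ j a z‖ₑ ^ 2 ∂spectralMeasure S ≤
      ENNReal.ofReal ((A₁ψ ψ S / 4 / (2 ^ j) ^ 4 + Real.pi * Aψ ψ S / (2 ^ j) ^ 3) *
        ∑' k, ‖a k‖ ^ 2) ∧
    ∀ s, (∀ v, ‖trig a v‖ ≤ s) → ∫⁻ z, ‖levelFreq ψ j a z‖ₑ ^ 2 ∂spectralMeasure S ≤
      ENNReal.ofReal (A₁ψ ψ S / 4 / (2 ^ j) ^ 4 * s ^ 2) := by
  have hp : (0 : ℝ) < 2 ^ j := by positivity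
  set p : ℝ := 2 ^ j with hpdef
  set c := cψ'' ψ with hc
  have hc0 : 0 ≤ c := cψ''_nonneg h
  have i3 := hS.integrable_mul_pow_three hR.integrable
  have i4 := hS.integrable_mul_pow
  have i4' := hS.integrable_deriv_mul_pow
  have b₀ : ∀ z, ‖ft ψ (z / p)‖ ^ 2 * S z ≤ c ^ 2 / 4 / p ^ 4 * (|S z| * |z| ^ 4) := by
    intro z
    have h1 := pow_le_pow_left₀ (norm_nonneg _) (norm_ft_wavelet_le h (z / p)) 2
    have h2 : (c * (z / p) ^ 2 / 2) ^ 2 = c ^ 2 / 4 / p ^ 4 * |z| ^ 4 := by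
      rw [show |z| ^ 4 = (|z| ^ 2) ^ 2 by ring, sq_abs]
      field_simp
      ring
    rw [abs_of_nonneg (hR.nonneg z), mul_left_comm, mul_comm (S z)]
    refine mul_le_mul_of_nonneg_right (h1.trans (le_of_eq ?_)) (hR.nonneg z)
    rw [h2]
  have b₁ : ∀ z, 2 * ‖ft ψ (z / p)‖ * (‖deriv (ft ψ) (z / p)‖ / p) * S z +
      ‖ft ψ (z / p)‖ ^ 2 * |deriv S z| ≤
      c ^ 2 / 2 / p ^ 4 * (|deriv S z| * |z| ^ 4 + 2 * |S z| * |z| ^ 3) := by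
    intro z
    have h1 := norm_ft_wavelet_le h (z / p)
    have h2 := norm_deriv_ft_wavelet_le h (z / p)
    rw [abs_div, abs_of_pos hp] at h2
    have h3 : (z / p) ^ 2 = |z| ^ 2 / p ^ 2 := by rw [div_pow, sq_abs]
    rw [h3] at h1
    have hS0 := hR.nonneg z
    calc 2 * ‖ft ψ (z / p)‖ * (‖deriv (ft ψ) (z / p)‖ / p) * S z +
        ‖ft ψ (z / p)‖ ^ 2 * |deriv S z|
        ≤ 2 * (c * (|z| ^ 2 / p ^ 2) / 2) * (c * (|z| / p) / p) * S z +
          (c * (|z| ^ 2 / p ^ 2) / 2) ^ 2 * |deriv S z| := by gcongr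
      _ = c ^ 2 / 2 / p ^ 4 * (|deriv S z| * |z| ^ 4 / 2 + 2 * |S z| * |z| ^ 3) := by
          rw [abs_of_nonneg hS0]
          field_simp
          ring
      _ ≤ _ := by
          gcongr
          have : 0 ≤ |deriv S z| * |z| ^ 4 := by positivity
          linarith
  have e0 : (2 * Real.pi)⁻¹ * ∫ z, c ^ 2 / 4 / p ^ 4 * (|S z| * |z| ^ 4) =
      A₁ψ ψ S / 4 / p ^ 4 := by
    rw [integral_const_mul]
    unfold A₁ψ
    rw [← hc]
    field_simp
  have e1 : p * ∫ z, c ^ 2 / 2 / p ^ 4 * (|deriv S z| * |z| ^ 4 + 2 * |S z| * |z| ^ 3) =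
      Real.pi * Aψ ψ S / p ^ 3 := by
    rw [integral_const_mul]
    unfold Aψ
    rw [← hc]
    field_simp
  constructor
  · have := lintegral_levelFreq_le hR.integrable hR.nonneg hS.differentiable
      h.differentiable_ft_wavelet (j := j) (i4.const_mul (c ^ 2 / 4 / p ^ 4))
      ((i4'.add (i3.const_mul 2)).const_mul (c ^ 2 / 2 / p ^ 4)) b₀
      (fun z => by
        have := b₁ z
        simp only [Pi.add_apply]
        rwa [← mul_assoc]) ha
    simp only [Pi.add_apply, ← mul_assoc (2 : ℝ) |S _|] at this
    rwa [e0, e1] at this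
  · intro s hs
    have := lintegral_levelFreq_le_of_norm_le hR.integrable hR.nonneg
      h.differentiable_ft_wavelet.continuous (j := j) (i4.const_mul (c ^ 2 / 4 / p ^ 4)) b₀ ha hs
    rwa [e0] at this

lemma lintegral_levelFreq_scaling_le {φ ψ : ℝ → ℂ} {α γ : ℝ} {R : ℝ → ℂ} {S : ℝ → ℝ}
    (h : WaveletConditions φ ψ α γ) (hR : IsSpectralDensity R S) (hS : SpectralConditions S)
    {a : ℤ → ℂ} (ha : Summable fun k => ‖a k‖) :
    ∫⁻ z, ‖levelFreq φ 0 a z‖ₑ ^ 2 ∂spectralMeasure S ≤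
      ENNReal.ofReal ((A₁φ φ S + 2 * Real.pi * Aφ φ S) * ∑' k, ‖a k‖ ^ 2) := by
  have b := norm_ft_le_cφ h
  have b' := norm_deriv_ft_le_cφ' h
  have hc0 : 0 ≤ cφ φ := (norm_nonneg _).trans (b 0)
  have hi := hR.integrable
  have hi' := hS.integrable_deriv
  have key := lintegral_levelFreq_le hR.integrable hR.nonneg hS.differentiable
      h.differentiable_ft_scaling (j := 0) (hi.abs.const_mul (cφ φ ^ 2))
      ((hi'.abs.const_mul (cφ φ ^ 2)).add (hi.abs.const_mul (2 * cφ φ * cφ' φ)))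
      (fun z => by
        rw [abs_of_nonneg (hR.nonneg z)]
        have := hR.nonneg z
        gcongr
        exact b _)
      (fun z => by
        simp only [Pi.add_apply, pow_zero, div_one]
        rw [abs_of_nonneg (hR.nonneg z), add_comm]
        have := hR.nonneg z
        gcongr
        · exact b _
        · exact b _
        · exact b' _) ha
  simp only [Pi.add_apply] at key
  rw [integral_add (hi'.abs.const_mul (cφ φ ^ 2)) (hi.abs.const_mul (2 * cφ φ * cφ' φ)),
    integral_const_mul, integral_const_mul, integral_const_mul] at key
  refine key.trans (le_of_eq ?_)
  unfold A₁φ Aφ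
  congr 2
  field_simp

/-! ### Integrability of the Fourier transforms -/

lemma continuous_log_rpow {α : ℝ} (hα : 0 < α) :
    Continuous fun u : ℝ => Real.log (Real.exp α + |u|) ^ α := by
  refine Continuous.rpow_const ?_ fun u => Or.inr hα.le
  refine Continuous.log (by fun_prop) fun u => ?_
  have := Real.exp_pos α
  positivity

/-- In the integrability condition, `1 + |u|` may be replaced by `e^α + |u|`: on a compact set both
logarithms are bounded, and beyond it `e^α + |u| ≤ (1 + |u|)^{1 + α}`. -/
lemma integrable_log_mul_rpow {g : ℝ → ℂ} (hg : Continuous g) {M α γ : ℝ} (hM : ∀ u, ‖g u‖ ≤ M)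
    (hα : 0 < α) (hγ : 0 < γ)
    (h : Integrable fun u : ℝ => Real.log (1 + |u|) ^ α * ‖g u‖ ^ γ) :
    Integrable fun u : ℝ => Real.log (Real.exp α + |u|) ^ α * ‖g u‖ ^ γ := by
  have hgc : Continuous fun u => ‖g u‖ ^ γ := hg.norm.rpow_const fun _ => Or.inr hγ.le
  have hcl := continuous_log_rpow hα
  set D := Real.log (Real.exp α + 2) ^ α * M ^ γ with hD
  have hi : Integrable ((Set.Icc (-2 : ℝ) 2).indicator fun _ => D) :=
    (integrable_indicator_iff measurableSet_Icc).2 (integrableOn_const (by simp))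
  have hexp : 1 < Real.exp α := Real.one_lt_exp_iff.2 hα
  refine (hi.add (h.const_mul ((1 + α) ^ α))).mono' (hcl.mul hgc).aestronglyMeasurable
    (Eventually.of_forall fun u => ?_)
  have hlog : 0 ≤ Real.log (Real.exp α + |u|) :=
    Real.log_nonneg (by linarith [abs_nonneg u])
  have hlog1 : 0 ≤ Real.log (1 + |u|) := Real.log_nonneg (by linarith [abs_nonneg u])
  rw [Real.norm_eq_abs, abs_of_nonneg (by positivity), Pi.add_apply]
  by_cases hu : u ∈ Set.Icc (-2 : ℝ) 2
  · rw [Set.indicator_of_mem hu]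
    have hu2 : |u| ≤ 2 := abs_le.2 hu
    have h1 : Real.log (Real.exp α + |u|) ^ α * ‖g u‖ ^ γ ≤ D := by
      rw [hD]
      gcongr
      · exact Real.rpow_nonneg (Real.log_nonneg (by linarith)) _
      · exact hM u
    have : 0 ≤ (1 + α) ^ α * (Real.log (1 + |u|) ^ α * ‖g u‖ ^ γ) := by positivity
    linarith
  · rw [Set.indicator_of_notMem hu, zero_add, ← mul_assoc, ← Real.mul_rpow (by positivity) hlog1]
    have hu2 : 2 < |u| := by
      rw [Set.mem_Icc, ← abs_le] at hu
      exact not_le.1 hu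
    gcongr
    have h3 : Real.exp α ≤ (1 + |u|) ^ α := by
      rw [← Real.exp_one_rpow]
      refine Real.rpow_le_rpow (Real.exp_pos 1).le ?_ hα.le
      linarith [Real.exp_one_lt_d9]
    have h1u : 1 ≤ (1 + |u|) ^ α := hexp.le.trans h3
    have h4 : Real.exp α + |u| ≤ (1 + |u|) ^ (1 + α) := by
      rw [Real.rpow_add (by positivity), Real.rpow_one]
      nlinarith [abs_nonneg u]
    calc Real.log (Real.exp α + |u|) ≤ Real.log ((1 + |u|) ^ (1 + α)) :=
          Real.log_le_log (by positivity) h4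
      _ = (1 + α) * Real.log (1 + |u|) := Real.log_rpow (by positivity) _

/-- The logarithmic condition makes a bounded function integrable, since its weight is bounded below
and `γ ≤ 1`. -/
lemma integrable_of_log_mul_rpow {g : ℝ → ℂ} (hg : Continuous g) {M α γ : ℝ}
    (hM : ∀ u, ‖g u‖ ≤ M) (hα : 0 < α) (hγ1 : γ ≤ 1)
    (h : Integrable fun u : ℝ => Real.log (Real.exp α + |u|) ^ α * ‖g u‖ ^ γ) :
    Integrable g := by
  have hM0 : 0 ≤ M := (norm_nonneg _).trans (hM 0)
  refine (h.const_mul (M ^ (1 - γ) / α ^ α)).mono' hg.aestronglyMeasurable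
    (Eventually.of_forall fun u => ?_)
  have h1 : α ≤ Real.log (Real.exp α + |u|) := by
    rw [Real.le_log_iff_exp_le (by positivity)]
    linarith [abs_nonneg u]
  have h2 : α ^ α ≤ Real.log (Real.exp α + |u|) ^ α := Real.rpow_le_rpow hα.le h1 hα.le
  rcases (norm_nonneg (g u)).eq_or_lt with h0 | h0
  · rw [← h0]
    have : 0 ≤ Real.log (Real.exp α + |u|) := hα.le.trans h1
    positivity
  have h3 : ‖g u‖ = ‖g u‖ ^ (1 - γ) * ‖g u‖ ^ γ := by
    rw [← Real.rpow_add h0]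
    simp
  have hαα : 0 < α ^ α := Real.rpow_pos_of_pos hα α
  calc ‖g u‖ = ‖g u‖ ^ (1 - γ) * ‖g u‖ ^ γ := h3
    _ ≤ M ^ (1 - γ) * ‖g u‖ ^ γ := by
        gcongr
        exact hM u
    _ = M ^ (1 - γ) / α ^ α * (α ^ α * ‖g u‖ ^ γ) := by field_simp
    _ ≤ _ := by gcongr

section

variable {φ ψ : ℝ → ℂ} {α γ : ℝ}

lemma WaveletConditions.integrable_log_scaling (h : WaveletConditions φ ψ α γ) :
    Integrable fun u : ℝ => Real.log (Real.exp α + |u|) ^ α * ‖ft φ u‖ ^ γ :=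
  integrable_log_mul_rpow h.differentiable_ft_scaling.continuous (norm_ft_le_cφ h)
    (by linarith [h.alpha_gt]) h.gamma_pos h.log_integrable_scaling

lemma WaveletConditions.integrable_log_wavelet (h : WaveletConditions φ ψ α γ) :
    Integrable fun u : ℝ => Real.log (Real.exp α + |u|) ^ α * ‖ft ψ u‖ ^ γ :=
  integrable_log_mul_rpow h.differentiable_ft_wavelet.continuous (fun u => norm_ft_le u)
    (by linarith [h.alpha_gt]) h.gamma_pos h.log_integrable_wavelet

lemma WaveletConditions.integrable_ft_scaling (h : WaveletConditions φ ψ α γ) :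
    Integrable (ft φ) :=
  integrable_of_log_mul_rpow h.differentiable_ft_scaling.continuous (norm_ft_le_cφ h)
    (by linarith [h.alpha_gt]) (by linarith [h.gamma_lt]) h.integrable_log_scaling

lemma WaveletConditions.integrable_ft_wavelet (h : WaveletConditions φ ψ α γ) :
    Integrable (ft ψ) :=
  integrable_of_log_mul_rpow h.differentiable_ft_wavelet.continuous (fun u => norm_ft_le u)
    (by linarith [h.alpha_gt]) (by linarith [h.gamma_lt]) h.integrable_log_wavelet

end

/-! ### Decay of the wavelets and sums of squares -/

lemma norm_le_integral_ft {f : ℝ → ℂ} (hc : Continuous f) (hf : Integrable f)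
    (hft : Integrable (ft f)) (x : ℝ) : ‖f x‖ ≤ (∫ u, ‖ft f u‖) / (2 * Real.pi) := by
  rw [integral_ft_mul_expo hc hf hft x, norm_mul, norm_inv, norm_mul, Complex.norm_real,
    Real.norm_of_nonneg Real.pi_pos.le, Complex.norm_two, inv_mul_eq_div]
  refine div_le_div_of_nonneg_right ((norm_integral_le_integral_norm _).trans (le_of_eq ?_))
    (by positivity)
  simp [norm_expo]

lemma hasDerivAt_expo (y u : ℝ) : HasDerivAt (expo y) (Complex.I * y * expo y u) u := by
  unfold expo
  have h1 : HasDerivAt (fun u : ℝ => (u : ℂ)) 1 u := Complex.ofRealCLM.hasDerivAt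
  have h2 := (h1.const_mul (Complex.I * (y : ℂ))).cexp
  simpa [mul_comm, mul_left_comm] using h2

/-- Decay of order `1/|y|`, by an integration by parts in the inversion formula. -/
lemma abs_mul_norm_le {f : ℝ → ℂ} (hc : Continuous f) (hf : Integrable f)
    (hft : Integrable (ft f)) (hd : Differentiable ℝ (ft f)) (hd' : Integrable (deriv (ft f)))
    (y : ℝ) : |y| * ‖f y‖ ≤ (∫ u, ‖deriv (ft f) u‖) / (2 * Real.pi) := by
  have hbd : ∀ g : ℝ → ℂ, Integrable g → Integrable fun u => g u * expo y u := fun g hg =>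
    hg.mul_bdd (c := 1) (continuous_expo y).aestronglyMeasurable
      (Eventually.of_forall fun u => (norm_expo y u).le)
  have h0 : ∫ u, (deriv (ft f) u * expo y u + ft f u * (Complex.I * y * expo y u)) = 0 := by
    refine integral_eq_zero_of_hasDerivAt_of_integrable (f := fun u => ft f u * expo y u)
      (fun u => (hd u).hasDerivAt.mul (hasDerivAt_expo y u)) ?_ (hbd _ hft)
    refine (hbd _ hd').add ?_
    refine ((hbd _ hft).const_mul (Complex.I * y)).congr (Eventually.of_forall fun u => ?_)
    simp only
    ring
  have e : ∀ u, ft f u * (Complex.I * y * expo y u) = Complex.I * y * (ft f u * expo y u) :=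
    fun u => by ring
  simp only [e] at h0
  rw [integral_add (hbd _ hd') ((hbd _ hft).const_mul _), integral_const_mul] at h0
  have h1 : Complex.I * y * f y = -((2 * (Real.pi : ℂ))⁻¹ * ∫ u, deriv (ft f) u * expo y u) := by
    rw [integral_ft_mul_expo hc hf hft y]
    linear_combination (2 * (Real.pi : ℂ))⁻¹ * h0
  have h2 : |y| * ‖f y‖ = ‖Complex.I * y * f y‖ := by
    rw [norm_mul, norm_mul, Complex.norm_I, one_mul, Complex.norm_real, Real.norm_eq_abs]
  rw [h2, h1, norm_neg, norm_mul, norm_inv, norm_mul, Complex.norm_real,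
    Real.norm_of_nonneg Real.pi_pos.le, Complex.norm_two, inv_mul_eq_div]
  refine div_le_div_of_nonneg_right ((norm_integral_le_integral_norm _).trans (le_of_eq ?_))
    (by positivity)
  simp [norm_expo]

lemma B₁_nonneg (f : ℝ → ℂ) {T : ℝ} (hT : 0 ≤ T) : 0 ≤ B₁ f T := by
  have h1 : 0 ≤ ∫ u, ‖deriv (ft f) u‖ := integral_nonneg fun _ => norm_nonneg _
  have h2 : 0 ≤ ∫ u, ‖ft f u‖ := integral_nonneg fun _ => norm_nonneg _
  unfold B₁
  positivity

/-- Decay of the coefficients in `k`, uniformly for `t ∈ [0, T]`: `|k| ≤ |2^j t - k| + 2^j T`. -/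
lemma abs_mul_norm_shift_le {f : ℝ → ℂ} (hc : Continuous f) (hf : Integrable f)
    (hft : Integrable (ft f)) (hd : Differentiable ℝ (ft f)) (hd' : Integrable (deriv (ft f)))
    {T t : ℝ} (ht : t ∈ Set.Icc 0 T) (j : ℕ) (k : ℤ) :
    |(k : ℝ)| * ‖f (2 ^ j * t - k)‖ ≤ 2 ^ j * B₁ f T := by
  have h1 := abs_mul_norm_le hc hf hft hd hd' (2 ^ j * t - k)
  have h2 := norm_le_integral_ft hc hf hft (2 ^ j * t - k)
  have hp : (1 : ℝ) ≤ 2 ^ j := one_le_pow₀ (by norm_num)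
  have h3 : |(k : ℝ)| ≤ |2 ^ j * t - k| + 2 ^ j * T := by
    have h4 := abs_sub_abs_le_abs_sub (k : ℝ) (2 ^ j * t)
    rw [abs_sub_comm, abs_of_nonneg (mul_nonneg (by positivity) ht.1)] at h4
    have : (2 : ℝ) ^ j * t ≤ 2 ^ j * T := by gcongr; exact ht.2
    linarith
  have hT : 0 ≤ T := ht.1.trans ht.2
  have i1 : 0 ≤ ∫ u, ‖deriv (ft f) u‖ := integral_nonneg fun _ => norm_nonneg _
  calc |(k : ℝ)| * ‖f (2 ^ j * t - k)‖
      ≤ (|2 ^ j * t - k| + 2 ^ j * T) * ‖f (2 ^ j * t - k)‖ := by gcongr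
    _ = |2 ^ j * t - k| * ‖f (2 ^ j * t - k)‖ + 2 ^ j * T * ‖f (2 ^ j * t - k)‖ := by ring
    _ ≤ 2 ^ j * ((∫ u, ‖deriv (ft f) u‖) / (2 * Real.pi)) +
        2 ^ j * T * ((∫ u, ‖ft f u‖) / (2 * Real.pi)) := by
      refine add_le_add (h1.trans (le_mul_of_one_le_left (by positivity) hp)) ?_
      gcongr
    _ = 2 ^ j * B₁ f T := by
      unfold B₁
      ring

lemma tsum_norm_sq_le {a : ℤ → ℂ} {s : ℕ → ℝ} (hs : Summable s) (h0 : a 0 = 0)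
    (h1 : ∀ m : ℕ, ‖a (m + 1)‖ ^ 2 ≤ s m) (h2 : ∀ m : ℕ, ‖a (-(m + 1))‖ ^ 2 ≤ s m) :
    ∑' k, ‖a k‖ ^ 2 ≤ 2 * ∑' m, s m := by
  have s1 : Summable fun m : ℕ => ‖a (m + 1)‖ ^ 2 :=
    Summable.of_nonneg_of_le (fun _ => by positivity) h1 hs
  have s2 : Summable fun m : ℕ => ‖a (-(m + 1))‖ ^ 2 :=
    Summable.of_nonneg_of_le (fun _ => by positivity) h2 hs
  rw [tsum_of_add_one_of_neg_add_one (f := fun k => ‖a k‖ ^ 2) s1 s2, h0]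
  have := s1.tsum_le_tsum h1 hs
  have := s2.tsum_le_tsum h2 hs
  simp only [norm_zero]
  linarith

lemma norm_sq_le_of_mul_le {D : ℝ} {x : ℂ} {k : ℤ} {m : ℕ} (hk : |(k : ℝ)| = m + 1)
    (h : |(k : ℝ)| * ‖x‖ ≤ D) : ‖x‖ ^ 2 ≤ D ^ 2 * (1 / ((m : ℝ) + 1) ^ 2) := by
  have hm : (0 : ℝ) < (m : ℝ) + 1 := by positivity
  rw [hk] at h
  have h1 := pow_le_pow_left₀ (by positivity) h 2
  rw [mul_pow] at h1
  rw [mul_one_div, le_div_iff₀ (by positivity)]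
  linarith

lemma abs_cast_add_one (m : ℕ) : |(((m : ℤ) + 1 : ℤ) : ℝ)| = m + 1 := by
  push_cast
  exact abs_of_nonneg (by positivity)

lemma abs_cast_neg_add_one (m : ℕ) : |((-((m : ℤ) + 1) : ℤ) : ℝ)| = m + 1 := by
  push_cast
  rw [abs_neg]
  exact abs_of_nonneg (by positivity)

lemma summable_one_div_add_one_sq : Summable fun m : ℕ => 1 / ((m : ℝ) + 1) ^ 2 := by
  have h := (summable_nat_add_iff 1).2 (Real.summable_one_div_nat_pow.2 (by norm_num : 1 < 2))
  simpa using h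

lemma tsum_norm_sq_le_zeta2 {a : ℤ → ℂ} {D : ℝ} (h0 : a 0 = 0)
    (h : ∀ k : ℤ, |(k : ℝ)| * ‖a k‖ ≤ D) : ∑' k, ‖a k‖ ^ 2 ≤ 2 * (D ^ 2 * zeta2) := by
  have := tsum_norm_sq_le (a := a) (summable_one_div_add_one_sq.mul_left (D ^ 2)) h0
    (fun m => norm_sq_le_of_mul_le (abs_cast_add_one m) (h _))
    (fun m => norm_sq_le_of_mul_le (abs_cast_neg_add_one m) (h _))
  rwa [tsum_mul_left] at this

/-- The tail of `∑ 1/m²`, by telescoping `1/m - 1/(m + 1)`. -/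
lemma tsum_ite_one_div_sq_le {K : ℕ} (hK : 1 ≤ K) :
    (Summable fun m : ℕ => if K ≤ m then 1 / ((m : ℝ) + 1) ^ 2 else 0) ∧
    ∑' m : ℕ, (if K ≤ m then 1 / ((m : ℝ) + 1) ^ 2 else 0) ≤ 1 / (K : ℝ) := by
  have hK0 : (0 : ℝ) < K := by exact_mod_cast hK
  have hnn : ∀ m : ℕ, 0 ≤ (if K ≤ m then 1 / ((m : ℝ) + 1) ^ 2 else 0) := fun m => by
    split_ifs <;> positivity
  have hle : ∀ n : ℕ, ∑ m ∈ Finset.range n, (if K ≤ m then 1 / ((m : ℝ) + 1) ^ 2 else 0) ≤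
      1 / (K : ℝ) := by
    intro n
    have hd : ∀ m : ℕ, (if K ≤ m then 1 / ((m : ℝ) + 1) ^ 2 else 0) ≤
        1 / (max (K : ℝ) (m : ℝ)) - 1 / (max (K : ℝ) ((m + 1 : ℕ) : ℝ)) := by
      intro m
      split_ifs with hm
      · have hm' : (K : ℝ) ≤ m := by exact_mod_cast hm
        have hm0 : (0 : ℝ) < m := hK0.trans_le hm'
        rw [max_eq_right hm', max_eq_right (by push_cast; linarith)]
        push_cast
        rw [div_sub_div _ _ hm0.ne' (by positivity), div_le_div_iff₀ (by positivity) (by positivity)]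
        nlinarith
      · have : max (K : ℝ) (m : ℝ) ≤ max (K : ℝ) ((m + 1 : ℕ) : ℝ) :=
          max_le_max le_rfl (by push_cast; linarith)
        have h0 : 0 < max (K : ℝ) (m : ℝ) := lt_max_of_lt_left hK0
        exact sub_nonneg.2 (one_div_le_one_div_of_le h0 this)
    refine (Finset.sum_le_sum fun m _ => hd m).trans ?_
    rw [Finset.sum_range_sub' (fun m : ℕ => 1 / (max (K : ℝ) (m : ℝ))) n]
    have : 0 ≤ 1 / (max (K : ℝ) (n : ℝ)) := by positivity
    simp only [Nat.cast_zero, max_eq_left hK0.le]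
    linarith
  exact ⟨summable_of_sum_range_le hnn hle, Real.tsum_le_of_sum_range_le hnn hle⟩

/-- The coefficients outside of the window `|k| ≤ K`. -/
noncomputable def tailCoeff (K : ℕ) (a : ℤ → ℂ) (k : ℤ) : ℂ :=
  if k ∈ Finset.Icc (-(K : ℤ)) K then 0 else a k

/-- The coefficients in the window `|k| ≤ K`. -/
noncomputable def headCoeff (K : ℕ) (a : ℤ → ℂ) (k : ℤ) : ℂ :=
  if k ∈ Finset.Icc (-(K : ℤ)) K then a k else 0

lemma summable_tailCoeff {a : ℤ → ℂ} (ha : Summable fun k => ‖a k‖) (K : ℕ) :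
    Summable fun k => ‖tailCoeff K a k‖ := by
  refine Summable.of_nonneg_of_le (fun _ => norm_nonneg _) (fun k => ?_) ha
  unfold tailCoeff
  split_ifs
  · simp
  · exact le_rfl

lemma summable_headCoeff (a : ℤ → ℂ) (K : ℕ) :
    Summable fun k => ‖headCoeff K a k‖ := by
  refine summable_of_ne_finset_zero (s := Finset.Icc (-(K : ℤ)) K) fun k hk => ?_
  rw [headCoeff, if_neg hk, norm_zero]

lemma headCoeff_add_tailCoeff (K : ℕ) (a : ℤ → ℂ) (k : ℤ) :
    headCoeff K a k + tailCoeff K a k = a k := by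
  unfold headCoeff tailCoeff
  split_ifs <;> simp

lemma tsum_norm_sq_tailCoeff_le {a : ℤ → ℂ} {D : ℝ} {K : ℕ} (hK : 1 ≤ K)
    (h : ∀ k : ℤ, |(k : ℝ)| * ‖a k‖ ≤ D) :
    ∑' k, ‖tailCoeff K a k‖ ^ 2 ≤ 2 * D ^ 2 / K := by
  obtain ⟨hs, hle⟩ := tsum_ite_one_div_sq_le hK
  have := tsum_norm_sq_le (a := tailCoeff K a) (hs.mul_left (D ^ 2))
    (by rw [tailCoeff, if_pos (by simp)])
    (fun m => by
      unfold tailCoeff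
      split_ifs with h1 h2 h2
      · rw [norm_zero, zero_pow two_ne_zero]; positivity
      · simp
      · exact norm_sq_le_of_mul_le (abs_cast_add_one m) (h _)
      · rw [Finset.mem_Icc] at h1
        omega)
    (fun m => by
      unfold tailCoeff
      split_ifs with h1 h2 h2
      · rw [norm_zero, zero_pow two_ne_zero]; positivity
      · simp
      · exact norm_sq_le_of_mul_le (abs_cast_neg_add_one m) (h _)
      · rw [Finset.mem_Icc] at h1
        omega)
  rw [tsum_mul_left] at this
  refine this.trans ?_
  calc 2 * (D ^ 2 * ∑' m : ℕ, (if K ≤ m then 1 / ((m : ℝ) + 1) ^ 2 else 0))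
      ≤ 2 * (D ^ 2 * (1 / K)) := by gcongr
    _ = 2 * D ^ 2 / K := by ring

/-! ### Zeta values -/

lemma zeta2_eq : zeta2 = Real.pi ^ 2 / 6 := by
  unfold zeta2
  have h := hasSum_zeta_two
  rw [← hasSum_nat_add_iff' 1] at h
  simpa using h.tsum_eq

/-- Lower bound by comparison with `∫ x^{-3/2} dx` from `2` on, in the form of the telescoping
differences of `2/√m`. It yields `4π ≤ 6 ζ(3/2)` and `(8π/3) ζ(2) ≤ 3 ζ(3/2)²`, which relate the
bounds obtained from the periods to the constants of the theorem. -/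
lemma zeta32_ge : 1 + √2 ≤ zeta32 := by
  have hs : Summable fun m : ℕ => 1 / ((m : ℝ) + 1) ^ (3 / 2 : ℝ) := by
    have h := (summable_nat_add_iff 1).2
      (Real.summable_one_div_nat_rpow.2 (by norm_num : (1 : ℝ) < 3 / 2))
    simpa using h
  have hterm : ∀ m : ℕ, 2 * (1 / √((m : ℝ) + 2) - 1 / √((m : ℝ) + 3)) ≤
      1 / ((m : ℝ) + 2) ^ (3 / 2 : ℝ) := by
    intro m
    have hx : 0 < √((m : ℝ) + 2) := Real.sqrt_pos.2 (by positivity)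
    have hy : 0 < √((m : ℝ) + 3) := Real.sqrt_pos.2 (by positivity)
    have hx2 : √((m : ℝ) + 2) ^ 2 = (m : ℝ) + 2 := Real.sq_sqrt (by positivity)
    have hy2 : √((m : ℝ) + 3) ^ 2 = (m : ℝ) + 3 := Real.sq_sqrt (by positivity)
    have hxy : √((m : ℝ) + 2) ≤ √((m : ℝ) + 3) := Real.sqrt_le_sqrt (by linarith)
    have e : ((m : ℝ) + 2) ^ (3 / 2 : ℝ) = √((m : ℝ) + 2) ^ 3 := by
      rw [Real.sqrt_eq_rpow, ← Real.rpow_natCast, ← Real.rpow_mul (by positivity)]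
      norm_num
    rw [e]
    set x := √((m : ℝ) + 2)
    set y := √((m : ℝ) + 3)
    have e2 : 2 * (1 / x - 1 / y) = 2 / (x * y * (x + y)) := by
      field_simp
      nlinarith
    rw [e2, div_le_div_iff₀ (by positivity) (by positivity)]
    have : 2 * x ^ 2 ≤ y * (x + y) := by nlinarith
    nlinarith
  have htele : Tendsto (fun n : ℕ => ∑ m ∈ Finset.range n,
      2 * (1 / √((m : ℝ) + 2) - 1 / √((m : ℝ) + 3))) atTop (𝓝 √2) := by
    have e : ∀ n : ℕ, ∑ m ∈ Finset.range n,
        2 * (1 / √((m : ℝ) + 2) - 1 / √((m : ℝ) + 3)) = √2 - 2 * (1 / √((n : ℝ) + 2)) := by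
      intro n
      have h2 : 2 * (1 / √2) = √2 := by
        rw [mul_one_div]
        exact Real.div_sqrt
      induction n with
      | zero =>
        simp only [Finset.range_zero, Finset.sum_empty, Nat.cast_zero, zero_add]
        rw [h2, sub_self]
      | succ n ih =>
        rw [Finset.sum_range_succ, ih]
        push_cast
        rw [show (n : ℝ) + 1 + 2 = n + 3 by ring]
        ring
    simp only [e]
    have h3 : Tendsto (fun n : ℕ => 1 / √((n : ℝ) + 2)) atTop (𝓝 0) :=
      (Real.tendsto_sqrt_atTop.comp
        (tendsto_atTop_add_const_right _ 2 tendsto_natCast_atTop_atTop)).const_div_atTop 1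
    simpa using (h3.const_mul 2).const_sub √2
  have h5 : √2 ≤ ∑' m : ℕ, 1 / ((m : ℝ) + 2) ^ (3 / 2 : ℝ) := by
    have hs' : Summable fun m : ℕ => 1 / ((m : ℝ) + 2) ^ (3 / 2 : ℝ) := by
      refine ((summable_nat_add_iff 1).2 hs).congr fun m => ?_
      push_cast
      rw [show (m : ℝ) + 1 + 1 = m + 2 by ring]
    refine le_of_tendsto htele (Eventually.of_forall fun n => ?_)
    exact (Finset.sum_le_sum fun m _ => hterm m).trans
      (hs'.sum_le_tsum _ fun _ _ => by positivity)
  unfold zeta32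
  rw [hs.tsum_eq_zero_add]
  have h6 : ∀ m : ℕ, 1 / (((m + 1 : ℕ) : ℝ) + 1) ^ (3 / 2 : ℝ) =
      1 / ((m : ℝ) + 2) ^ (3 / 2 : ℝ) := fun m => by
    push_cast
    rw [show (m : ℝ) + 1 + 1 = m + 2 by ring]
  simp only [h6]
  simpa using h5

/-! ### The mean-square error -/

lemma rpow_half_sq (n : ℕ) : ((2 : ℝ) ^ ((n : ℝ) / 2)) ^ 2 = 2 ^ n := by
  rw [← Real.rpow_natCast, ← Real.rpow_mul (by norm_num)]
  rw [show (n : ℝ) / 2 * ((2 : ℕ) : ℝ) = n by push_cast; ring, Real.rpow_natCast]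

lemma A₁ψ_nonneg (ψ : ℝ → ℂ) (S : ℝ → ℝ) : 0 ≤ A₁ψ ψ S := by
  have : 0 ≤ ∫ z : ℝ, |S z| * |z| ^ 4 := integral_nonneg fun z => by positivity
  unfold A₁ψ
  positivity

lemma Aψ_nonneg (ψ : ℝ → ℂ) (S : ℝ → ℝ) : 0 ≤ Aψ ψ S := by
  have : 0 ≤ ∫ z : ℝ, (|deriv S z| * |z| ^ 4 + 2 * |S z| * |z| ^ 3) :=
    integral_nonneg fun z => by positivity
  unfold Aψ
  positivity

lemma A₁φ_nonneg (φ : ℝ → ℂ) (S : ℝ → ℝ) : 0 ≤ A₁φ φ S := by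
  have : 0 ≤ ∫ z : ℝ, |S z| := integral_nonneg fun z => by positivity
  unfold A₁φ
  positivity

lemma Aφ_nonneg (φ : ℝ → ℂ) (S : ℝ → ℝ) : 0 ≤ Aφ φ S := by
  have h1 : 0 ≤ ∫ z : ℝ, |S z| := integral_nonneg fun z => by positivity
  have h2 : 0 ≤ ∫ z : ℝ, |deriv S z| := integral_nonneg fun z => by positivity
  have h3 : 0 ≤ cφ φ := Real.iSup_nonneg fun _ => norm_nonneg _
  have h4 : 0 ≤ cφ' φ := Real.iSup_nonneg fun _ => norm_nonneg _
  unfold Aφ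
  positivity

lemma zeta32_pos : 0 < zeta32 := by
  have := zeta32_ge
  have := Real.sqrt_nonneg 2
  linarith

lemma zeta2_pos : 0 < zeta2 := by
  rw [zeta2_eq]
  positivity

section

variable {φ ψ : ℝ → ℂ} {α γ T : ℝ} {R : ℝ → ℂ} {S : ℝ → ℝ}

/-- The coefficients at scale `j` and time `t`. -/
def shiftCoeff (f : ℝ → ℂ) (j : ℕ) (t : ℝ) (k : ℤ) : ℂ := f (2 ^ j * t - k)

lemma summable_shiftCoeff {f : ℝ → ℂ} (hf : AssumptionS f) (hc : Continuous f) (j : ℕ) (t : ℝ) :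
    Summable fun k => ‖shiftCoeff f j t k‖ := hf.summable hc _

lemma constA_nonneg (ψ : ℝ → ℂ) (S : ℝ → ℝ) (hT : 0 ≤ T) : 0 ≤ constA ψ S T :=
  mul_nonneg (B₁_nonneg ψ hT) (Real.sqrt_nonneg _)

lemma constC_nonneg (ψ : ℝ → ℂ) (S : ℝ → ℝ) (T : ℝ) : 0 ≤ constC ψ S T :=
  mul_nonneg (add_nonneg two_pos.le (Real.sqrt_nonneg _)) (Real.sqrt_nonneg _)

/-- The tail `|k| > K` of wavelet level `j`, of order `2^{-j/2} K^{-1/2}`. -/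
lemma eLpNorm_tail_wavelet_le (hwav : IsWaveletPair φ ψ) (h : WaveletConditions φ ψ α γ)
    (hR : IsSpectralDensity R S) (hS : SpectralConditions S) {t : ℝ} (ht : t ∈ Set.Icc 0 T)
    (j : ℕ) {K : ℕ} (hK : 1 ≤ K) :
    eLpNorm (levelFreq ψ j (tailCoeff K (shiftCoeff ψ j t))) 2 (spectralMeasure S) ≤
      ENNReal.ofReal (constA ψ S T / ((2 : ℝ) ^ ((j : ℝ) / 2) * √(K : ℝ))) := by
  have hT : 0 ≤ T := ht.1.trans ht.2
  have hs := summable_tailCoeff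
    (summable_shiftCoeff hwav.assumptionS_wavelet hwav.continuous_wavelet j t) K
  have h1 := (lintegral_levelFreq_wavelet_le h hR hS j hs).1
  have hsum : ∑' k, ‖tailCoeff K (shiftCoeff ψ j t) k‖ ^ 2 ≤ 2 * (2 ^ j * B₁ ψ T) ^ 2 / K :=
    tsum_norm_sq_tailCoeff_le hK (abs_mul_norm_shift_le hwav.continuous_wavelet
      (hwav.assumptionS_wavelet.integrable hwav.continuous_wavelet) h.integrable_ft_wavelet
      h.differentiable_ft_wavelet h.integrable_deriv_ft_wavelet ht j)
  have hA1 := A₁ψ_nonneg ψ S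
  have hA := Aψ_nonneg ψ S
  have hp1 : (1 : ℝ) ≤ 2 ^ j := one_le_pow₀ (by norm_num)
  have hcA := constA_nonneg ψ S hT
  have hrp := rpow_half_sq j
  have hK0 : (0 : ℝ) < K := by exact_mod_cast hK
  refine (eLpNorm_two_le_of_lintegral_le (by positivity) h1).trans
    (ENNReal.ofReal_le_ofReal (Real.sqrt_le_iff.2 ⟨by positivity, ?_⟩))
  rw [div_pow, mul_pow, hrp, Real.sq_sqrt hK0.le]
  have hcA2 : constA ψ S T ^ 2 = B₁ ψ T ^ 2 * (6 * Aψ ψ S * zeta32 + 4 * A₁ψ ψ S) := by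
    unfold constA
    rw [mul_pow, Real.sq_sqrt]
    have := zeta32_pos
    positivity
  rw [hcA2]
  set p : ℝ := 2 ^ j
  have hp0 : 0 < p := by positivity
  calc (A₁ψ ψ S / 4 / p ^ 4 + Real.pi * Aψ ψ S / p ^ 3) *
        ∑' k, ‖tailCoeff K (shiftCoeff ψ j t) k‖ ^ 2
      ≤ (A₁ψ ψ S / 4 / p ^ 4 + Real.pi * Aψ ψ S / p ^ 3) * (2 * (p * B₁ ψ T) ^ 2 / K) := by
        gcongr
    _ = B₁ ψ T ^ 2 * (A₁ψ ψ S / (2 * p) + 2 * Real.pi * Aψ ψ S) / (p * K) := by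
        field_simp
        ring
    _ ≤ _ := by
        refine div_le_div_of_nonneg_right (mul_le_mul_of_nonneg_left ?_ (sq_nonneg _)) (by positivity)
        have e1 : A₁ψ ψ S / (2 * p) ≤ 4 * A₁ψ ψ S := by
          rw [div_le_iff₀ (by positivity)]
          nlinarith
        -- the sum over the periods gives `2π` where `constA` has `6 ζ(3/2)`
        have e2 : 2 * Real.pi ≤ 6 * zeta32 := by
          have := zeta32_ge
          have := Real.pi_lt_d2
          have : 1 ≤ √2 := Real.one_le_sqrt.2 (by norm_num)
          linarith
        nlinarith

/-- The constant bounding `2^{j/2}` times the norm of a full level. -/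
noncomputable def levelConst (ψ : ℝ → ℂ) (S : ℝ → ℝ) (T : ℝ) : ℝ :=
  √(3 * Aψ ψ S * B₁ ψ T ^ 2 * zeta32 ^ 2 +
    (A₁ψ ψ S * B₁ ψ T ^ 2 + (∫ u, ‖ft ψ u‖) * Aψ ψ S * B₁ ψ T / Real.pi) * zeta2 +
    (∫ u, ‖ft ψ u‖) ^ 2 * A₁ψ ψ S / (32 * Real.pi ^ 2))

/-- From `(x + y)² ≤ 4x² + (4/3) y²`. -/
lemma add_le_sqrt_of_sq {a b V : ℝ} (ha : 0 ≤ a) (hb : 0 ≤ b) (h : 4 * a + 4 / 3 * b ≤ V) :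
    √a + √b ≤ √V := by
  refine Real.le_sqrt_of_sq_le (le_trans ?_ h)
  nlinarith [Real.sq_sqrt ha, Real.sq_sqrt hb, sq_nonneg (3 * √a - √b)]

/-- A full wavelet level. The coefficient `k = 0`, which is merely bounded, is separated from the
others, which decay like `1/|k|`; the weight `2^{-4j}` with `j ≥ 1` absorbs the constant `4` of
`add_le_sqrt_of_sq`. -/
lemma eLpNorm_fullLevel_wavelet_le (hwav : IsWaveletPair φ ψ) (h : WaveletConditions φ ψ α γ)
    (hR : IsSpectralDensity R S) (hS : SpectralConditions S) {t : ℝ} (ht : t ∈ Set.Icc 0 T)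
    {j : ℕ} (hj : 1 ≤ j) :
    eLpNorm (fullLevel ψ j t) 2 (spectralMeasure S) ≤
      ENNReal.ofReal (levelConst ψ S T / (2 : ℝ) ^ ((j : ℝ) / 2)) := by
  have hT : 0 ≤ T := ht.1.trans ht.2
  have hci := hwav.assumptionS_wavelet.integrable hwav.continuous_wavelet
  have hsum0 := summable_shiftCoeff hwav.assumptionS_wavelet hwav.continuous_wavelet j t
  have hs := summable_tailCoeff hsum0 0
  have hs' := summable_headCoeff (shiftCoeff ψ j t) 0
  have hdec := abs_mul_norm_shift_le hwav.continuous_wavelet hci h.integrable_ft_wavelet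
      h.differentiable_ft_wavelet h.integrable_deriv_ft_wavelet ht j
  have hnum : ∀ k : ℤ, k ≠ 0 → k ∉ Finset.Icc (-((0 : ℕ) : ℤ)) ((0 : ℕ) : ℤ) := fun k hk => by
    rw [Finset.mem_Icc]
    push_cast
    omega
  have hA1 := A₁ψ_nonneg ψ S
  have hA := Aψ_nonneg ψ S
  have hB := B₁_nonneg ψ hT
  have hz2 := zeta2_pos
  have hz3 := zeta32_pos
  set c2 := ∫ u, ‖ft ψ u‖ with hc2
  have hc20 : 0 ≤ c2 := integral_nonneg fun _ => norm_nonneg _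
  -- the central coefficient
  have hhead : ∀ v, ‖trig (headCoeff 0 (shiftCoeff ψ j t)) v‖ ≤ c2 / (2 * Real.pi) := by
    intro v
    refine (norm_trig_le hs' v).trans ?_
    rw [tsum_eq_single 0 fun k hk => by rw [headCoeff, if_neg (hnum k hk), norm_zero]]
    rw [headCoeff, if_pos (by simp)]
    exact norm_le_integral_ft hwav.continuous_wavelet hci h.integrable_ft_wavelet _
  have h1 := (lintegral_levelFreq_wavelet_le h hR hS j hs').2 _ hhead
  have h2 := (lintegral_levelFreq_wavelet_le h hR hS j hs).1
  have hsum : ∑' k, ‖tailCoeff 0 (shiftCoeff ψ j t) k‖ ^ 2 ≤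
      2 * ((2 ^ j * B₁ ψ T) ^ 2 * zeta2) := by
    refine tsum_norm_sq_le_zeta2 (by rw [tailCoeff, if_pos (by simp)]) fun k => ?_
    rcases eq_or_ne k 0 with rfl | hk
    · simp only [Int.cast_zero, abs_zero, zero_mul]
      positivity
    · rw [tailCoeff, if_neg (hnum k hk)]
      exact hdec k
  have hp2 : (2 : ℝ) ≤ 2 ^ j := by
    calc (2 : ℝ) = 2 ^ 1 := by norm_num
      _ ≤ 2 ^ j := pow_le_pow_right₀ (by norm_num) hj
  have hrp := rpow_half_sq j
  have e : fullLevel ψ j t = levelFreq ψ j (headCoeff 0 (shiftCoeff ψ j t)) +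
      levelFreq ψ j (tailCoeff 0 (shiftCoeff ψ j t)) := by
    ext z
    rw [Pi.add_apply]
    unfold fullLevel levelFreq
    rw [← mul_add, ← trig_add hs' hs]
    simp only [headCoeff_add_tailCoeff]
    rfl
  have hc := h.differentiable_ft_wavelet.continuous
  rw [e]
  refine (eLpNorm_add_le (continuous_levelFreq hc hs' j).aestronglyMeasurable
    (continuous_levelFreq hc hs j).aestronglyMeasurable (by norm_num)).trans ?_
  refine (add_le_add (eLpNorm_two_le_of_lintegral_le (by positivity) h1)
    (eLpNorm_two_le_of_lintegral_le (by positivity) h2)).trans ?_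
  rw [← ENNReal.ofReal_add (Real.sqrt_nonneg _) (Real.sqrt_nonneg _)]
  refine ENNReal.ofReal_le_ofReal ?_
  have e2 : levelConst ψ S T / (2 : ℝ) ^ ((j : ℝ) / 2) =
      √((3 * Aψ ψ S * B₁ ψ T ^ 2 * zeta32 ^ 2 +
        (A₁ψ ψ S * B₁ ψ T ^ 2 + c2 * Aψ ψ S * B₁ ψ T / Real.pi) * zeta2 +
        c2 ^ 2 * A₁ψ ψ S / (32 * Real.pi ^ 2)) / 2 ^ j) := by
    unfold levelConst
    rw [← hrp, Real.sqrt_div (by positivity), Real.sqrt_sq (by positivity)]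
  rw [e2]
  refine add_le_sqrt_of_sq (by positivity) (by positivity) ?_
  set p : ℝ := 2 ^ j
  have hp0 : 0 < p := by positivity
  set A := Aψ ψ S
  set A1 := A₁ψ ψ S
  set B := B₁ ψ T
  have k1 : 4 * (A1 / 4 / p ^ 4 * (c2 / (2 * Real.pi)) ^ 2) ≤
      c2 ^ 2 * A1 / (32 * Real.pi ^ 2) / p := by
    have : 4 * (A1 / 4 / p ^ 4 * (c2 / (2 * Real.pi)) ^ 2) =
        c2 ^ 2 * A1 / (4 * Real.pi ^ 2 * p ^ 4) := by
      field_simp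
      ring
    rw [this, div_div]
    refine div_le_div_of_nonneg_left (by positivity) (by positivity) ?_
    have hp3 : (8 : ℝ) ≤ p ^ 3 := by
      have := pow_le_pow_left₀ (by norm_num) hp2 3
      linarith
    have : 4 * Real.pi ^ 2 * p ^ 4 = (4 * Real.pi ^ 2 * p) * p ^ 3 := by ring
    rw [this]
    have h0 : 0 ≤ 4 * Real.pi ^ 2 * p := by positivity
    nlinarith
  have k2 : 4 / 3 * ((A1 / 4 / p ^ 4 + Real.pi * A / p ^ 3) *
      ∑' k, ‖tailCoeff 0 (shiftCoeff ψ j t) k‖ ^ 2) ≤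
      (A1 * B ^ 2 * zeta2 + 3 * A * B ^ 2 * zeta32 ^ 2) / p := by
    calc 4 / 3 * ((A1 / 4 / p ^ 4 + Real.pi * A / p ^ 3) *
          ∑' k, ‖tailCoeff 0 (shiftCoeff ψ j t) k‖ ^ 2)
        ≤ 4 / 3 * ((A1 / 4 / p ^ 4 + Real.pi * A / p ^ 3) * (2 * ((p * B) ^ 2 * zeta2))) := by
          gcongr
      _ = (2 / 3 * A1 / p * B ^ 2 * zeta2 + 8 / 3 * Real.pi * zeta2 * A * B ^ 2) / p := by
          field_simp
          ring
      _ ≤ _ := by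
          gcongr ?_ / p
          have m1 : 2 / 3 * A1 / p * B ^ 2 * zeta2 ≤ A1 * B ^ 2 * zeta2 := by
            gcongr
            rw [div_le_iff₀ hp0]
            nlinarith
          -- `ζ(2) = π²/6` and `ζ(3/2) ≥ 2.4`
          have m2 : 8 / 3 * Real.pi * zeta2 ≤ 3 * zeta32 ^ 2 := by
            rw [zeta2_eq]
            have hpi := Real.pi_lt_d2
            have hpi0 := Real.pi_pos
            have hz : (2.4 : ℝ) ≤ zeta32 := by
              have := zeta32_ge
              have : (1.4 : ℝ) ≤ √2 := Real.le_sqrt_of_sq_le (by norm_num)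
              linarith
            have : Real.pi ^ 3 ≤ 3.15 ^ 3 := pow_le_pow_left₀ hpi0.le hpi.le 3
            nlinarith
          have m3 : 8 / 3 * Real.pi * zeta2 * A * B ^ 2 ≤ 3 * A * B ^ 2 * zeta32 ^ 2 := by
            have h0 : 0 ≤ A * B ^ 2 := by positivity
            nlinarith
          linarith
  -- the mixed summand of the constant is not needed
  have k3 : 0 ≤ c2 * A * B / Real.pi * zeta2 / p := by positivity
  have k4 : (3 * A * B ^ 2 * zeta32 ^ 2 + (A1 * B ^ 2 + c2 * A * B / Real.pi) * zeta2 +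
      c2 ^ 2 * A1 / (32 * Real.pi ^ 2)) / p = (A1 * B ^ 2 * zeta2 + 3 * A * B ^ 2 * zeta32 ^ 2) / p +
      c2 * A * B / Real.pi * zeta2 / p + c2 ^ 2 * A1 / (32 * Real.pi ^ 2) / p := by ring
  rw [k4]
  linarith

/-- The tail `|k| > K` of the scaling level, from decay of order `D/|k|` of the coefficients. -/
lemma eLpNorm_tail_scaling_le (hwav : IsWaveletPair φ ψ) (h : WaveletConditions φ ψ α γ)
    (hR : IsSpectralDensity R S) (hS : SpectralConditions S) {t D : ℝ}
    (hD : ∀ k : ℤ, |(k : ℝ)| * ‖φ (2 ^ 0 * t - k)‖ ≤ D) {K : ℕ} (hK : 1 ≤ K) :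
    eLpNorm (levelFreq φ 0 (tailCoeff K (shiftCoeff φ 0 t))) 2 (spectralMeasure S) ≤
      ENNReal.ofReal (D * √(6 * Aφ φ S * zeta32 + 4 * A₁φ φ S) / √(K : ℝ)) := by
  have hs := summable_tailCoeff
    (summable_shiftCoeff hwav.assumptionS_scaling hwav.continuous_scaling 0 t) K
  have h1 := lintegral_levelFreq_scaling_le h hR hS hs
  have hsum : ∑' k, ‖tailCoeff K (shiftCoeff φ 0 t) k‖ ^ 2 ≤ 2 * D ^ 2 / K :=
    tsum_norm_sq_tailCoeff_le hK hD
  have hA1 := A₁φ_nonneg φ S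
  have hA := Aφ_nonneg φ S
  have hz := zeta32_pos
  have hD0 : 0 ≤ D := le_trans (by positivity) (hD 0)
  have hK0 : (0 : ℝ) < K := by exact_mod_cast hK
  refine (eLpNorm_two_le_of_lintegral_le (by positivity) h1).trans
    (ENNReal.ofReal_le_ofReal (Real.sqrt_le_iff.2 ⟨by positivity, ?_⟩))
  rw [div_pow, mul_pow, Real.sq_sqrt (by positivity), Real.sq_sqrt hK0.le]
  calc (A₁φ φ S + 2 * Real.pi * Aφ φ S) * ∑' k, ‖tailCoeff K (shiftCoeff φ 0 t) k‖ ^ 2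
      ≤ (A₁φ φ S + 2 * Real.pi * Aφ φ S) * (2 * D ^ 2 / K) := by gcongr
    _ = D ^ 2 * (2 * A₁φ φ S + 4 * Real.pi * Aφ φ S) / K := by ring
    _ ≤ _ := by
        refine div_le_div_of_nonneg_right (mul_le_mul_of_nonneg_left ?_ (sq_nonneg _)) hK0.le
        have e2 : 4 * Real.pi ≤ 6 * zeta32 := by
          have := zeta32_ge
          have := Real.pi_lt_d2
          have : (1.4 : ℝ) ≤ √2 := Real.le_sqrt_of_sq_le (by norm_num)
          linarith
        nlinarith

/-- The constant in front of `1/√k₀'`. If the derivative of `φ̂` is not integrable, the decay of `φ`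
comes from its radial majorant instead. -/
lemma exists_const_tail_scaling (hwav : IsWaveletPair φ ψ) (h : WaveletConditions φ ψ α γ)
    (hR : IsSpectralDensity R S) (hS : SpectralConditions S) (hT : 0 ≤ T) :
    ∃ B : ℝ, 0 ≤ B ∧ (Integrable (deriv (ft φ)) → B = constB φ S T) ∧
      ∀ t ∈ Set.Icc 0 T, ∀ K : ℕ, 1 ≤ K →
        eLpNorm (levelFreq φ 0 (tailCoeff K (shiftCoeff φ 0 t))) 2 (spectralMeasure S) ≤
          ENNReal.ofReal (B / √(K : ℝ)) := by
  have hc := hwav.continuous_scaling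
  have hi := hwav.assumptionS_scaling.integrable hc
  by_cases hd : Integrable (deriv (ft φ))
  · refine ⟨constB φ S T, mul_nonneg (B₁_nonneg φ hT) (Real.sqrt_nonneg _), fun _ => rfl,
      fun t ht K hK => ?_⟩
    refine eLpNorm_tail_scaling_le hwav h hR hS (fun k => ?_) hK
    have := abs_mul_norm_shift_le hc hi h.integrable_ft_scaling h.differentiable_ft_scaling hd ht
      0 k
    rwa [pow_zero, one_mul, one_mul] at *
  · obtain ⟨C, hC0, hC1, hC2⟩ := hwav.assumptionS_scaling.exists_decay hc
    refine ⟨(C + T * C) * √(6 * Aφ φ S * zeta32 + 4 * A₁φ φ S), by positivity,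
      fun h => absurd h hd, fun t ht K hK => ?_⟩
    refine eLpNorm_tail_scaling_le hwav h hR hS (fun k => ?_) hK
    rw [pow_zero, one_mul]
    have h3 : |(k : ℝ)| ≤ |t - k| + T := by
      have h4 := abs_sub_abs_le_abs_sub (k : ℝ) t
      rw [abs_sub_comm, abs_of_nonneg ht.1] at h4
      linarith [ht.2]
    calc |(k : ℝ)| * ‖φ (t - k)‖ ≤ (|t - k| + T) * ‖φ (t - k)‖ := by gcongr
      _ = |t - k| * ‖φ (t - k)‖ + T * ‖φ (t - k)‖ := by ring
      _ ≤ C + T * C := by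
        gcongr
        · exact hC2 _
        · exact hC1 _

lemma tendsto_eLpNorm_two_of_bounded {μ : Measure ℝ} [IsFiniteMeasure μ] {F : ℕ → ℝ → ℂ} {C : ℝ}
    (hF : ∀ n, Measurable (F n)) (hC : ∀ n z, ‖F n z‖ ≤ C)
    (hlim : ∀ z, Tendsto (fun n => F n z) atTop (𝓝 0)) :
    Tendsto (fun n => eLpNorm (F n) 2 μ) atTop (𝓝 0) := by
  have h1 : Tendsto (fun n => ∫⁻ z, ‖F n z‖ₑ ^ 2 ∂μ) atTop (𝓝 (∫⁻ _, 0 ∂μ)) := by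
    refine tendsto_lintegral_of_dominated_convergence (fun _ => ENNReal.ofReal C ^ 2)
      (fun n => by have := hF n; fun_prop) (fun n => Eventually.of_forall fun z => ?_) ?_
      (Eventually.of_forall fun z => ?_)
    · simp only
      rw [← ofReal_norm]
      gcongr
      exact hC n z
    · rw [lintegral_const]
      exact ENNReal.mul_ne_top (ENNReal.pow_ne_top ENNReal.ofReal_ne_top) (measure_ne_top _ _)
    · have h2 := ((ENNReal.continuous_pow 2).tendsto _).comp ((hlim z).enorm)
      simpa [Function.comp_def] using h2
  simp only [lintegral_zero] at h1
  have h3 := ((ENNReal.continuous_rpow_const (y := (1 / 2 : ℝ))).tendsto _).comp h1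
  rw [ENNReal.zero_rpow_of_pos (by norm_num)] at h3
  refine h3.congr fun n => ?_
  rw [eLpNorm_eq_lintegral_rpow_enorm_toReal (by norm_num) (by norm_num)]
  simp

/-- The function of the frequency that represents the truncated expansion. -/
noncomputable def truncatedFreq (φ ψ : ℝ → ℂ) (n k₀' : ℕ) (k : ℕ → ℕ) (t z : ℝ) : ℂ :=
  levelFreq φ 0 (headCoeff k₀' (shiftCoeff φ 0 t)) z +
    ∑ j ∈ Finset.range n, levelFreq ψ j (headCoeff (k j) (shiftCoeff ψ j t)) z

lemma fullLevel_eq_head_add_tail {f : ℝ → ℂ} (hf : AssumptionS f) (hc : Continuous f)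
    (j K : ℕ) (t z : ℝ) : fullLevel f j t z = levelFreq f j (headCoeff K (shiftCoeff f j t)) z +
      levelFreq f j (tailCoeff K (shiftCoeff f j t)) z := by
  have hs := summable_shiftCoeff hf hc j t
  unfold fullLevel levelFreq
  rw [← mul_add, ← trig_add (summable_headCoeff _ K) (summable_tailCoeff hs K)]
  simp only [headCoeff_add_tailCoeff]
  rfl

lemma sum_geometric_tail_le {c : ℝ} (hc : 0 ≤ c) (n N : ℕ) :
    ∑ j ∈ Finset.Ico n N, c / (2 : ℝ) ^ ((j : ℝ) / 2) ≤
      (2 + √2) * c / (2 : ℝ) ^ ((n : ℝ) / 2) := by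
  have hstep : ∀ j : ℕ, c / (2 : ℝ) ^ ((j : ℝ) / 2) =
      (2 + √2) * c / (2 : ℝ) ^ ((j : ℝ) / 2) -
        (2 + √2) * c / (2 : ℝ) ^ (((j + 1 : ℕ) : ℝ) / 2) := by
    intro j
    have e : (2 : ℝ) ^ (((j + 1 : ℕ) : ℝ) / 2) = (2 : ℝ) ^ ((j : ℝ) / 2) * √2 := by
      rw [Real.sqrt_eq_rpow, ← Real.rpow_add two_pos]
      congr 1
      push_cast
      ring
    have h2 : √2 ^ 2 = 2 := Real.sq_sqrt (by norm_num)
    have h0 : 0 < √2 := Real.sqrt_pos.2 (by norm_num)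
    have hq : 0 < (2 : ℝ) ^ ((j : ℝ) / 2) := by positivity
    rw [e]
    field_simp
    linear_combination -c * h2
  rcases le_total n N with hnN | hnN
  · have := Finset.sum_Ico_sub (fun j : ℕ => -((2 + √2) * c / (2 : ℝ) ^ ((j : ℝ) / 2))) hnN
    have h0 : 0 ≤ (2 + √2) * c / (2 : ℝ) ^ ((N : ℝ) / 2) := by positivity
    calc ∑ j ∈ Finset.Ico n N, c / (2 : ℝ) ^ ((j : ℝ) / 2)
        = ∑ j ∈ Finset.Ico n N, (-((2 + √2) * c / (2 : ℝ) ^ (((j + 1 : ℕ) : ℝ) / 2)) -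
            -((2 + √2) * c / (2 : ℝ) ^ ((j : ℝ) / 2))) :=
          Finset.sum_congr rfl fun j _ => by rw [hstep j]; ring
      _ ≤ _ := by
          rw [this]
          linarith
  · rw [Finset.Ico_eq_empty_of_le hnN, Finset.sum_empty]
    positivity

/-- The mean-square error of the truncated expansion, in the frequency domain. -/
lemma eLpNorm_expo_sub_truncatedFreq_le (hwav : IsWaveletPair φ ψ)
    (h : WaveletConditions φ ψ α γ) (hR : IsSpectralDensity R S) (hS : SpectralConditions S)
    {B : ℝ} (hB0 : 0 ≤ B) (hB : ∀ t ∈ Set.Icc 0 T, ∀ K : ℕ, 1 ≤ K →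
        eLpNorm (levelFreq φ 0 (tailCoeff K (shiftCoeff φ 0 t))) 2 (spectralMeasure S) ≤
          ENNReal.ofReal (B / √(K : ℝ)))
    {n k₀' : ℕ} {k : ℕ → ℕ} (hn : 1 ≤ n) (hk₀ : 1 ≤ k₀') (hk : ∀ j, j < n → 1 ≤ k j)
    {t : ℝ} (ht : t ∈ Set.Icc 0 T) :
    eLpNorm (fun z => expo t z - truncatedFreq φ ψ n k₀' k t z) 2 (spectralMeasure S) ≤
      ENNReal.ofReal (epsK (constA ψ S T) B (constC ψ S T) n k₀' k) := by
  have hT : 0 ≤ T := ht.1.trans ht.2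
  have hfin := isFiniteMeasure_spectralMeasure hR.integrable
  have hSφ := hwav.assumptionS_scaling
  have hcφ := hwav.continuous_scaling
  have hSψ := hwav.assumptionS_wavelet
  have hcψ := hwav.continuous_wavelet
  have hdφ := h.differentiable_ft_scaling.continuous
  have hdψ := h.differentiable_ft_wavelet.continuous
  have hcA := constA_nonneg ψ S hT
  have hcC := constC_nonneg ψ S T
  set μ := spectralMeasure S with hμ
  have cφ : ∀ j, Continuous (fullLevel φ j t) := fun j =>
    continuous_levelFreq hdφ (summable_shiftCoeff hSφ hcφ j t) j
  have cψ : ∀ j, Continuous (fullLevel ψ j t) := fun j =>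
    continuous_levelFreq hdψ (summable_shiftCoeff hSψ hcψ j t) j
  have cφt : ∀ K, Continuous (levelFreq φ 0 (tailCoeff K (shiftCoeff φ 0 t))) := fun K =>
    continuous_levelFreq hdφ (summable_tailCoeff (summable_shiftCoeff hSφ hcφ 0 t) K) 0
  have cψt : ∀ j K, Continuous (levelFreq ψ j (tailCoeff K (shiftCoeff ψ j t))) := fun j K =>
    continuous_levelFreq hdψ (summable_tailCoeff (summable_shiftCoeff hSψ hcψ j t) K) j
  obtain ⟨C, hC⟩ := exists_norm_fullLevel_le hSφ hcφ
  have hlim : Tendsto (fun N => eLpNorm (fun z => expo t z - fullLevel φ N t z) 2 μ) atTop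
      (𝓝 0) := by
    refine tendsto_eLpNorm_two_of_bounded (C := 1 + C)
      (fun N => ((continuous_expo t).sub (cφ N)).measurable) (fun N z => ?_) fun z => ?_
    · refine (norm_sub_le _ _).trans ?_
      rw [norm_expo]
      linarith [hC N t z]
    · simpa using (hwav.tendsto_fullLevel h.integrable_ft_scaling t z).const_sub (expo t z)
  have hle : ∀ N, n ≤ N → eLpNorm (fun z => expo t z - truncatedFreq φ ψ n k₀' k t z) 2 μ ≤
      eLpNorm (fun z => expo t z - fullLevel φ N t z) 2 μ +
        ENNReal.ofReal (epsK (constA ψ S T) B (constC ψ S T) n k₀' k) := by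
    intro N hN
    -- the error splits into the error of the projection onto scale `N`, the tails of the retained
    -- levels, and the omitted levels below `N`
    have hae : (fun z => expo t z - truncatedFreq φ ψ n k₀' k t z) =ᵐ[μ]
        (fun z => expo t z - fullLevel φ N t z) +
          ((∑ j ∈ Finset.range n, levelFreq ψ j (tailCoeff (k j) (shiftCoeff ψ j t))) +
            levelFreq φ 0 (tailCoeff k₀' (shiftCoeff φ 0 t)) +
            ∑ j ∈ Finset.Ico n N, fullLevel ψ j t) := by
      refine (withDensity_absolutelyContinuous volume _).ae_eq ?_
      filter_upwards [hwav.fullLevel_eq_add_sum h.integrable_ft_scaling h.integrable_ft_wavelet N t]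
        with z hz
      simp only [Pi.add_apply, Finset.sum_apply]
      rw [hz, ← Finset.sum_range_add_sum_Ico _ hN, fullLevel_eq_head_add_tail hSφ hcφ 0 k₀',
        Finset.sum_congr rfl fun j _ => fullLevel_eq_head_add_tail hSψ hcψ j (k j) t z,
        Finset.sum_add_distrib]
      unfold truncatedFreq
      ring
    rw [eLpNorm_congr_ae hae]
    have m1 : AEStronglyMeasurable (∑ j ∈ Finset.range n,
        levelFreq ψ j (tailCoeff (k j) (shiftCoeff ψ j t))) μ :=
      Finset.aestronglyMeasurable_sum _ fun j _ => (cψt j _).aestronglyMeasurable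
    have m3 : AEStronglyMeasurable (∑ j ∈ Finset.Ico n N, fullLevel ψ j t) μ :=
      Finset.aestronglyMeasurable_sum _ fun j _ => (cψ j).aestronglyMeasurable
    have m2 := (cφt k₀').aestronglyMeasurable (μ := μ)
    refine (eLpNorm_add_le ((continuous_expo t).sub (cφ N)).aestronglyMeasurable
      ((m1.add m2).add m3) (by norm_num)).trans (add_le_add le_rfl ?_)
    refine (eLpNorm_add_le (m1.add m2) m3 (by norm_num)).trans ?_
    refine (add_le_add (eLpNorm_add_le m1 m2 (by norm_num)) le_rfl).trans ?_
    have b1 : eLpNorm (∑ j ∈ Finset.range n, levelFreq ψ j (tailCoeff (k j) (shiftCoeff ψ j t)))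
        2 μ ≤ ENNReal.ofReal (∑ j ∈ Finset.range n,
          constA ψ S T / ((2 : ℝ) ^ ((j : ℝ) / 2) * √(k j : ℝ))) := by
      rw [ENNReal.ofReal_sum_of_nonneg fun j _ => by positivity]
      refine (eLpNorm_sum_le (fun j _ => (cψt j _).aestronglyMeasurable) (by norm_num)).trans ?_
      exact Finset.sum_le_sum fun j hj =>
        eLpNorm_tail_wavelet_le hwav h hR hS ht j (hk j (Finset.mem_range.1 hj))
    have b3 : eLpNorm (∑ j ∈ Finset.Ico n N, fullLevel ψ j t) 2 μ ≤
        ENNReal.ofReal (constC ψ S T / (2 : ℝ) ^ ((n : ℝ) / 2)) := by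
      refine (eLpNorm_sum_le (fun j _ => (cψ j).aestronglyMeasurable) (by norm_num)).trans ?_
      have hl0 : 0 ≤ levelConst ψ S T := Real.sqrt_nonneg _
      refine (Finset.sum_le_sum fun j hj => eLpNorm_fullLevel_wavelet_le hwav h hR hS ht
        (hn.trans (Finset.mem_Ico.1 hj).1)).trans ?_
      rw [← ENNReal.ofReal_sum_of_nonneg fun j _ => by positivity]
      exact ENNReal.ofReal_le_ofReal (sum_geometric_tail_le hl0 n N)
    refine (add_le_add (add_le_add b1 (hB t ht k₀' hk₀)) b3).trans (le_of_eq ?_)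
    unfold epsK
    rw [ENNReal.ofReal_add, ENNReal.ofReal_add]
    · exact Finset.sum_nonneg fun j _ => by positivity
    · positivity
    · exact add_nonneg (Finset.sum_nonneg fun j _ => by positivity) (by positivity)
    · positivity
  -- the projection error vanishes as `N → ∞`
  have h2 := hlim.add_const (ENNReal.ofReal (epsK (constA ψ S T) B (constC ψ S T) n k₀' k))
  rw [zero_add] at h2
  exact ge_of_tendsto h2 (eventually_atTop.2 ⟨n, hle⟩)

end

/-! ### Logarithmic moduli of continuity -/

/-- The weight `ln(e^α + |z|)^α`. -/
noncomputable def logWeight (α z : ℝ) : ℝ := Real.log (Real.exp α + |z|) ^ α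

lemma logWeight_pos {α : ℝ} (hα : 0 < α) (z : ℝ) : 0 < logWeight α z :=
  Real.rpow_pos_of_pos (log_exp_add_pos hα (abs_nonneg z)) _

lemma continuous_logWeight {α : ℝ} (hα : 0 < α) : Continuous (logWeight α) :=
  continuous_log_rpow hα

lemma sigma_eq_div_logWeight (c α : ℝ) {h : ℝ} (hh : 0 ≤ h) :
    sigma c α h = c / logWeight α (1 / h) := by
  unfold sigma logWeight
  rw [abs_of_nonneg (one_div_nonneg.2 hh)]

/-- The logarithmic modulus of continuity of the exponentials. For `|z| ≥ 1/|t - s|` the trivial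
bound `2` suffices; otherwise the difference is at most `|t - s| |z|`, and `w(x)/x` is
nonincreasing. -/
lemma norm_expo_sub_le_logWeight {α : ℝ} (hα : 0 < α) {t s : ℝ} (hts : s ≠ t) (z : ℝ) :
    ‖expo t z - expo s z‖ ≤ 2 * logWeight α z / logWeight α (1 / |t - s|) := by
  have hh : 0 < |t - s| := abs_pos.2 (sub_ne_zero.2 hts.symm)
  have hx : 0 < 1 / |t - s| := one_div_pos.2 hh
  have hw := logWeight_pos hα z
  have hw' := logWeight_pos hα (1 / |t - s|)
  rw [le_div_iff₀ hw']
  rcases le_or_gt (1 / |t - s|) |z| with hz | hz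
  · have h1 : ‖expo t z - expo s z‖ ≤ 2 := by
      refine (norm_sub_le _ _).trans ?_
      rw [norm_expo, norm_expo]
      norm_num
    have h2 : logWeight α (1 / |t - s|) ≤ logWeight α z := by
      unfold logWeight
      rw [abs_of_pos hx]
      exact Real.rpow_le_rpow (log_exp_add_pos hα hx.le).le (log_exp_add_le hx.le hz) hα.le
    exact mul_le_mul h1 h2 hw'.le two_pos.le
  · rcases eq_or_ne z 0 with rfl | hz0
    · have : ‖expo t 0 - expo s 0‖ = 0 := by simp [expo]
      rw [this, zero_mul]
      positivity
    have hz1 : 0 < |z| := abs_pos.2 hz0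
    have h1 := norm_expo_sub_expo_le t s z
    have h2 := log_exp_add_mul_rpow_le hα (abs_nonneg z) (r := 1 / |t - s| / |z|)
      ((one_le_div hz1).2 hz.le)
    rw [div_mul_cancel₀ _ hz1.ne'] at h2
    have h3 : logWeight α (1 / |t - s|) ≤ 1 / |t - s| / |z| * logWeight α z := by
      unfold logWeight
      rwa [abs_of_pos hx]
    calc ‖expo t z - expo s z‖ * logWeight α (1 / |t - s|)
        ≤ |t - s| * |z| * (1 / |t - s| / |z| * logWeight α z) := by gcongr
      _ = logWeight α z := by field_simp
      _ ≤ 2 * logWeight α z := by linarith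

/-- Dilation by `2^j` costs a factor polynomial in `j`. -/
lemma logWeight_two_pow_mul_le {α : ℝ} (hα : 1 / 2 < α) (j : ℕ) (z : ℝ) :
    logWeight α (2 ^ j * z) ≤ (1 + 2 * j) ^ α * logWeight α z := by
  have hα0 : 0 < α := by linarith
  have hL := log_exp_add_pos hα0 (abs_nonneg z)
  unfold logWeight
  rw [← Real.mul_rpow (by positivity) hL.le]
  refine Real.rpow_le_rpow (log_exp_add_pos hα0 (abs_nonneg _)).le ?_ hα0.le
  rw [abs_mul, abs_of_pos (by positivity : (0 : ℝ) < 2 ^ j)]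
  refine (log_exp_add_mul_le (abs_nonneg z) (one_le_pow₀ (by norm_num))).trans ?_
  rw [Real.log_pow]
  have h1 := le_log_exp_add (α := α) (abs_nonneg z)
  have h2 : Real.log 2 ≤ 1 := by linarith [Real.log_two_lt_d9]
  have h3 : (j : ℝ) * Real.log 2 ≤ j * (2 * Real.log (Real.exp α + |z|)) := by
    gcongr
    linarith
  linarith

/-- The weight is slowly varying: a bounded shift changes it by a bounded factor. -/
lemma exists_logWeight_le {α : ℝ} (hα : 0 < α) (r : ℝ) :
    ∃ C : ℝ, 0 < C ∧ ∀ u v, |u - v| ≤ r → logWeight α u ≤ C * logWeight α v := by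
  refine ⟨(1 + Real.log (1 + |r|) / α) ^ α, ?_, fun u v huv => ?_⟩
  · have : 0 ≤ Real.log (1 + |r|) := Real.log_nonneg (by linarith [abs_nonneg r])
    positivity
  have hlr : 0 ≤ Real.log (1 + |r|) := Real.log_nonneg (by linarith [abs_nonneg r])
  have hL := log_exp_add_pos hα (abs_nonneg v)
  unfold logWeight
  rw [← Real.mul_rpow (by positivity) hL.le]
  refine Real.rpow_le_rpow (log_exp_add_pos hα (abs_nonneg _)).le ?_ hα.le
  have h1 := le_log_exp_add (α := α) (abs_nonneg v)
  have h2 : Real.exp α + |u| ≤ (1 + |r|) * (Real.exp α + |v|) := by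
    have h3 : |u| ≤ |v| + |r| := by
      have := abs_sub_abs_le_abs_sub u v
      linarith [le_abs_self r]
    have h4 : 1 ≤ Real.exp α := Real.one_le_exp hα.le
    nlinarith [abs_nonneg r, abs_nonneg v]
  calc Real.log (Real.exp α + |u|) ≤ Real.log ((1 + |r|) * (Real.exp α + |v|)) :=
        Real.log_le_log (by positivity) h2
    _ = Real.log (1 + |r|) + Real.log (Real.exp α + |v|) :=
        Real.log_mul (by positivity) (by positivity)
    _ ≤ Real.log (1 + |r|) / α * Real.log (Real.exp α + |v|) + Real.log (Real.exp α + |v|) := by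
        gcongr
        rw [div_mul_eq_mul_div, le_div_iff₀ hα]
        gcongr
    _ = _ := by ring

/-! ### Periodized square sums -/

/-- Minkowski's inequality for a countable sum of nonnegative functions. -/
lemma lintegral_tsum_sq_le {X : Type*} [MeasurableSpace X] {μ : Measure X} {g : ℤ → X → ℝ≥0∞}
    (hg : ∀ l, Measurable (g l)) {b : ℤ → ℝ≥0∞} (hb : ∀ l, ∫⁻ x, g l x ^ 2 ∂μ ≤ b l ^ 2) :
    ∫⁻ x, (∑' l, g l x) ^ 2 ∂μ ≤ (∑' l, b l) ^ 2 := by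
  have h1 : ∀ l, (∫⁻ x, g l x ^ (2 : ℝ) ∂μ) ^ (1 / 2 : ℝ) ≤ b l := by
    intro l
    have := ENNReal.rpow_le_rpow (hb l) (by norm_num : (0 : ℝ) ≤ 1 / 2)
    rw [← ENNReal.rpow_natCast (b l), ← ENNReal.rpow_mul] at this
    simpa using this
  have h2 : ∀ l m, ∫⁻ x, g l x * g m x ∂μ ≤ b l * b m := by
    intro l m
    have := ENNReal.lintegral_mul_le_Lp_mul_Lq μ Real.HolderConjugate.two_two
      (hg l).aemeasurable (hg m).aemeasurable
    exact this.trans (mul_le_mul' (h1 l) (h1 m))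
  have e : ∀ x, (∑' l, g l x) ^ 2 = ∑' l, ∑' m, g l x * g m x := by
    intro x
    rw [pow_two, ← ENNReal.tsum_mul_right]
    exact tsum_congr fun l => ENNReal.tsum_mul_left.symm
  simp only [e]
  have hm : ∀ l, Measurable fun x => ∑' m, g l x * g m x := fun l =>
    Measurable.tsum fun m => (hg l).mul (hg m)
  rw [lintegral_tsum fun l => (hm l).aemeasurable]
  calc ∑' l, ∫⁻ x, ∑' m, g l x * g m x ∂μ = ∑' l, ∑' m, ∫⁻ x, g l x * g m x ∂μ :=
        tsum_congr fun l => lintegral_tsum fun m => ((hg l).mul (hg m)).aemeasurable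
    _ ≤ ∑' l, ∑' m, b l * b m :=
        ENNReal.tsum_le_tsum fun l => ENNReal.tsum_le_tsum fun m => h2 l m
    _ = (∑' l, b l) ^ 2 := by
        rw [pow_two, ← ENNReal.tsum_mul_right]
        exact tsum_congr fun l => ENNReal.tsum_mul_left

/-- A Lipschitz function is large on a whole interval around a point where it is large. -/
lemma rpow_le_integral_of_lipschitz {F : ℝ → ℝ} {K M γ n : ℝ} (hF0 : ∀ v, 0 ≤ F v)
    (hFc : Continuous F) (hK : ∀ v w, |F v - F w| ≤ K * |v - w|) (hM : ∀ v, F v ≤ M)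
    (hKM : M ≤ K) (hγ : 0 < γ) {v : ℝ} (hv : v ∈ Set.Ioc n (n + 1)) :
    F v ^ (1 + γ) ≤ 2 ^ (1 + γ) * K * ∫ w in Set.Ioc n (n + 1), F w ^ γ := by
  have hFγ : Continuous fun w => F w ^ γ := hFc.rpow_const fun _ => Or.inr hγ.le
  have hint : IntegrableOn (fun w => F w ^ γ) (Set.Ioc n (n + 1)) :=
    (hFγ.integrableOn_Icc (a := n) (b := n + 1)).mono_set Set.Ioc_subset_Icc_self
  rcases (hF0 v).eq_or_lt with h0 | h0
  · rw [← h0, Real.zero_rpow (by linarith)]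
    have : 0 ≤ K := (hF0 v).trans ((hM v).trans hKM)
    have : 0 ≤ ∫ w in Set.Ioc n (n + 1), F w ^ γ :=
      integral_nonneg fun w => Real.rpow_nonneg (hF0 w) _
    positivity
  have hK0 : 0 < K := h0.trans_le ((hM v).trans hKM)
  set d := F v / (2 * K) with hd
  have hd0 : 0 < d := by positivity
  have hd1 : d ≤ 1 / 2 := by
    rw [hd, div_le_iff₀ (by positivity)]
    linarith [hM v]
  -- an interval of length `d` in the block, on which `F ≥ F v / 2`
  obtain ⟨p, hp1, hp2⟩ : ∃ p, Set.Ioc p (p + d) ⊆ Set.Ioc n (n + 1) ∧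
      ∀ w ∈ Set.Ioc p (p + d), |v - w| ≤ d := by
    rcases le_total v (n + 1 / 2) with h | h
    · refine ⟨v, fun w hw => ⟨hv.1.trans hw.1, by linarith [hw.2]⟩, fun w hw => ?_⟩
      rw [abs_le]
      constructor <;> linarith [hw.1, hw.2]
    · refine ⟨v - d, fun w hw => ⟨by linarith [hw.1], by linarith [hw.2, hv.2]⟩, fun w hw => ?_⟩
      rw [abs_le]
      constructor <;> linarith [hw.1, hw.2]
  have hlow : ∀ w ∈ Set.Ioc p (p + d), (F v / 2) ^ γ ≤ F w ^ γ := by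
    intro w hw
    refine Real.rpow_le_rpow (by positivity) ?_ hγ.le
    have h1 := (le_abs_self _).trans (hK v w)
    have h2 : K * |v - w| ≤ K * d := by
      gcongr
      exact hp2 w hw
    have h3 : K * d = F v / 2 := by
      rw [hd]
      field_simp
    linarith
  have h1 : (F v / 2) ^ γ * d ≤ ∫ w in Set.Ioc n (n + 1), F w ^ γ := by
    calc (F v / 2) ^ γ * d = ∫ _ in Set.Ioc p (p + d), (F v / 2) ^ γ := by
          simp [hd0.le, mul_comm]
      _ ≤ ∫ w in Set.Ioc p (p + d), F w ^ γ :=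
          setIntegral_mono_on (integrableOn_const (by simp)) (hint.mono_set hp1)
            measurableSet_Ioc hlow
      _ ≤ _ := setIntegral_mono_set hint
          (Eventually.of_forall fun w => Real.rpow_nonneg (hF0 w) _) hp1.eventuallyLE
  have h2 : F v ^ (1 + γ) = 2 ^ (1 + γ) * K * ((F v / 2) ^ γ * d) := by
    have e1 : F v ^ (1 + γ) = 2 ^ (1 + γ) * (F v / 2) ^ (1 + γ) := by
      rw [← Real.mul_rpow (by norm_num) (by positivity)]
      congr 1
      ring
    rw [e1, Real.rpow_add (by positivity : 0 < F v / 2), Real.rpow_one, hd]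
    field_simp
  rw [h2]
  gcongr

/-- On a unit interval, the square of a bounded Lipschitz function is controlled by the square of
the integral of its `γ`-th power; this is where `γ ≤ 1/2` enters. -/
lemma integral_sq_le_of_lipschitz {F : ℝ → ℝ} {K M γ n : ℝ} (hF0 : ∀ v, 0 ≤ F v)
    (hFc : Continuous F) (hK : ∀ v w, |F v - F w| ≤ K * |v - w|) (hM : ∀ v, F v ≤ M)
    (hKM : M ≤ K) (hγ : 0 < γ) (hγ2 : γ ≤ 1 / 2) :
    ∫ w in Set.Ioc n (n + 1), F w ^ 2 ≤
      2 ^ (1 + γ) * K * M ^ (1 - 2 * γ) * (∫ w in Set.Ioc n (n + 1), F w ^ γ) ^ 2 := by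
  have hFγ : Continuous fun w => F w ^ γ := hFc.rpow_const fun _ => Or.inr hγ.le
  have hint : ∀ G : ℝ → ℝ, Continuous G → IntegrableOn G (Set.Ioc n (n + 1)) := fun G hG =>
    (hG.integrableOn_Icc (a := n) (b := n + 1)).mono_set Set.Ioc_subset_Icc_self
  set I := ∫ w in Set.Ioc n (n + 1), F w ^ γ with hI
  have hI0 : 0 ≤ I := integral_nonneg fun w => Real.rpow_nonneg (hF0 w) _
  have hM0 : 0 ≤ M := (hF0 0).trans (hM 0)
  have hK0 : 0 ≤ K := hM0.trans hKM
  have hpt : ∀ v ∈ Set.Ioc n (n + 1),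
      F v ^ 2 ≤ 2 ^ (1 + γ) * K * I * M ^ (1 - 2 * γ) * F v ^ γ := by
    intro v hv
    rcases (hF0 v).eq_or_lt with h0 | h0
    · rw [← h0, Real.zero_rpow hγ.ne']
      simp
    have e : F v ^ 2 = F v ^ (1 + γ) * F v ^ (1 - 2 * γ) * F v ^ γ := by
      rw [← Real.rpow_add h0, ← Real.rpow_add h0, ← Real.rpow_natCast]
      congr 1
      push_cast
      ring
    rw [e]
    have h1 := rpow_le_integral_of_lipschitz hF0 hFc hK hM hKM hγ hv
    have h2 : F v ^ (1 - 2 * γ) ≤ M ^ (1 - 2 * γ) :=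
      Real.rpow_le_rpow (hF0 v) (hM v) (by linarith)
    gcongr
  calc ∫ w in Set.Ioc n (n + 1), F w ^ 2
      ≤ ∫ w in Set.Ioc n (n + 1), 2 ^ (1 + γ) * K * I * M ^ (1 - 2 * γ) * F w ^ γ :=
        setIntegral_mono_on (hint _ (by fun_prop)) (hint _ (by fun_prop)) measurableSet_Ioc hpt
    _ = 2 ^ (1 + γ) * K * M ^ (1 - 2 * γ) * I ^ 2 := by
        rw [integral_const_mul, ← hI]
        ring

/-- The periodization of `f̂` with the logarithmic weight is square integrable over a period. -/
lemma lintegral_tsum_ft_sq_lt_top {g : ℝ → ℂ} {α γ K M : ℝ} (hα : 0 < α) (hγ : 0 < γ)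
    (hγ2 : γ ≤ 1 / 2) (hgc : Continuous g) (hK : ∀ u v, ‖g u - g v‖ ≤ K * |u - v|)
    (hM : ∀ u, ‖g u‖ ≤ M)
    (hint : Integrable fun u : ℝ => logWeight α u * ‖g u‖ ^ γ) :
    ∫⁻ v in Set.Ioc (0 : ℝ) 1, (∑' l : ℤ, ENNReal.ofReal
      (‖g (2 * Real.pi * (v + l))‖ * logWeight α (2 * Real.pi * (v + l)))) ^ 2 < ∞ := by
  have hpi := Real.pi_pos
  set F : ℝ → ℝ := fun v => ‖g (2 * Real.pi * v)‖ with hF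
  set W : ℝ → ℝ := fun v => logWeight α (2 * Real.pi * v) with hW
  have hFc : Continuous F := by fun_prop
  have hlw := continuous_logWeight hα
  have hWc : Continuous W := by fun_prop
  have hF0 : ∀ v, 0 ≤ F v := fun v => norm_nonneg _
  have hW0 : ∀ v, 0 < W v := fun v => logWeight_pos hα _
  have hM0 : 0 ≤ M := (norm_nonneg _).trans (hM 0)
  have hK0 : 0 ≤ K := by
    have := (norm_nonneg _).trans (hK 1 0)
    simpa using this
  set K' := K * (2 * Real.pi) + M with hK'
  have hFK : ∀ v w, |F v - F w| ≤ K' * |v - w| := by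
    intro v w
    refine (abs_norm_sub_norm_le _ _).trans ((hK _ _).trans ?_)
    rw [← mul_sub, abs_mul, abs_of_pos (by positivity : 0 < 2 * Real.pi), ← mul_assoc]
    gcongr
    linarith
  have hFγ : Continuous fun v => F v ^ γ := hFc.rpow_const fun _ => Or.inr hγ.le
  have hFW : Integrable fun v => W v * F v ^ γ :=
    hint.comp_mul_left' (R := 2 * Real.pi) (by positivity)
  obtain ⟨C, hC0, hC⟩ := exists_logWeight_le hα (2 * Real.pi)
  set J : ℤ → ℝ := fun l => ∫ w in Set.Ioc (l : ℝ) (l + 1), W w * F w ^ γ with hJ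
  have hJ0 : ∀ l, 0 ≤ J l := fun l => integral_nonneg fun w =>
    mul_nonneg (hW0 w).le (Real.rpow_nonneg (hF0 w) _)
  have hJs : Summable J := by
    have := hasSum_integral_iUnion (μ := volume) (s := fun n : ℤ => Set.Ioc (n : ℝ) (n + 1))
      (f := fun w => W w * F w ^ γ) (fun _ => measurableSet_Ioc)
      (Set.pairwise_disjoint_Ioc_intCast ℝ) hFW.integrableOn
    exact this.summable
  set Q := 2 ^ (1 + γ) * K' * M ^ (1 - 2 * γ) with hQ
  have hQ0 : 0 ≤ Q := by positivity
  have hint' : ∀ (n : ℝ) (G : ℝ → ℝ), Continuous G → IntegrableOn G (Set.Ioc n (n + 1)) :=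
    fun n G hG => (hG.integrableOn_Icc (a := n) (b := n + 1)).mono_set Set.Ioc_subset_Icc_self
  -- on each block the weight is essentially constant, and the `L²` norm of `F W` is bounded by the
  -- summable integrals `J l`
  have hblock : ∀ l : ℤ, ∫ w in Set.Ioc (l : ℝ) (l + 1), (F w * W w) ^ 2 ≤
      (C ^ 2 * √Q * J l) ^ 2 := by
    intro l
    have hcomp : ∀ w ∈ Set.Ioc (l : ℝ) (l + 1), W w ≤ C * W l ∧ W l ≤ C * W w := by
      intro w hw
      have : |2 * Real.pi * w - 2 * Real.pi * l| ≤ 2 * Real.pi := by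
        rw [← mul_sub, abs_mul, abs_of_pos (by positivity : 0 < 2 * Real.pi),
          abs_of_nonneg (by linarith [hw.1])]
        have := hw.2
        nlinarith
      exact ⟨hC _ _ this, hC _ _ (by rwa [abs_sub_comm])⟩
    have h1 := integral_sq_le_of_lipschitz (n := l) hF0 hFc hFK (M := M) (fun v => hM _)
      (by rw [hK']; have : 0 ≤ K * (2 * Real.pi) := by positivity
          linarith) hγ hγ2
    have h2 : W l * ∫ w in Set.Ioc (l : ℝ) (l + 1), F w ^ γ ≤ C * J l := by
      rw [hJ, ← integral_const_mul, ← integral_const_mul]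
      refine setIntegral_mono_on (hint' _ _ (by fun_prop)) (hint' _ _ (by fun_prop))
        measurableSet_Ioc fun w hw => ?_
      rw [← mul_assoc]
      exact mul_le_mul_of_nonneg_right (hcomp w hw).2 (Real.rpow_nonneg (hF0 w) _)
    have hI0 : 0 ≤ ∫ w in Set.Ioc (l : ℝ) (l + 1), F w ^ γ :=
      integral_nonneg fun w => Real.rpow_nonneg (hF0 w) _
    calc ∫ w in Set.Ioc (l : ℝ) (l + 1), (F w * W w) ^ 2
        ≤ ∫ w in Set.Ioc (l : ℝ) (l + 1), (C * W l) ^ 2 * F w ^ 2 := by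
          refine setIntegral_mono_on (hint' _ _ (by fun_prop)) (hint' _ _ (by fun_prop))
            measurableSet_Ioc fun w hw => ?_
          rw [mul_pow, mul_comm]
          refine mul_le_mul_of_nonneg_right ?_ (sq_nonneg _)
          exact pow_le_pow_left₀ (hW0 w).le (hcomp w hw).1 2
      _ = (C * W l) ^ 2 * ∫ w in Set.Ioc (l : ℝ) (l + 1), F w ^ 2 := integral_const_mul _ _
      _ ≤ (C * W l) ^ 2 * (Q * (∫ w in Set.Ioc (l : ℝ) (l + 1), F w ^ γ) ^ 2) := by gcongr
      _ = C ^ 2 * Q * (W l * ∫ w in Set.Ioc (l : ℝ) (l + 1), F w ^ γ) ^ 2 := by ring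
      _ ≤ C ^ 2 * Q * (C * J l) ^ 2 := by
          gcongr
          exact mul_nonneg (hW0 _).le hI0
      _ = (C ^ 2 * √Q * J l) ^ 2 := by
          have := Real.sq_sqrt hQ0
          linear_combination -C ^ 4 * J l ^ 2 * this
  have hmeas : ∀ l : ℤ, Measurable fun v : ℝ => ENNReal.ofReal (F (v + l) * W (v + l)) :=
    fun l => by
      have : Continuous fun v : ℝ => F (v + l) * W (v + l) := by fun_prop
      exact this.measurable.ennreal_ofReal
  have hb : ∀ l : ℤ, ∫⁻ v in Set.Ioc (0 : ℝ) 1, ENNReal.ofReal (F (v + l) * W (v + l)) ^ 2 ≤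
      ENNReal.ofReal (C ^ 2 * √Q * J l) ^ 2 := by
    intro l
    have hnn : 0 ≤ C ^ 2 * √Q * J l := mul_nonneg (by positivity) (hJ0 l)
    rw [← ENNReal.ofReal_pow hnn]
    refine le_trans (le_of_eq ?_) (ENNReal.ofReal_le_ofReal (hblock l))
    have e1 : ∫ w in Set.Ioc (l : ℝ) (l + 1), (F w * W w) ^ 2 =
        ∫ v in Set.Ioc (0 : ℝ) 1, (F (v + l) * W (v + l)) ^ 2 := by
      rw [← intervalIntegral.integral_of_le (by linarith), ← intervalIntegral.integral_of_le
        (by norm_num), intervalIntegral.integral_comp_add_right (fun w => (F w * W w) ^ 2)]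
      simp [add_comm]
    rw [e1, ofReal_integral_eq_lintegral_ofReal]
    · refine lintegral_congr fun v => ?_
      rw [ENNReal.ofReal_pow (mul_nonneg (hF0 _) (hW0 _).le)]
    · have := hint' 0 (fun v => (F (v + l) * W (v + l)) ^ 2) (by fun_prop)
      rwa [zero_add] at this
    · exact Eventually.of_forall fun _ => sq_nonneg _
  refine (lintegral_tsum_sq_le hmeas hb).trans_lt ?_
  refine ENNReal.pow_lt_top ?_
  rw [← ENNReal.ofReal_tsum_of_nonneg (fun l => mul_nonneg (by positivity) (hJ0 l))
    (hJs.mul_left _)]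
  exact ENNReal.ofReal_lt_top

/-! ### Increments of the error -/

/-- A function bounded together with its second derivative has a bounded derivative. -/
lemma norm_deriv_le_of_bounds {g : ℝ → ℂ} {M M₂ : ℝ} (hd : Differentiable ℝ g)
    (hd2 : Differentiable ℝ (deriv g)) (hM : ∀ u, ‖g u‖ ≤ M)
    (hM2 : ∀ u, ‖deriv (deriv g) u‖ ≤ M₂) (u : ℝ) : ‖deriv g u‖ ≤ 2 * M + M₂ := by
  have hM20 : 0 ≤ M₂ := (norm_nonneg _).trans (hM2 0)
  have hder : ∀ x, HasDerivAt (fun x : ℝ => g x - x • deriv g u) (deriv g x - deriv g u) x := by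
    intro x
    have h1 : HasDerivAt (fun x : ℝ => x • deriv g u) ((1 : ℝ) • deriv g u) x :=
      (hasDerivAt_id x).smul_const _
    rw [one_smul] at h1
    exact (hd x).hasDerivAt.sub h1
  have h2 : ∀ x ∈ Set.Icc u (u + 1), ‖deriv g x - deriv g u‖ ≤ M₂ := by
    intro x hx
    have h3 := convex_univ.norm_image_sub_le_of_norm_deriv_le (f := deriv g) (C := M₂)
      (fun x _ => hd2 x) (fun x _ => hM2 x) (Set.mem_univ u) (Set.mem_univ x)
    refine h3.trans ?_
    rw [Real.norm_eq_abs, abs_of_nonneg (by linarith [hx.1])]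
    have := hx.2
    nlinarith
  have h4 := (convex_Icc u (u + 1)).norm_image_sub_le_of_norm_hasDerivWithin_le
    (fun x _ => (hder x).hasDerivWithinAt) h2 (Set.left_mem_Icc.2 (by linarith))
    (Set.right_mem_Icc.2 (by linarith))
  have e : g (u + 1) - (u + 1) • deriv g u - (g u - u • deriv g u) =
      g (u + 1) - g u - deriv g u := by
    rw [add_smul, one_smul]
    ring
  rw [e] at h4
  have h5 : ‖u + 1 - u‖ = 1 := by simp
  rw [h5, mul_one] at h4
  have h6 : deriv g u = g (u + 1) - g u - (g (u + 1) - g u - deriv g u) := by ring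
  rw [h6]
  refine (norm_sub_le _ _).trans (add_le_add ((norm_sub_le _ _).trans ?_) h4)
  linarith [hM (u + 1), hM u]

lemma norm_sub_le_of_norm_deriv_le {g : ℝ → ℂ} {K : ℝ} (hd : Differentiable ℝ g)
    (hK : ∀ u, ‖deriv g u‖ ≤ K) (u v : ℝ) : ‖g u - g v‖ ≤ K * |u - v| := by
  have := convex_univ.norm_image_sub_le_of_norm_deriv_le (f := g) (C := K)
    (fun x _ => hd x) (fun x _ => hK x) (Set.mem_univ v) (Set.mem_univ u)
  rwa [Real.norm_eq_abs] at this

lemma norm_expo_two_pow_sub_le {α : ℝ} (hα : 1 / 2 < α) {t s : ℝ} (hts : s ≠ t) (j : ℕ) (u : ℝ) :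
    ‖expo (2 ^ j * t) u - expo (2 ^ j * s) u‖ ≤
      2 * (1 + 2 * j) ^ α / logWeight α (1 / |t - s|) * logWeight α u := by
  have e : ∀ r : ℝ, expo (2 ^ j * r) u = expo r (2 ^ j * u) := fun r => by
    unfold expo
    congr 1
    push_cast
    ring
  have hα0 : 0 < α := by linarith
  have hw := logWeight_pos hα0 (1 / |t - s|)
  rw [e, e]
  refine (norm_expo_sub_le_logWeight hα0 hts _).trans ?_
  rw [div_mul_eq_mul_div]
  refine div_le_div_of_nonneg_right ?_ hw.le
  rw [mul_assoc]
  exact mul_le_mul_of_nonneg_left (logWeight_two_pow_mul_le hα j u) two_pos.le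

/-- The increments of the coefficients in `t`, uniformly over the scale up to a polynomial
factor. -/
lemma exists_tsum_norm_sq_increment_le {f : ℝ → ℂ} (hf : AssumptionS f) (hc : Continuous f)
    (hft : Integrable (ft f)) {α γ K M : ℝ} (hα : 1 / 2 < α) (hγ : 0 < γ) (hγ2 : γ ≤ 1 / 2)
    (hK : ∀ u v, ‖ft f u - ft f v‖ ≤ K * |u - v|) (hM : ∀ u, ‖ft f u‖ ≤ M)
    (hint : Integrable fun u : ℝ => logWeight α u * ‖ft f u‖ ^ γ) :
    ∃ D : ℝ, 0 ≤ D ∧ ∀ (j : ℕ) (s t : ℝ), s ≠ t →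
      ∑' k, ‖shiftCoeff f j t k - shiftCoeff f j s k‖ ^ 2 ≤
        (D * (1 + 2 * j) ^ α / logWeight α (1 / |t - s|)) ^ 2 := by
  have hα0 : 0 < α := by linarith
  have hcf := continuous_ft (hf.integrable hc)
  have hfin := lintegral_tsum_ft_sq_lt_top hα0 hγ hγ2 hcf hK hM hint
  set Z := ∫⁻ v in Set.Ioc (0 : ℝ) 1, (∑' l : ℤ, ENNReal.ofReal
      (‖ft f (2 * Real.pi * (v + l))‖ * logWeight α (2 * Real.pi * (v + l)))) ^ 2 with hZ
  refine ⟨2 * √Z.toReal, by positivity, fun j s t hts => ?_⟩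
  have hw := logWeight_pos hα0 (1 / |t - s|)
  set r := 2 * (1 + 2 * (j : ℝ)) ^ α / logWeight α (1 / |t - s|) with hr
  have hr0 : 0 ≤ r := by positivity
  have hst := summable_shiftCoeff hf hc j t
  have hss := summable_shiftCoeff hf hc j s
  have hsum : Summable fun k => ‖shiftCoeff f j t k - shiftCoeff f j s k‖ :=
    Summable.of_nonneg_of_le (fun _ => norm_nonneg _) (fun k => norm_sub_le _ _) (hst.add hss)
  have hae : ∀ᵐ v : ℝ, ENNReal.ofReal
      (‖trig (fun k => shiftCoeff f j t k - shiftCoeff f j s k) v‖ ^ 2) ≤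
      ENNReal.ofReal r ^ 2 * (∑' l : ℤ, ENNReal.ofReal
        (‖ft f (2 * Real.pi * (v + l))‖ * logWeight α (2 * Real.pi * (v + l)))) ^ 2 := by
    filter_upwards [hasSum_ft_eq_zak hf hc hft (2 ^ j * t),
      hasSum_ft_eq_zak hf hc hft (2 ^ j * s)] with v h1 h2
    -- Poisson summation in both times
    have h3 : trig (fun k => shiftCoeff f j t k - shiftCoeff f j s k) v =
        ∑' l : ℤ, ft f (2 * Real.pi * (v + l)) * (expo (2 ^ j * t) (2 * Real.pi * (v + l)) -
          expo (2 ^ j * s) (2 * Real.pi * (v + l))) := by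
      rw [trig_sub hst hss]
      change zak f (2 ^ j * t) v - zak f (2 ^ j * s) v = _
      rw [← (h1.sub h2).tsum_eq]
      exact tsum_congr fun l => by ring
    rw [ENNReal.ofReal_pow (norm_nonneg _), ← mul_pow, ofReal_norm]
    refine pow_le_pow_left' ?_ 2
    rw [h3, ← ENNReal.tsum_mul_left]
    refine (enorm_tsum_le_tsum_enorm).trans (ENNReal.tsum_le_tsum fun l => ?_)
    rw [← ofReal_norm, ← ENNReal.ofReal_mul hr0]
    refine ENNReal.ofReal_le_ofReal ?_
    rw [norm_mul, mul_left_comm]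
    refine mul_le_mul_of_nonneg_left ?_ (norm_nonneg _)
    exact norm_expo_two_pow_sub_le hα hts j _
  have h4 : ENNReal.ofReal (∑' k, ‖shiftCoeff f j t k - shiftCoeff f j s k‖ ^ 2) ≤
      ENNReal.ofReal r ^ 2 * Z := by
    rw [← lintegral_norm_sq_trig hsum, hZ, ← lintegral_const_mul' _ _
      (ENNReal.pow_ne_top ENNReal.ofReal_ne_top)]
    exact lintegral_mono_ae (ae_restrict_of_ae hae)
  have h5 := ENNReal.toReal_mono (ENNReal.mul_ne_top (ENNReal.pow_ne_top ENNReal.ofReal_ne_top)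
    hfin.ne) h4
  rw [ENNReal.toReal_ofReal (tsum_nonneg fun _ => sq_nonneg _), ENNReal.toReal_mul,
    ENNReal.toReal_pow, ENNReal.toReal_ofReal hr0] at h5
  refine h5.trans (le_of_eq ?_)
  have h6 : 2 * √Z.toReal * (1 + 2 * (j : ℝ)) ^ α / logWeight α (1 / |t - s|) =
      r * √Z.toReal := by
    rw [hr]
    ring
  rw [h6, mul_pow, Real.sq_sqrt ENNReal.toReal_nonneg]

section

variable {φ ψ : ℝ → ℂ} {α γ T : ℝ} {R : ℝ → ℂ} {S : ℝ → ℝ}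

lemma memLp_id_spectralMeasure (hR : IsSpectralDensity R S) (hS : SpectralConditions S) :
    MemLp (fun z : ℝ => z) 2 (spectralMeasure S) := by
  refine (memLp_two_iff_integrable_sq (f := fun z : ℝ => z)
    measurable_id.aestronglyMeasurable).2 ?_
  unfold spectralMeasure
  have hm : Measurable fun z => S z / (2 * Real.pi) :=
    hS.differentiable.continuous.measurable.div_const _
  rw [integrable_withDensity_iff hm.ennreal_ofReal
    (Eventually.of_forall fun _ => ENNReal.ofReal_lt_top)]
  refine ((hR.integrable.abs.add hS.integrable_mul_pow).div_const (2 * Real.pi)).mono'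
    ((measurable_id.pow_const 2).mul hm.ennreal_ofReal.ennreal_toReal).aestronglyMeasurable
    (Eventually.of_forall fun z => ?_)
  have h0 := hR.nonneg z
  have h1 : 0 ≤ S z / (2 * Real.pi) := by positivity
  rw [ENNReal.toReal_ofReal h1, Real.norm_eq_abs, abs_of_nonneg (by positivity), Pi.add_apply,
    ← mul_div_assoc]
  refine div_le_div_of_nonneg_right ?_ (by positivity)
  rw [abs_of_nonneg h0]
  have h2 : z ^ 2 ≤ 1 + |z| ^ 4 := by
    have : |z| ^ 4 = (z ^ 2) ^ 2 := by
      rw [← sq_abs z]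
      ring
    nlinarith [sq_nonneg (z ^ 2 - 1 / 2)]
  nlinarith

/-- The weight grows at most linearly, and the spectral measure has a second moment. -/
lemma memLp_logWeight (hα : 0 < α) (hR : IsSpectralDensity R S) (hS : SpectralConditions S) :
    MemLp (logWeight α) 2 (spectralMeasure S) := by
  have hfin := isFiniteMeasure_spectralMeasure hR.integrable
  have h1 : MemLp (fun z : ℝ => (1 + |z|) * logWeight α 1) 2 (spectralMeasure S) := by
    have ha : MemLp (fun z : ℝ => |z|) 2 (spectralMeasure S) :=
      (memLp_id_spectralMeasure hR hS).norm
    have hb : MemLp (fun _ : ℝ => (1 : ℝ)) 2 (spectralMeasure S) := memLp_const 1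
    exact (hb.add ha).mul_const (logWeight α 1)
  refine h1.mono' (continuous_logWeight hα).aestronglyMeasurable (Eventually.of_forall fun z => ?_)
  rw [Real.norm_eq_abs, abs_of_pos (logWeight_pos hα z)]
  have h3 := log_exp_add_mul_rpow_le hα (zero_le_one) (r := 1 + |z|) (by linarith [abs_nonneg z])
  unfold logWeight
  rw [abs_one]
  refine le_trans (Real.rpow_le_rpow (log_exp_add_pos hα (abs_nonneg z)).le ?_ hα.le) h3
  exact log_exp_add_le (abs_nonneg z) (by linarith)

/-- The increments of the process itself. -/
lemma exists_eLpNorm_expo_sub_le (hα : 0 < α) (hR : IsSpectralDensity R S)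
    (hS : SpectralConditions S) :
    ∃ D : ℝ, 0 ≤ D ∧ ∀ s t : ℝ, s ≠ t →
      eLpNorm (fun z => expo t z - expo s z) 2 (spectralMeasure S) ≤
        ENNReal.ofReal (D / logWeight α (1 / |t - s|)) := by
  have hm := memLp_logWeight hα hR hS
  refine ⟨2 * (eLpNorm (logWeight α) 2 (spectralMeasure S)).toReal, by positivity,
    fun s t hts => ?_⟩
  have hw := logWeight_pos hα (1 / |t - s|)
  have h1 := eLpNorm_le_mul_eLpNorm_of_ae_le_mul (μ := spectralMeasure S)
    (f := fun z => expo t z - expo s z) (g := logWeight α)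
    (c := 2 / logWeight α (1 / |t - s|)) (Eventually.of_forall fun z => by
      refine (norm_expo_sub_le_logWeight hα hts z).trans (le_of_eq ?_)
      rw [Real.norm_eq_abs, abs_of_pos (logWeight_pos hα z)]
      ring) 2
  refine h1.trans (le_of_eq ?_)
  rw [← ENNReal.ofReal_toReal hm.eLpNorm_ne_top, ← ENNReal.ofReal_mul (by positivity)]
  congr 1
  rw [ENNReal.toReal_ofReal ENNReal.toReal_nonneg]
  ring

lemma levelFreq_sub {f : ℝ → ℂ} (j : ℕ) {a b : ℤ → ℂ} (ha : Summable fun k => ‖a k‖)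
    (hb : Summable fun k => ‖b k‖) (z : ℝ) :
    levelFreq f j a z - levelFreq f j b z = levelFreq f j (fun k => a k - b k) z := by
  unfold levelFreq
  rw [trig_sub ha hb, mul_sub]

lemma tsum_norm_sq_head_sub_le (K : ℕ) {a b : ℤ → ℂ} (ha : Summable fun k => ‖a k‖)
    (hb : Summable fun k => ‖b k‖) :
    ∑' k, ‖headCoeff K a k - headCoeff K b k‖ ^ 2 ≤ ∑' k, ‖a k - b k‖ ^ 2 := by
  have hs : Summable fun k => ‖a k - b k‖ :=
    Summable.of_nonneg_of_le (fun _ => norm_nonneg _) (fun k => norm_sub_le _ _) (ha.add hb)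
  have h2 := summable_norm_sq (a := fun k => a k - b k) hs
  have hle : ∀ k, ‖headCoeff K a k - headCoeff K b k‖ ^ 2 ≤ ‖a k - b k‖ ^ 2 := by
    intro k
    unfold headCoeff
    split_ifs
    · exact le_rfl
    · simp
  exact (Summable.of_nonneg_of_le (fun _ => sq_nonneg _) hle h2).tsum_le_tsum hle h2

lemma summable_head_sub (K : ℕ) (a b : ℤ → ℂ) :
    Summable fun k => ‖headCoeff K a k - headCoeff K b k‖ :=
  Summable.of_nonneg_of_le (fun _ => norm_nonneg _) (fun _ => norm_sub_le _ _)
    ((summable_headCoeff a K).add (summable_headCoeff b K))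

lemma eLpNorm_le_of_coeff_le {μ : Measure ℝ} {F : ℝ → ℂ} {A A' s b : ℝ} (hA : A ≤ A' ^ 2)
    (hA0 : 0 ≤ A) (hA' : 0 ≤ A') (hb : 0 ≤ b) (hs0 : 0 ≤ s)
    (h : ∫⁻ z, ‖F z‖ₑ ^ 2 ∂μ ≤ ENNReal.ofReal (A * s)) (hs : s ≤ b ^ 2) :
    eLpNorm F 2 μ ≤ ENNReal.ofReal (A' * b) := by
  refine (eLpNorm_two_le_of_lintegral_le (by positivity) h).trans (ENNReal.ofReal_le_ofReal ?_)
  refine Real.sqrt_le_iff.2 ⟨by positivity, ?_⟩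
  rw [mul_pow]
  exact mul_le_mul hA hs hs0 (sq_nonneg _)

/-- Increments of the truncated scaling level, uniformly over the truncation. -/
lemma exists_increment_scaling (hwav : IsWaveletPair φ ψ) (h : WaveletConditions φ ψ α γ)
    (hR : IsSpectralDensity R S) (hS : SpectralConditions S) :
    ∃ D : ℝ, 0 ≤ D ∧ ∀ (K : ℕ) (s t : ℝ), s ≠ t →
      eLpNorm (fun z => levelFreq φ 0 (headCoeff K (shiftCoeff φ 0 t)) z -
        levelFreq φ 0 (headCoeff K (shiftCoeff φ 0 s)) z) 2 (spectralMeasure S) ≤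
        ENNReal.ofReal (D / logWeight α (1 / |t - s|)) := by
  have hα : 0 < α := by linarith [h.alpha_gt]
  obtain ⟨D, hD0, hD⟩ := exists_tsum_norm_sq_increment_le hwav.assumptionS_scaling
    hwav.continuous_scaling h.integrable_ft_scaling h.alpha_gt h.gamma_pos h.gamma_lt.le
    (norm_sub_le_of_norm_deriv_le h.differentiable_ft_scaling (norm_deriv_ft_le_cφ' h))
    (norm_ft_le_cφ h) h.integrable_log_scaling
  have hA0 : 0 ≤ A₁φ φ S + 2 * Real.pi * Aφ φ S := by
    have := A₁φ_nonneg φ S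
    have := Aφ_nonneg φ S
    positivity
  refine ⟨√(A₁φ φ S + 2 * Real.pi * Aφ φ S) * D, by positivity, fun K s t hts => ?_⟩
  have hw := logWeight_pos hα (1 / |t - s|)
  have hst := summable_shiftCoeff hwav.assumptionS_scaling hwav.continuous_scaling 0 t
  have hss := summable_shiftCoeff hwav.assumptionS_scaling hwav.continuous_scaling 0 s
  have h1 := hD 0 s t hts
  simp only [Nat.cast_zero, mul_zero, add_zero, Real.one_rpow, mul_one] at h1
  simp only [levelFreq_sub 0 (summable_headCoeff _ K) (summable_headCoeff _ K)]
  rw [mul_div_assoc]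
  exact eLpNorm_le_of_coeff_le (Real.sq_sqrt hA0).ge hA0 (Real.sqrt_nonneg _) (by positivity)
    (tsum_nonneg fun _ => sq_nonneg _)
    (lintegral_levelFreq_scaling_le h hR hS (summable_head_sub K _ _))
    ((tsum_norm_sq_head_sub_le K hst hss).trans h1)

/-- Increments of the truncated wavelet levels, uniformly over the truncation and summably over the
scales. -/
lemma exists_increment_wavelet (hwav : IsWaveletPair φ ψ) (h : WaveletConditions φ ψ α γ)
    (hR : IsSpectralDensity R S) (hS : SpectralConditions S) :
    ∃ D : ℝ, 0 ≤ D ∧ ∀ (j K : ℕ) (s t : ℝ), s ≠ t →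
      eLpNorm (fun z => levelFreq ψ j (headCoeff K (shiftCoeff ψ j t)) z -
        levelFreq ψ j (headCoeff K (shiftCoeff ψ j s)) z) 2 (spectralMeasure S) ≤
        ENNReal.ofReal (D * ((1 + 2 * j) ^ α / 2 ^ j) / logWeight α (1 / |t - s|)) := by
  have hα : 0 < α := by linarith [h.alpha_gt]
  have hMb : ∀ u, ‖ft ψ u‖ ≤ ∫ x, ‖ψ x‖ := fun u => norm_ft_le u
  obtain ⟨D, hD0, hD⟩ := exists_tsum_norm_sq_increment_le hwav.assumptionS_wavelet
    hwav.continuous_wavelet h.integrable_ft_wavelet h.alpha_gt h.gamma_pos h.gamma_lt.le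
    (norm_sub_le_of_norm_deriv_le h.differentiable_ft_wavelet
      (norm_deriv_le_of_bounds h.differentiable_ft_wavelet h.differentiable_deriv_ft_wavelet
        hMb (norm_deriv2_ft_le_cψ'' h)))
    hMb h.integrable_log_wavelet
  have hA1 := A₁ψ_nonneg ψ S
  have hA := Aψ_nonneg ψ S
  have hV0 : 0 ≤ A₁ψ ψ S / 4 + Real.pi * Aψ ψ S := by positivity
  refine ⟨√(A₁ψ ψ S / 4 + Real.pi * Aψ ψ S) * D, by positivity, fun j K s t hts => ?_⟩
  have hw := logWeight_pos hα (1 / |t - s|)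
  have hst := summable_shiftCoeff hwav.assumptionS_wavelet hwav.continuous_wavelet j t
  have hss := summable_shiftCoeff hwav.assumptionS_wavelet hwav.continuous_wavelet j s
  have h1 := hD j s t hts
  simp only [levelFreq_sub j (summable_headCoeff _ K) (summable_headCoeff _ K)]
  have hp : (1 : ℝ) ≤ 2 ^ j := one_le_pow₀ (by norm_num)
  have hA' : A₁ψ ψ S / 4 / (2 ^ j) ^ 4 + Real.pi * Aψ ψ S / (2 ^ j) ^ 3 ≤
      (√(A₁ψ ψ S / 4 + Real.pi * Aψ ψ S) / 2 ^ j) ^ 2 := by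
    rw [div_pow, Real.sq_sqrt hV0, add_div]
    refine add_le_add ?_ ?_
    · exact div_le_div_of_nonneg_left (by positivity) (by positivity)
        (pow_le_pow_right₀ hp (by norm_num))
    · exact div_le_div_of_nonneg_left (by positivity) (by positivity)
        (pow_le_pow_right₀ hp (by norm_num))
  have key := eLpNorm_le_of_coeff_le hA' (by positivity) (by positivity)
    (b := D * (1 + 2 * (j : ℝ)) ^ α / logWeight α (1 / |t - s|)) (by positivity)
    (tsum_nonneg fun _ => sq_nonneg _)
    (lintegral_levelFreq_wavelet_le h hR hS j (summable_head_sub K _ _)).1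
    ((tsum_norm_sq_head_sub_le K hst hss).trans h1)
  refine key.trans (le_of_eq ?_)
  congr 1
  ring

lemma summable_rpow_div_two_pow (α : ℝ) :
    Summable fun j : ℕ => (1 + 2 * (j : ℝ)) ^ α / 2 ^ j := by
  obtain ⟨m, hm⟩ := exists_nat_ge α
  have h1 := summable_pow_mul_geometric_of_norm_lt_one (R := ℝ) m (r := 1 / 2) (by norm_num)
  have h2 := ((summable_nat_add_iff 1).2 h1).mul_left (2 ^ m * 2)
  refine Summable.of_nonneg_of_le (fun j => by positivity) (fun j => ?_) h2
  have hj : (0 : ℝ) ≤ j := Nat.cast_nonneg j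
  have h3 : (1 + 2 * (j : ℝ)) ^ α ≤ (2 * ((j : ℝ) + 1)) ^ m := by
    rw [← Real.rpow_natCast]
    exact (Real.rpow_le_rpow_of_exponent_le (by linarith) hm).trans
      (Real.rpow_le_rpow (by positivity) (by linarith) (Nat.cast_nonneg m))
  calc (1 + 2 * (j : ℝ)) ^ α / 2 ^ j ≤ (2 * ((j : ℝ) + 1)) ^ m / 2 ^ j := by gcongr
    _ = _ := by
      push_cast
      rw [mul_pow, pow_succ, one_div, inv_pow]
      field_simp

/-- The increments of the error are bounded uniformly over all truncations. -/
lemma exists_eLpNorm_increment_le (hwav : IsWaveletPair φ ψ) (h : WaveletConditions φ ψ α γ)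
    (hR : IsSpectralDensity R S) (hS : SpectralConditions S) :
    ∃ c : ℝ, 0 < c ∧ ∀ (n k₀' : ℕ) (k : ℕ → ℕ) (s t : ℝ), s ≠ t →
      eLpNorm (fun z => (expo t z - truncatedFreq φ ψ n k₀' k t z) -
        (expo s z - truncatedFreq φ ψ n k₀' k s z)) 2 (spectralMeasure S) ≤
        ENNReal.ofReal (sigma c α |t - s|) := by
  have hα : 0 < α := by linarith [h.alpha_gt]
  obtain ⟨D₁, h10, h1⟩ := exists_eLpNorm_expo_sub_le hα hR hS
  obtain ⟨D₂, h20, h2⟩ := exists_increment_scaling hwav h hR hS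
  obtain ⟨D₃, h30, h3⟩ := exists_increment_wavelet hwav h hR hS
  have hsum := (summable_rpow_div_two_pow α).mul_left D₃
  have hnn : ∀ j : ℕ, 0 ≤ D₃ * ((1 + 2 * (j : ℝ)) ^ α / 2 ^ j) := fun j => by positivity
  refine ⟨D₁ + D₂ + ∑' j : ℕ, D₃ * ((1 + 2 * (j : ℝ)) ^ α / 2 ^ j) + 1,
    by
      have : 0 ≤ ∑' j : ℕ, D₃ * ((1 + 2 * (j : ℝ)) ^ α / 2 ^ j) := tsum_nonneg hnn
      positivity, fun n k₀' k s t hts => ?_⟩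
  have hw := logWeight_pos hα (1 / |t - s|)
  rw [sigma_eq_div_logWeight _ _ (abs_nonneg _)]
  set w := logWeight α (1 / |t - s|)
  set μ := spectralMeasure S
  have cφ : ∀ r, Continuous (levelFreq φ 0 (headCoeff k₀' (shiftCoeff φ 0 r))) := fun r =>
    continuous_levelFreq h.differentiable_ft_scaling.continuous (summable_headCoeff _ _) 0
  have cψ : ∀ j r, Continuous (levelFreq ψ j (headCoeff (k j) (shiftCoeff ψ j r))) := fun j r =>
    continuous_levelFreq h.differentiable_ft_wavelet.continuous (summable_headCoeff _ _) j
  set F₁ : ℝ → ℂ := fun z => expo t z - expo s z with hF₁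
  set F₂ : ℝ → ℂ := fun z => levelFreq φ 0 (headCoeff k₀' (shiftCoeff φ 0 t)) z -
        levelFreq φ 0 (headCoeff k₀' (shiftCoeff φ 0 s)) z with hF₂
  set F₃ : ℕ → ℝ → ℂ := fun j z => levelFreq ψ j (headCoeff (k j) (shiftCoeff ψ j t)) z -
        levelFreq ψ j (headCoeff (k j) (shiftCoeff ψ j s)) z with hF₃
  have m1 : AEStronglyMeasurable F₁ μ :=
    ((continuous_expo t).sub (continuous_expo s)).aestronglyMeasurable
  have m2 : AEStronglyMeasurable F₂ μ := ((cφ t).sub (cφ s)).aestronglyMeasurable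
  have m3 : ∀ j, AEStronglyMeasurable (F₃ j) μ := fun j =>
    ((cψ j t).sub (cψ j s)).aestronglyMeasurable
  have m4 : AEStronglyMeasurable (∑ j ∈ Finset.range n, F₃ j) μ :=
    Finset.aestronglyMeasurable_sum _ fun j _ => m3 j
  have e : (fun z => (expo t z - truncatedFreq φ ψ n k₀' k t z) -
        (expo s z - truncatedFreq φ ψ n k₀' k s z)) =
      F₁ - (F₂ + ∑ j ∈ Finset.range n, F₃ j) := by
    ext z
    simp only [Pi.sub_apply, Pi.add_apply, Finset.sum_apply, hF₁, hF₂, hF₃, truncatedFreq,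
      Finset.sum_sub_distrib]
    ring
  rw [e]
  refine (eLpNorm_sub_le m1 (m2.add m4) (by norm_num)).trans ?_
  refine (add_le_add (h1 s t hts) ((eLpNorm_add_le m2 m4 (by norm_num)).trans
    (add_le_add (h2 k₀' s t hts) ((eLpNorm_sum_le (fun j _ => m3 j) (by norm_num)).trans
      (Finset.sum_le_sum fun j _ => h3 j (k j) s t hts))))).trans ?_
  rw [← ENNReal.ofReal_sum_of_nonneg fun j _ => div_nonneg (hnn j) hw.le,
    ← ENNReal.ofReal_add (by positivity) (Finset.sum_nonneg fun j _ => div_nonneg (hnn j) hw.le),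
    ← ENNReal.ofReal_add (by positivity) (add_nonneg (by positivity)
      (Finset.sum_nonneg fun j _ => div_nonneg (hnn j) hw.le))]
  refine ENNReal.ofReal_le_ofReal ?_
  rw [← Finset.sum_div, ← add_div, ← add_div]
  refine div_le_div_of_nonneg_right ?_ hw.le
  have := hsum.sum_le_tsum (Finset.range n) fun j _ => hnn j
  linarith

end

/-! ### The error process in the frequency domain -/

lemma integrable_conj_dilate {f : ℝ → ℂ} (hf : Integrable f) (j : ℕ) (l : ℤ) :
    Integrable fun u => conj (dilate f j l u) := by
  have h1 : Integrable fun u : ℝ => f (2 ^ j * u - l) :=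
    (hf.comp_sub_right (l : ℝ)).comp_mul_left' (by positivity)
  exact (Complex.conjCLE : ℂ →L[ℝ] ℂ).integrable_comp (h1.const_mul _)

lemma integral_conj_dilate_mul_expo (f : ℝ → ℂ) (j : ℕ) (l : ℤ) (z : ℝ) :
    ∫ u, conj (dilate f j l u) * expo u z =
      (((2 : ℝ) ^ ((j : ℝ) / 2) : ℝ) : ℂ)⁻¹ * (conj (ft f (z / 2 ^ j)) * expo l (z / 2 ^ j)) := by
  have hj : (0 : ℝ) < 2 ^ j := by positivity
  have hq : (0 : ℝ) < (2 : ℝ) ^ ((j : ℝ) / 2) := by positivity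
  have hqc : (((2 : ℝ) ^ ((j : ℝ) / 2) : ℝ) : ℂ) ≠ 0 := by exact_mod_cast hq.ne'
  have hq2 : (((2 : ℝ) ^ ((j : ℝ) / 2) : ℝ) : ℂ) ^ 2 = ((2 ^ j : ℝ) : ℂ) := by
    rw [← Complex.ofReal_pow, rpow_half_sq]
  set q : ℂ := (((2 : ℝ) ^ ((j : ℝ) / 2) : ℝ) : ℂ) with hqdef
  let G : ℝ → ℂ := fun x => q * (conj (f (x - l)) * expo x (z / 2 ^ j))
  have e1 : ∀ u : ℝ, conj (dilate f j l u) * expo u z = G (2 ^ j * u) := by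
    intro u
    have : expo (2 ^ j * u) (z / 2 ^ j) = expo u z := by
      unfold expo
      congr 1
      push_cast
      field_simp
    simp only [G, dilate, map_mul, Complex.conj_ofReal, this]
    ring
  have e2 : ∀ x : ℝ, G (x + l) = q * expo l (z / 2 ^ j) * conj (expo (-(z / 2 ^ j)) x * f x) := by
    intro x
    have h : expo (x + l) (z / 2 ^ j) = expo l (z / 2 ^ j) * expo (z / 2 ^ j) x := by
      unfold expo
      rw [← Complex.exp_add]
      congr 1
      push_cast
      ring
    simp only [G, add_sub_cancel_right, h, map_mul, conj_expo, neg_neg]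
    ring
  simp only [e1]
  rw [Measure.integral_comp_mul_left, ← integral_add_right_eq_self G (l : ℝ)]
  simp only [e2]
  rw [integral_const_mul, integral_conj, ← ft_eq_integral, abs_of_pos (inv_pos.2 hj),
    Complex.real_smul, Complex.ofReal_inv, ← hq2]
  field_simp

section

variable {Ω : Type*} [MeasurableSpace Ω] {P : Measure Ω} {X : ℝ → Ω → ℂ} {R : ℝ → ℂ} {S : ℝ → ℝ}
  {φ ψ : ℝ → ℂ} {α γ T : ℝ} {ξ : ℤ → Ω → ℂ} {η : ℕ → ℤ → Ω → ℂ}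

/-- The truncated level of the expansion corresponds to the level of the frequency with the
coefficients in the window. -/
lemma represents_level (hX : ∀ t, MemLp (X t) 2 P) (hS : Integrable S)
    (hS2 : MemLp (fun z : ℝ => z) 2 (spectralMeasure S)) {f : ℝ → ℂ} (hf : Integrable f) {j : ℕ}
    (hξ : ∀ l, IsMeanSquareIntegral P X (fun t => conj (dilate f j l t)) (ξ l)) (K : ℕ) (t : ℝ) :
    Represents hX hS
      (fun ω => ∑ l ∈ Finset.Icc (-(K : ℤ)) (K : ℤ), ξ l ω * dilate f j l t)
      (levelFreq f j (headCoeff K (shiftCoeff f j t))) := by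
  have hq : (((2 : ℝ) ^ ((j : ℝ) / 2) : ℝ) : ℂ) ≠ 0 := by
    have : (0 : ℝ) < (2 : ℝ) ^ ((j : ℝ) / 2) := by positivity
    exact_mod_cast this.ne'
  have h := Represents.sum (s := Finset.Icc (-(K : ℤ)) (K : ℤ)) fun l _ =>
    (represents_of_isMeanSquareIntegral hX hS hS2 (integrable_conj_dilate hf j l)
      (hξ l)).mul_const (dilate f j l t)
  convert h using 1
  ext z
  have hz : 2 * Real.pi * (z / (2 * Real.pi * 2 ^ j)) = z / 2 ^ j := by
    field_simp
  unfold levelFreq trig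
  rw [tsum_eq_sum (s := Finset.Icc (-(K : ℤ)) (K : ℤ)) fun l hl => by
    rw [headCoeff, if_neg hl, zero_mul], Finset.mul_sum]
  refine Finset.sum_congr rfl fun l hl => ?_
  rw [integral_conj_dilate_mul_expo, headCoeff, if_pos hl, shiftCoeff, dilate, hz]
  field_simp

/-- The error process corresponds to the error of the truncated expansion of the exponential. -/
lemma represents_error (hX : ∀ t, MemLp (X t) 2 P) (hR : IsSpectralDensity R S)
    (hS : SpectralConditions S) (hwav : IsWaveletPair φ ψ)
    (hξ : ∀ l, IsMeanSquareIntegral P X (fun t => conj (dilate φ 0 l t)) (ξ l))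
    (hη : ∀ j l, IsMeanSquareIntegral P X (fun t => conj (dilate ψ j l t)) (η j l))
    (n k₀' : ℕ) (k : ℕ → ℕ) (t : ℝ) :
    Represents hX hR.integrable (fun ω => X t ω - truncatedExpansion φ ψ ξ η n k₀' k t ω)
      (fun z => expo t z - truncatedFreq φ ψ n k₀' k t z) := by
  have hS2 := memLp_id_spectralMeasure hR hS
  have hφ := hwav.assumptionS_scaling.integrable hwav.continuous_scaling
  have hψ := hwav.assumptionS_wavelet.integrable hwav.continuous_wavelet
  exact (represents_self hX hR.integrable t).sub
    ((represents_level hX hR.integrable hS2 hφ hξ k₀' t).add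
      (Represents.sum fun j _ => represents_level hX hR.integrable hS2 hψ (hη j) (k j) t))

/-- Separability is not affected by subtracting a process with continuous paths. -/
lemma IsSeparableOn.sub_continuous {I : Set ℝ} (h : IsSeparableOn P X I) {Z : ℝ → Ω → ℂ}
    (hZ : ∀ ω, Continuous fun t => Z t ω) : IsSeparableOn P (fun t ω => X t ω - Z t ω) I := by
  obtain ⟨D, hD, hDI, hae⟩ := h
  refine ⟨D, hD, hDI, ?_⟩
  filter_upwards [hae] with ω hω t ht U hU htU
  rw [Metric.mem_closure_iff]
  intro ε hε
  have hV : IsOpen {s | dist (Z t ω) (Z s ω) < ε / 2} :=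
    isOpen_lt (continuous_const.dist (hZ ω)) continuous_const
  have hmem := hω t ht (U ∩ {s | dist (Z t ω) (Z s ω) < ε / 2}) (hU.inter hV)
    ⟨htU, by rw [Set.mem_ofPred_eq, dist_self]; positivity⟩
  obtain ⟨_, ⟨s, ⟨hsD, hsU, hsV⟩, rfl⟩, hs⟩ := Metric.mem_closure_iff.1 hmem (ε / 2) (by positivity)
  refine ⟨_, ⟨s, ⟨hsD, hsU⟩, rfl⟩, ?_⟩
  rw [Set.mem_ofPred_eq] at hsV
  have := dist_sub_sub_le (X t ω) (Z t ω) (X s ω) (Z s ω)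
  linarith

end

lemma continuous_dilate {f : ℝ → ℂ} (hf : Continuous f) (j : ℕ) (l : ℤ) :
    Continuous (dilate f j l) := by
  unfold dilate
  fun_prop

lemma continuous_truncatedExpansion {Ω : Type*} {φ ψ : ℝ → ℂ} {ξ : ℤ → Ω → ℂ}
    {η : ℕ → ℤ → Ω → ℂ} (hφ : Continuous φ) (hψ : Continuous ψ) (n k₀' : ℕ)
    (k : ℕ → ℕ) (ω : Ω) : Continuous fun t => truncatedExpansion φ ψ ξ η n k₀' k t ω := by
  have h1 := continuous_dilate hφ
  have h2 := continuous_dilate hψ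
  unfold truncatedExpansion
  fun_prop

/-! ### The error level -/

lemma div_two_pow_mul_sqrt_le {A : ℝ} (hA : 0 ≤ A) (j : ℕ) {m : ℕ} (hm : 1 ≤ m) :
    A / ((2 : ℝ) ^ ((j : ℝ) / 2) * √(m : ℝ)) ≤ A / (2 : ℝ) ^ ((j : ℝ) / 2) := by
  have h1 : 1 ≤ √(m : ℝ) := by
    rw [Real.one_le_sqrt]
    exact_mod_cast hm
  refine div_le_div_of_nonneg_left hA (by positivity) ?_
  exact le_mul_of_one_le_right (by positivity) h1

lemma epsK_nonneg {A B C : ℝ} (hA : 0 ≤ A) (hB : 0 ≤ B) (hC : 0 ≤ C) (n k₀' : ℕ) (k : ℕ → ℕ) :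
    0 ≤ epsK A B C n k₀' k := by
  unfold epsK
  positivity

lemma epsK_le {A B C : ℝ} (hA : 0 ≤ A) (hB : 0 ≤ B) (hC : 0 ≤ C) {n k₀' : ℕ} {k : ℕ → ℕ}
    (hk₀ : 1 ≤ k₀') (hk : ∀ j, j < n → 1 ≤ k j) :
    epsK A B C n k₀' k ≤ (2 + √2) * A + B + C := by
  unfold epsK
  have h1 : ∑ j ∈ Finset.range n, A / ((2 : ℝ) ^ ((j : ℝ) / 2) * √(k j : ℝ)) ≤
      (2 + √2) * A := by
    refine (Finset.sum_le_sum fun j hj =>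
      div_two_pow_mul_sqrt_le hA j (hk j (Finset.mem_range.1 hj))).trans ?_
    have := sum_geometric_tail_le hA 0 n
    simpa using this
  have h2 : B / √(k₀' : ℝ) ≤ B := by
    refine div_le_self hB ?_
    rw [Real.one_le_sqrt]
    exact_mod_cast hk₀
  have h3 : C / (2 : ℝ) ^ ((n : ℝ) / 2) ≤ C :=
    div_le_self hC (Real.one_le_rpow (by norm_num) (by positivity))
  linarith

lemma summable_div_two_pow_half {A : ℝ} (hA : 0 ≤ A) :
    Summable fun j : ℕ => A / (2 : ℝ) ^ ((j : ℝ) / 2) := by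
  refine summable_of_sum_range_le (c := (2 + √2) * A) (fun j => by positivity) fun n => ?_
  have := sum_geometric_tail_le hA 0 n
  simpa using this

lemma tendsto_div_sqrt_cast (A : ℝ) {m : ℕ → ℕ} (hm : Tendsto m atTop atTop) :
    Tendsto (fun i => A / √(m i : ℝ)) atTop (𝓝 0) :=
  tendsto_const_nhds.div_atTop
    (Real.tendsto_sqrt_atTop.comp (tendsto_natCast_atTop_atTop.comp hm))

/-- The sum over the scales is treated by dominated convergence. -/
lemma tendsto_epsK {A B C : ℝ} (hA : 0 ≤ A) {n k₀' : ℕ → ℕ} {k : ℕ → ℕ → ℕ}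
    (hk : ∀ i j, 1 ≤ k i j) (hn : Tendsto n atTop atTop) (hk₀ : Tendsto k₀' atTop atTop)
    (hkt : ∀ j, Tendsto (fun i => k i j) atTop atTop) :
    Tendsto (fun i => epsK A B C (n i) (k₀' i) (k i)) atTop (𝓝 0) := by
  have h1 : Tendsto (fun i => ∑ j ∈ Finset.range (n i),
      A / ((2 : ℝ) ^ ((j : ℝ) / 2) * √(k i j : ℝ))) atTop (𝓝 0) := by
    have e : ∀ i, ∑ j ∈ Finset.range (n i), A / ((2 : ℝ) ^ ((j : ℝ) / 2) * √(k i j : ℝ)) =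
        ∑' j, if j ∈ Finset.range (n i) then
          A / ((2 : ℝ) ^ ((j : ℝ) / 2) * √(k i j : ℝ)) else 0 := fun i => by
      rw [tsum_eq_sum (s := Finset.range (n i)) fun j hj => if_neg hj]
      exact Finset.sum_congr rfl fun j hj => (if_pos hj).symm
    have h := tendsto_tsum_of_dominated_convergence (𝓕 := atTop)
      (f := fun i j => if j ∈ Finset.range (n i) then
          A / ((2 : ℝ) ^ ((j : ℝ) / 2) * √(k i j : ℝ)) else 0) (g := fun _ => (0 : ℝ))
      (summable_div_two_pow_half hA) (fun j => ?_) (Eventually.of_forall fun i j => ?_)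
    · rw [tsum_zero] at h
      exact h.congr fun i => (e i).symm
    · have h2 := tendsto_div_sqrt_cast (A / (2 : ℝ) ^ ((j : ℝ) / 2)) (hkt j)
      refine squeeze_zero (fun i => ?_) (fun i => ?_) h2
      · split_ifs
        · positivity
        · exact le_rfl
      · split_ifs
        · rw [div_div]
        · positivity
    · split_ifs
      · rw [Real.norm_of_nonneg (by positivity)]
        exact div_two_pow_mul_sqrt_le hA j (hk i j)
      · rw [norm_zero]
        positivity
  have h2 := tendsto_div_sqrt_cast B hk₀
  have h3 : Tendsto (fun i => C / (2 : ℝ) ^ ((n i : ℝ) / 2)) atTop (𝓝 0) := by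
    refine tendsto_const_nhds.div_atTop ?_
    have := (Real.tendsto_exp_atTop.comp ((tendsto_natCast_atTop_atTop.comp hn).const_mul_atTop
      (show (0 : ℝ) < Real.log 2 / 2 by have := Real.log_pos one_lt_two; positivity)))
    refine this.congr fun i => ?_
    simp only [Function.comp]
    rw [Real.rpow_def_of_pos two_pos]
    congr 1
    ring
  have := (h1.add h2).add h3
  simpa [epsK] using this

/-- For small `ε` the entropy function `δ(ε)` is of order `ε^{1 - 1/(2α)}`, and `α > 1/2`. -/
lemma tendsto_delta {c α T : ℝ} (hα : 1 / 2 < α) (hc : 0 < c) (hT : 0 < T) :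
    Tendsto (delta c α T) (𝓝[>] 0) (𝓝 0) := by
  have hα0 : 0 < α := by linarith
  set p : ℝ := 1 / (2 * α) with hp
  have hp1 : p < 1 := by rw [hp, div_lt_one (by linarith)]; linarith
  have hσ : 0 < sigma c α (T / 2) := by
    have := log_exp_add_pos hα0 (x := 1 / (T / 2)) (by positivity)
    unfold sigma
    positivity
  have h1 : Tendsto (fun ε : ℝ => ε / √2 * √(Real.log (T + 1)) +
      ε ^ (1 - p) * (c ^ p * (1 - p)⁻¹ / √2)) (𝓝[>] 0) (𝓝 0) := by
    have hcont : ContinuousAt (fun ε : ℝ => ε / √2 * √(Real.log (T + 1)) +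
        ε ^ (1 - p) * (c ^ p * (1 - p)⁻¹ / √2)) 0 := by
      have : ContinuousAt (fun ε : ℝ => ε ^ (1 - p)) 0 :=
        Real.continuousAt_rpow_const _ _ (Or.inr (by linarith))
      fun_prop
    have h := hcont.tendsto.mono_left (nhdsWithin_le_nhds (s := Set.Ioi 0))
    simpa [Real.zero_rpow (show 1 - p ≠ 0 by linarith)] using h
  refine h1.congr' ?_
  filter_upwards [Ioo_mem_nhdsGT hσ] with ε hε
  rw [delta_eq_of_le hε.2.le, Real.div_rpow hc.le hε.1.le, Real.rpow_sub hε.1, Real.rpow_one,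
    ← hp]
  ring

/-- If `32 δ ≤ u`, then `√(8uδ) ≤ u/2`. -/
lemma div_le_sq_sub_sqrt_div {u δ ε : ℝ} (hu : 0 < u) (hδ : 32 * δ ≤ u) :
    u ^ 2 / 8 / ε ^ 2 ≤ (u - √(8 * u * δ)) ^ 2 / (2 * ε ^ 2) := by
  have h1 : √(8 * u * δ) ≤ u / 2 := by
    rw [Real.sqrt_le_left (by positivity)]
    nlinarith
  have h2 : (u / 2) ^ 2 ≤ (u - √(8 * u * δ)) ^ 2 :=
    pow_le_pow_left₀ (by positivity) (by linarith) 2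
  have e : u ^ 2 / 8 / ε ^ 2 = (u / 2) ^ 2 / (2 * ε ^ 2) := by
    rw [div_div, div_pow, div_div, show (8 : ℝ) * ε ^ 2 = 2 ^ 2 * (2 * ε ^ 2) by ring]
  rw [e]
  gcongr

end WaveletExpansion

theorem theorem2 (φ ψ : ℝ → ℂ) (α γ : ℝ) (R : ℝ → ℂ) (S : ℝ → ℝ) (T : ℝ)
    (hT : 0 < T)
    (hwav : WaveletExpansion.IsWaveletPair φ ψ)
    (hcond : WaveletExpansion.WaveletConditions φ ψ α γ)
    (hspec : WaveletExpansion.IsSpectralDensity R S)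
    (hScond : WaveletExpansion.SpectralConditions S) :
    -- the constants depend only on the wavelets, the exponents, the covariance function and `T`
    ∃ c B : ℝ, 0 ≤ c ∧ 0 ≤ B ∧
      (Integrable (deriv (WaveletExpansion.ft φ)) → B = WaveletExpansion.constB φ S T) ∧
      -- the error level tends to zero when `n`, `k₀'` and all `k_j` tend to infinity
      (∀ (n k₀' : ℕ → ℕ) (k : ℕ → ℕ → ℕ), (∀ i j, 1 ≤ k i j) →
        Tendsto n atTop atTop → Tendsto k₀' atTop atTop →
        (∀ j, Tendsto (fun i => k i j) atTop atTop) →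
        Tendsto (fun i => WaveletExpansion.epsK (WaveletExpansion.constA ψ S T) B
          (WaveletExpansion.constC ψ S T) (n i) (k₀' i) (k i)) atTop (𝓝 0)) ∧
      ∀ (Ω : Type*) [MeasurableSpace Ω] (P : Measure Ω) [IsProbabilityMeasure P]
        (X : ℝ → Ω → ℂ) (ξ : ℤ → Ω → ℂ) (η : ℕ → ℤ → Ω → ℂ),
        WaveletExpansion.IsStationaryGaussian P X R →
        WaveletExpansion.IsSeparableOn P X (Set.Icc 0 T) →
        (∀ l, WaveletExpansion.IsMeanSquareIntegral P X
          (fun t => conj (WaveletExpansion.dilate φ 0 l t)) (ξ l)) →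
        (∀ j l, WaveletExpansion.IsMeanSquareIntegral P X
          (fun t => conj (WaveletExpansion.dilate ψ j l t)) (η j l)) →
        (∀ (n k₀' : ℕ) (k : ℕ → ℕ), 1 ≤ n → 1 ≤ k₀' → (∀ j, j < n → 1 ≤ k j) →
          -- `c` bounds the mean-square increments of the error process
          (∀ s ∈ Set.Icc 0 T, ∀ t ∈ Set.Icc 0 T, s ≠ t →
            eLpNorm (fun ω =>
              (X t ω - WaveletExpansion.truncatedExpansion φ ψ ξ η n k₀' k t ω) -
              (X s ω - WaveletExpansion.truncatedExpansion φ ψ ξ η n k₀' k s ω)) 2 P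
              ≤ ENNReal.ofReal (WaveletExpansion.sigma c α |t - s|)) ∧
          -- the exponential bound
          (∀ ε : ℝ, ε = WaveletExpansion.epsK (WaveletExpansion.constA ψ S T) B
              (WaveletExpansion.constC ψ S T) n k₀' k →
            ∀ u : ℝ, 8 * WaveletExpansion.delta c α T ε < u →
              P {ω | ENNReal.ofReal u < ⨆ t ∈ Set.Icc 0 T,
                  ‖X t ω - WaveletExpansion.truncatedExpansion φ ψ ξ η n k₀' k t ω‖ₑ}
                ≤ ENNReal.ofReal (2 * Real.exp
                  (-((u - √(8 * u * WaveletExpansion.delta c α T ε)) ^ 2 / (2 * ε ^ 2)))))) ∧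
        -- for every level `u` the rate of convergence is exponential
        (∀ u : ℝ, 0 < u → ∃ κ : ℝ, 0 < κ ∧ ∃ ε₀ : ℝ, 0 < ε₀ ∧
          ∀ (n k₀' : ℕ) (k : ℕ → ℕ), 1 ≤ n → 1 ≤ k₀' → (∀ j, j < n → 1 ≤ k j) →
          ∀ ε : ℝ, ε = WaveletExpansion.epsK (WaveletExpansion.constA ψ S T) B
              (WaveletExpansion.constC ψ S T) n k₀' k → ε ≤ ε₀ →
            P {ω | ENNReal.ofReal u < ⨆ t ∈ Set.Icc 0 T,
                ‖X t ω - WaveletExpansion.truncatedExpansion φ ψ ξ η n k₀' k t ω‖ₑ}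
              ≤ ENNReal.ofReal (2 * Real.exp (-(κ / ε ^ 2)))) := by
  open WaveletExpansion in
  have hα := hcond.alpha_gt
  have hα0 : 0 < α := by linarith
  have hA := constA_nonneg ψ S hT.le
  have hC := constC_nonneg ψ S T
  obtain ⟨B, hB0, hBeq, hB⟩ := exists_const_tail_scaling hwav hcond hspec hScond hT.le
  obtain ⟨c₁, hc₁, hincr⟩ := exists_eLpNorm_increment_le hwav hcond hspec hScond
  -- all error levels are at most `(2 + √2) A + B + C`; the summand `1` keeps the bound positive
  obtain ⟨Λ, hΛ, hsup⟩ := exists_const_measure_sup_gt_le hα hT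
    (E := (2 + √2) * constA ψ S T + B + constC ψ S T + 1) (by positivity) hc₁
  -- the constant has to dominate the increments and to be large enough for the chaining
  obtain ⟨-, hsup⟩ := hsup (max c₁ Λ) (le_max_right _ _)
  have hc : 0 < max c₁ Λ := hc₁.trans_le (le_max_left _ _)
  set c := max c₁ Λ with hcdef
  refine ⟨c, B, hc.le, hB0, hBeq, fun n k₀' k hk hn hk₀ hkt => tendsto_epsK hA hk hn hk₀ hkt, ?_⟩
  intro Ω _ P _ X ξ η hG hsep hξ hη
  have hX : ∀ t, MemLp (X t) 2 P := (hξ 0).choose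
  have hrep := represents_error hX hspec hScond hwav hξ hη
  have hinc : ∀ (n k₀' : ℕ) (k : ℕ → ℕ) (s t : ℝ), s ≠ t →
      eLpNorm (fun ω => (X t ω - truncatedExpansion φ ψ ξ η n k₀' k t ω) -
        (X s ω - truncatedExpansion φ ψ ξ η n k₀' k s ω)) 2 P ≤
        ENNReal.ofReal (sigma c₁ α |t - s|) := fun n k₀' k s t hst => by
    rw [((hrep n k₀' k t).sub (hrep n k₀' k s)).eLpNorm_eq (hR := hspec) hG]
    exact hincr n k₀' k s t hst
  have hmain : ∀ (n k₀' : ℕ) (k : ℕ → ℕ), 1 ≤ n → 1 ≤ k₀' → (∀ j, j < n → 1 ≤ k j) →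
      ∀ ε : ℝ, ε = epsK (constA ψ S T) B (constC ψ S T) n k₀' k →
      ∀ u : ℝ, 8 * delta c α T ε < u →
        P {ω | ENNReal.ofReal u < ⨆ t ∈ Set.Icc 0 T,
            ‖X t ω - truncatedExpansion φ ψ ξ η n k₀' k t ω‖ₑ}
          ≤ ENNReal.ofReal (2 * Real.exp
            (-((u - √(8 * u * delta c α T ε)) ^ 2 / (2 * ε ^ 2)))) := by
    intro n k₀' k hn hk₀ hk ε hε u hu
    have hε0 : 0 ≤ ε := hε ▸ epsK_nonneg hA hB0 hC n k₀' k
    have hεE : ε ≤ (2 + √2) * constA ψ S T + B + constC ψ S T + 1 := by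
      rw [hε]
      linarith [epsK_le hA hB0 hC hk₀ hk]
    -- for `ε = 0` the division by zero makes the right-hand side equal to `2`
    rcases hε0.eq_or_lt with h0 | h0
    · rw [← h0]
      refine prob_le_one.trans ?_
      simp
    · refine hsup h0 hεE (fun t => ?_) (fun t _ => (hrep n k₀' k t).gaussianTail hG)
        (fun a _ b _ => ((hrep n k₀' k a).sub (hrep n k₀' k b)).gaussianTail hG) (fun t ht => ?_)
        (fun a _ b _ hab => hinc n k₀' k b a hab.symm)
        (hsep.sub_continuous fun ω => continuous_truncatedExpansion hwav.continuous_scaling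
          hwav.continuous_wavelet n k₀' k ω) hu
      · obtain ⟨hY, -⟩ := hrep n k₀' k t
        exact hY.aestronglyMeasurable
      · rw [(hrep n k₀' k t).eLpNorm_eq (hR := hspec) hG, hε]
        exact eLpNorm_expo_sub_truncatedFreq_le hwav hcond hspec hScond hB0 hB hn hk₀ hk ht
  refine ⟨fun n k₀' k hn hk₀ hk => ⟨fun s _ t _ hst => (hinc n k₀' k s t hst).trans
    (ENNReal.ofReal_le_ofReal (sigma_le_sigma_left (le_max_left _ _) hα0 (abs_nonneg _))),
    hmain n k₀' k hn hk₀ hk⟩, fun u hu => ?_⟩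
  obtain ⟨b, hb, hδ⟩ := mem_nhdsGT_iff_exists_Ioc_subset.1
    ((tendsto_delta hα hc hT).eventually (gt_mem_nhds (show (0 : ℝ) < u / 32 by positivity)))
  -- once `δ(ε) < u/32`, the deviation `u - √(8uδ)` is at least `u/2`
  refine ⟨u ^ 2 / 8, by positivity, b, hb, fun n k₀' k hn hk₀ hk ε hε hεb => ?_⟩
  have hε0 : 0 ≤ ε := hε ▸ epsK_nonneg hA hB0 hC n k₀' k
  rcases hε0.eq_or_lt with h0 | h0
  · rw [← h0]
    refine prob_le_one.trans ?_
    simp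
  · have h1 : delta c α T ε < u / 32 := hδ ⟨h0, hεb⟩
    refine (hmain n k₀' k hn hk₀ hk ε hε u (by linarith)).trans (ENNReal.ofReal_le_ofReal ?_)
    exact mul_le_mul_of_nonneg_left (Real.exp_le_exp.2 (neg_le_neg
      (div_le_sq_sub_sqrt_div hu (by linarith)))) two_pos.le
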